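/- **Setting.** Let $\mathcal M$ be a compact, path-connected, smooth Riemannian manifold of dimension $d\ge 1$, possibly with boundary or corners, with Riemannian distance $d_{\mathcal M}$ and Riemannian volume $\mathcal V_{\mathcal M}$. Let $N>2$ firms choose prices $p_i\in[c,\infty)$, where $c\ge 0$ is the unit cost, and locations $y_i\in\mathcal M$. For $\beta>0$ (the rationality of consumers) a consumer at $x\in\mathcal M$ buys from firm $i$ with probability $$f_i(x)=\frac{e^{-\beta(d_{\mathcal M}(x,y_i)+p_i)}}{\sum_{k=1}^N e^{-\beta(d_{\mathcal M}(x,y_k)+p_k)}},$$ and firm $i$ earns $$\Pi_i=(p_i-c)\,\frac1{\mathcal V_{\mathcal M}(\mathcal M)}\int_{\mathcal M}f_i\,d\mathcal V_{\mathcal M}.$$ Perfectly rational consumers ($\beta\to+\infty$) choose uniformly among the firms that minimise $d_{\mathcal M}(x,y_i)+p_i$; this is the pointwise limit of $f_i(x)$. A profile $(\mathbf p,\mathbf y)$ with all $p_i\ge c$ is a Nash equilibrium if no firm can increase its profit by changing its own price in $[c,\infty)$ and its own location in $\mathcal M$. It is a local Nash equilibrium if no firm can do so by a sufficiently small such change.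 It is concentrated if $y_1=\dots=y_N$. **Theorem.** There is a threshold $\bar\beta>0$, depending only on $\mathcal M$ and $N$, such that the following hold for every $\beta>\bar\beta$ and every $c\ge 0$. 1. No concentrated profile is a Nash equilibrium, and none is even a local Nash equilibrium. 2. The second-order (Hessian) condition fails at concentrated configurations. Let $\bar y$ be an interior point of $\mathcal M$ and $\bar p>c$, and let all firms be at $(\bar p,\bar y)$. If $\Pi_i$ is twice differentiable in $y_i$ at this profile and $\nabla_{y_i}\Pi_i=0$ there, then $\nabla^2_{y_i}\Pi_i(v,v)>0$ for some tangent vector $v$ at $\bar y$. In particular $\nabla^2_{y_i}\Pi_i$ is not negative (semi)definite. Moreover, when consumers are perfectly rational, for every $c\ge 0$ no concentrated profile is a Nash equilibrium, nor even a local one. -/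

import Mathlib

open Set Filter Topology MeasureTheory Manifold Bundle
open scoped ContDiff ENNReal

noncomputable section

section Volume

variable {d : ℕ} {H : Type*} [TopologicalSpace H]
  (I : ModelWithCorners ℝ (EuclideanSpace ℝ (Fin d)) H)
  {M : Type*} [TopologicalSpace M] [ChartedSpace H M]
  [RiemannianBundle (fun x : M => TangentSpace I x)]

/-- The `i`-th coordinate vector field `∂ᵢ` of the chart centred at `x₀`, at the point of `M`
with coordinates `z`. -/
def coordField (x₀ : M) (i : Fin d) (z : EuclideanSpace ℝ (Fin d)) :
    TangentSpace I ((extChartAt I x₀).symm z) :=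
  mfderivWithin 𝓘(ℝ, EuclideanSpace ℝ (Fin d)) I (extChartAt I x₀).symm (range I) z
    (EuclideanSpace.single i (1 : ℝ) : EuclideanSpace ℝ (Fin d))

/-- The matrix `g = (⟨∂ᵢ, ∂ⱼ⟩)` of the Riemannian metric in the chart centred at `x₀`. -/
def metricMatrix (x₀ : M) (z : EuclideanSpace ℝ (Fin d)) : Matrix (Fin d) (Fin d) ℝ :=
  Matrix.of fun i j => inner ℝ (coordField I x₀ i z) (coordField I x₀ j z)

/-- The measure `√(det g) dz` of the chart centred at `x₀`, transported to `M` (it is carried by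
the domain of the chart). -/
def chartVolume [MeasurableSpace M] (x₀ : M) : Measure M :=
  Measure.map (extChartAt I x₀).symm
    ((volume.restrict (extChartAt I x₀).target).withDensity
      fun z => ENNReal.ofReal (Real.sqrt (metricMatrix I x₀ z).det))

variable (M) in
/-- The Riemannian volume measure of `M`. The measures `√(det g) dz` of two charts agree on the
overlap of their domains, so the measure that they glue to is their supremum. -/
def riemannianVolume [MeasurableSpace M] : Measure M :=
  ⨆ x₀ : M, chartVolume I x₀

end Volume

section Choice

variable {N : ℕ} {M : Type*}

variable (N M) in
/-- A consumer choice rule: for prices `p` and locations `y` of the `N` firms, `f p y i x` is the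
probability that a consumer located at `x` buys from firm `i`. -/
abbrev ChoiceRule : Type _ := (Fin N → ℝ) → (Fin N → M) → Fin N → M → ℝ

/-- The softmin rule with rationality `β`. -/
def softminChoice [Dist M] (β : ℝ) : ChoiceRule N M := fun p y i x =>
  Real.exp (-β * (dist x (y i) + p i)) / ∑ k, Real.exp (-β * (dist x (y k) + p k))

/-- The firms of minimal total cost (distance plus price) for a consumer at `x`. -/
def cheapestFirms [Dist M] (p : Fin N → ℝ) (y : Fin N → M) (x : M) : Finset (Fin N) :=
  open Classical in
  Finset.univ.filter fun i => ∀ k, dist x (y i) + p i ≤ dist x (y k) + p k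

/-- The choice rule of perfectly rational consumers: they buy at a firm of minimal total cost, each
such firm being equally likely. This is the limit of the softmin rule as `β → ∞`, see
`tendsto_softminChoice`. -/
def rationalChoice [Dist M] : ChoiceRule N M := fun p y i x =>
  open Classical in
  if i ∈ cheapestFirms p y x then ((cheapestFirms p y x).card : ℝ)⁻¹ else 0

theorem tendsto_softminChoice [Dist M] (p : Fin N → ℝ) (y : Fin N → M) (i : Fin N) (x : M) :
    Tendsto (fun β : ℝ => softminChoice β p y i x) atTop (𝓝 (rationalChoice p y i x)) := by
  classical
  set a : Fin N → ℝ := fun k => dist x (y k) + p k with ha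
  have hne : (Finset.univ : Finset (Fin N)).Nonempty := ⟨i, Finset.mem_univ i⟩
  obtain ⟨m, -, hm⟩ := Finset.exists_min_image Finset.univ a hne
  have hm' : ∀ k, a m ≤ a k := fun k => hm k (Finset.mem_univ k)
  have hmem : ∀ j, j ∈ cheapestFirms p y x ↔ a j = a m := by
    intro j
    simp only [cheapestFirms, Finset.mem_filter, Finset.mem_univ, true_and]
    exact ⟨fun h => le_antisymm (h m) (hm' j), fun h k => h.le.trans (hm' k)⟩
  have hlim : ∀ j, Tendsto (fun β : ℝ => Real.exp (-β * (a j - a m))) atTop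
      (𝓝 (if a j = a m then 1 else 0)) := by
    intro j
    by_cases h : a j = a m
    · simp [h]
    · have hpos : 0 < a j - a m := sub_pos.2 (lt_of_le_of_ne (hm' j) (Ne.symm h))
      simp only [h, if_false]
      refine Real.tendsto_exp_atBot.comp ?_
      exact (tendsto_neg_atTop_atBot (G := ℝ)).atBot_mul_const hpos
  have hsum := tendsto_finsetSum Finset.univ fun k _ => hlim k
  have hcard : (∑ k, if a k = a m then (1 : ℝ) else 0) = ((cheapestFirms p y x).card : ℝ) := by
    rw [Finset.sum_boole]
    congr 2
    ext j
    simp [hmem]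
  rw [hcard] at hsum
  have hc : ((cheapestFirms p y x).card : ℝ) ≠ 0 := by
    have : m ∈ cheapestFirms p y x := (hmem m).2 rfl
    exact_mod_cast (Finset.card_pos.2 ⟨m, this⟩).ne'
  have key := (hlim i).div hsum hc
  have hval : (if a i = a m then (1 : ℝ) else 0) / ((cheapestFirms p y x).card : ℝ)
      = rationalChoice p y i x := by
    by_cases h : a i = a m <;> simp [rationalChoice, hmem, h]
  rw [hval] at key
  refine key.congr fun β => ?_
  have hfac : ∀ j, Real.exp (-β * (a j - a m)) = Real.exp (-β * a j) * Real.exp (β * a m) := by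
    intro j
    rw [← Real.exp_add]
    ring_nf
  simp only [Pi.div_apply, hfac, ← Finset.sum_mul, softminChoice]
  exact mul_div_mul_right _ _ (Real.exp_pos _).ne'

end Choice

section Game

variable {d : ℕ} {H : Type*} [TopologicalSpace H]
  (I : ModelWithCorners ℝ (EuclideanSpace ℝ (Fin d)) H)
  {M : Type*} [TopologicalSpace M] [ChartedSpace H M]
  [RiemannianBundle (fun x : M => TangentSpace I x)] [MeasurableSpace M] {N : ℕ}

/-- The demand of firm `i`: the average over `M`, for the Riemannian volume, of the probability
that a consumer chooses firm `i`. -/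
def demand (f : ChoiceRule N M) (p : Fin N → ℝ) (y : Fin N → M) (i : Fin N) : ℝ :=
  ⨍ x, f p y i x ∂(riemannianVolume I M)

/-- The profit of firm `i` when the unit cost of production is `c`. -/
def profit (f : ChoiceRule N M) (c : ℝ) (p : Fin N → ℝ) (y : Fin N → M) (i : Fin N) : ℝ :=
  (p i - c) * demand I f p y i

/-- The profit of firm `i` when it alone changes its price to `q.1` and its location to `q.2`. -/
def deviationProfit (f : ChoiceRule N M) (c : ℝ) (p : Fin N → ℝ) (y : Fin N → M) (i : Fin N)
    (q : ℝ × M) : ℝ :=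
  profit I f c (Function.update p i q.1) (Function.update y i q.2) i

/-- Nash equilibrium of the game in which every firm chooses its price in `[c, ∞)` and its location
in `M`: no firm has a profitable deviation. -/
def IsNashEquilibrium (f : ChoiceRule N M) (c : ℝ) (p : Fin N → ℝ) (y : Fin N → M) : Prop :=
  (∀ i, c ≤ p i) ∧
    ∀ i, ∀ q ∈ Ici c ×ˢ (univ : Set M), deviationProfit I f c p y i q ≤ profit I f c p y i

/-- Local Nash equilibrium: no firm has a profitable deviation to strategies close to its own. -/
def IsLocalNashEquilibrium (f : ChoiceRule N M) (c : ℝ) (p : Fin N → ℝ) (y : Fin N → M) : Prop :=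
  (∀ i, c ≤ p i) ∧
    ∀ i, ∀ᶠ q in 𝓝[Ici c ×ˢ (univ : Set M)] (p i, y i),
      deviationProfit I f c p y i q ≤ profit I f c p y i

/-- A profile of locations is concentrated if all firms are at the same point. -/
def IsConcentrated (y : Fin N → M) : Prop := ∀ i j, y i = y j

/-- The profit of firm `i` as a function of the coordinates `z` of its own location, in the chart
centred at its present location `y i`; everything else is kept fixed. -/
def locationProfit (f : ChoiceRule N M) (c : ℝ) (p : Fin N → ℝ) (y : Fin N → M) (i : Fin N)
    (z : EuclideanSpace ℝ (Fin d)) : ℝ :=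
  deviationProfit I f c p y i (p i, (extChartAt I (y i)).symm z)

/-- The profit of firm `i` is twice differentiable in its own location at the profile `(p, y)`. -/
def LocationTwiceDifferentiable (f : ChoiceRule N M) (c : ℝ) (p : Fin N → ℝ) (y : Fin N → M)
    (i : Fin N) : Prop :=
  (∀ᶠ z in 𝓝 (extChartAt I (y i) (y i)), DifferentiableAt ℝ (locationProfit I f c p y i) z) ∧
    DifferentiableAt ℝ (fderiv ℝ (locationProfit I f c p y i)) (extChartAt I (y i) (y i))

/-- First-order condition: `∇_{y_i} Π_i = 0`. -/
def LocationFirstOrder (f : ChoiceRule N M) (c : ℝ) (p : Fin N → ℝ) (y : Fin N → M)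
    (i : Fin N) : Prop :=
  fderiv ℝ (locationProfit I f c p y i) (extChartAt I (y i) (y i)) = 0

/-- The Hessian `∇²_{y_i} Π_i` as a bilinear form, in the chart centred at `y i`. (At a point where
the gradient vanishes the signature of this form does not depend on the chart.) -/
def locationHessian (f : ChoiceRule N M) (c : ℝ) (p : Fin N → ℝ) (y : Fin N → M) (i : Fin N) :
    EuclideanSpace ℝ (Fin d) →L[ℝ] EuclideanSpace ℝ (Fin d) →L[ℝ] ℝ :=
  fderiv ℝ (fderiv ℝ (locationProfit I f c p y i)) (extChartAt I (y i) (y i))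

end Game

end

/-!
Let all firms be at `ybar` with the same price. When one of them moves to `y`, its demand becomes
the mean over the consumers `x` of `g (β t)`, where `t = dist x y - dist x ybar` is the change of
distance and `g s = 1 / (1 + (N - 1) eˢ)`. Since `N > 2`, the function `g` is strictly convex
at `0` (`exists_le_one_div_one_add_mul_exp`), so the new demand is at least
`1 / N - a β ∫ t + b β² ∫ t²` for small moves, with constants `a, b > 0`, up to normalization by
the total volume (`exists_le_average`). The proof finds moves for which this exceeds `1 / N` by a
multiple of `dist y ybar ^ 2`.

* At an interior point, the moves by `h v` and `-h v` are compared: the sum of the two integrals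
  `∫ t` is `O(h²)`, whereas `∫ t²` is at least a multiple of `h²`, because the distance to the
  consumers of some open set decreases at a definite rate (`MetricChart.exists_isOpen_dist_add_le`).
  For large `β` the quadratic term wins for one of the two moves
  (`exists_demandGrows_of_integral_le`). The bound `O(h²)` has two parts. For consumers far from
  `ybar`, second differences of the distance are bounded by the second variation of length, applied
  between `ybar` and a point of a small sphere on a minimal geodesic
  (`MetricChart.exists_integral_far_le`). For consumers near `ybar` the distance is singular; a
  change of variables translates them together with the firm, and second differences of the
  distance under common translations are harmless (`MetricChart.exists_integral_near_le`).
* At a boundary or corner point the moves `±h v` are not both available. There is however an inward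
  direction `v` which makes a nonobtuse angle with all the directions into the manifold
  (`exists_mem_interior_forall_nonneg`), and the first variation of length shows that moving along
  it decreases the mean distance at a definite rate
  (`MetricChart.exists_integral_dist_decrease`); then the linear term suffices, for every `β`.

Both statements hold on a neighbourhood of each point, with a threshold that does not depend on the
point of the neighbourhood, so compactness gives one threshold (`exists_forall_demandGrows`).

The variation formulas avoid the theory of geodesics. In a chart, an almost shortest curve between
two points is moved by a multiple `α + κ l` of a fixed vector, where `l` is arclength
(`MetricChart.deform`), and lengths are compared pointwise. The first variation needs only that the
metric is Lipschitz, and applies equally at the boundary; the second variation, at interior points,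
also uses that its second differences are bounded (`exists_metricChart`). The Riemannian volume is
`√(det g) dz` in each chart, by the change of variables formula (`chartVolume_eq_of_subset`); hence
it is finite, has no atoms and is positive on open sets.

It remains to use the growth of the demand. In a concentrated local equilibrium, the first-order
conditions for the prices force all prices to be equal and above the cost
(`IsLocalNashEquilibrium.price_eq`), and then a move with a larger demand is profitable. If the
profit is twice differentiable with zero gradient, its quadratic growth along points tending to
`ybar` gives a direction in which the Hessian is positive (`exists_fderiv_fderiv_pos`). With
perfectly rational consumers, an explicit small deviation of a cheapest firm is profitable
(`not_isLocalNashEquilibrium_rationalChoice`).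
-/

/-! ### Curves and the metric in a chart -/

section Chart

lemma contDiffOn_smul_const {E F : Type*} [NormedAddCommGroup E] [NormedSpace ℝ E]
    [NormedAddCommGroup F] [NormedSpace ℝ F] {n : WithTop ℕ∞} {s : Set E} {f : E → ℝ}
    (hf : ContDiffOn ℝ n f s) (c : F) : ContDiffOn ℝ n (fun z => f z • c) s :=
  hf.smul contDiffOn_const

section

variable {E : Type*} [NormedAddCommGroup E] [NormedSpace ℝ E] {H : Type*} [TopologicalSpace H]
  {I : ModelWithCorners ℝ E H}
  {M : Type*} [TopologicalSpace M] [ChartedSpace H M] [IsManifold I ∞ M]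

/-- The image of a constant vector field under the inverse of a chart is smooth, up to the
boundary. -/
lemma contMDiffOn_mfderivWithin_extChartAt_symm (q : M) (v : E) :
    ContMDiffOn 𝓘(ℝ, E) I.tangent ∞
      (fun z => (⟨(extChartAt I q).symm z,
        mfderivWithin 𝓘(ℝ, E) I (extChartAt I q).symm (range I) z v⟩ : TangentBundle I M))
      (extChartAt I q).target := by
  have hu : UniqueMDiffOn 𝓘(ℝ, E) (extChartAt I q).target :=
    (uniqueDiffOn_extChartAt_target q).uniqueMDiffOn
  have h1 := (contMDiffOn_extChartAt_symm (I := I) (n := ∞) q).contMDiffOn_tangentMapWithin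
    (m := ∞) (by simp) hu
  have h2 : ContMDiffOn 𝓘(ℝ, E) 𝓘(ℝ, E).tangent ∞
      (fun z => (⟨z, v⟩ : TangentBundle 𝓘(ℝ, E) E)) (extChartAt I q).target :=
    (contMDiffOn_vectorSpace_iff_contDiffOn (V := fun _ => v)).2 contDiffOn_const
  refine (h1.comp h2 fun z hz => hz).congr fun z hz => ?_
  simp only [Function.comp, tangentMapWithin]
  rw [mfderivWithin_subset (extChartAt_target_subset_range q) (hu z hz)
    (mdifferentiableWithinAt_extChartAt_symm hz)]

variable [RiemannianBundle (fun x : M => TangentSpace I x)]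
  [IsContMDiffRiemannianBundle I ∞ E (fun x : M => TangentSpace I x)]

lemma contDiffOn_inner_mfderivWithin_extChartAt_symm (q : M) (v w : E) :
    ContDiffOn ℝ ∞ (fun z => inner ℝ
      (mfderivWithin 𝓘(ℝ, E) I (extChartAt I q).symm (range I) z v)
      (mfderivWithin 𝓘(ℝ, E) I (extChartAt I q).symm (range I) z w)) (extChartAt I q).target := by
  rw [← contMDiffOn_iff_contDiffOn]
  exact ContMDiffOn.inner_bundle (IB := I) (F := E) (E := fun x : M => TangentSpace I x)
    (contMDiffOn_mfderivWithin_extChartAt_symm q v)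
    (contMDiffOn_mfderivWithin_extChartAt_symm q w)

omit [IsContMDiffRiemannianBundle I ∞ E (fun x : M => TangentSpace I x)] in
/-- The length of a curve given in a chart, computed with the derivative of the curve in the
chart. -/
lemma pathELength_extChartAt_symm_comp (q : M) {η : ℝ → E} (hη : ContDiffOn ℝ 1 η (Icc 0 1))
    (hmaps : MapsTo η (Icc 0 1) (extChartAt I q).target) :
    pathELength I ((extChartAt I q).symm ∘ η) 0 1 =
      ∫⁻ t in Icc (0 : ℝ) 1, ‖mfderivWithin 𝓘(ℝ, E) I (extChartAt I q).symm (range I) (η t)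
        (derivWithin η (Icc 0 1) t)‖ₑ := by
  rw [pathELength_eq_lintegral_mfderivWithin_Icc]
  refine setLIntegral_congr_fun measurableSet_Icc fun t ht => ?_
  have hη' : ContMDiffOn 𝓘(ℝ, ℝ) 𝓘(ℝ, E) 1 η (Icc 0 1) := contMDiffOn_iff_contDiffOn.2 hη
  have h1 : mfderivWithin 𝓘(ℝ, ℝ) I ((extChartAt I q).symm ∘ η) (Icc 0 1) t =
      (mfderivWithin 𝓘(ℝ, E) I (extChartAt I q).symm (range I) (η t)) ∘L
        (mfderivWithin 𝓘(ℝ, ℝ) 𝓘(ℝ, E) η (Icc 0 1) t) := by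
    apply mfderivWithin_comp
    · exact mdifferentiableWithinAt_extChartAt_symm (hmaps ht)
    · exact hη'.mdifferentiableOn one_ne_zero t ht
    · exact fun s hs => extChartAt_target_subset_range q (hmaps hs)
    · rw [uniqueMDiffWithinAt_iff_uniqueDiffWithinAt]
      exact uniqueDiffOn_Icc zero_lt_one t ht
  have h2 : mfderivWithin 𝓘(ℝ, ℝ) I ((extChartAt I q).symm ∘ η) (Icc 0 1) t 1 =
      (mfderivWithin 𝓘(ℝ, E) I (extChartAt I q).symm (range I) (η t))
        (mfderivWithin 𝓘(ℝ, ℝ) 𝓘(ℝ, E) η (Icc 0 1) t 1) := congr($h1 1)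
  simp only [h2, mfderivWithin_eq_fderivWithin]
  rfl

end

section

variable {E : Type*} [NormedAddCommGroup E] [NormedSpace ℝ E] {H : Type*} [TopologicalSpace H]
  {I : ModelWithCorners ℝ E H}
  {M : Type*} [MetricSpace M] [ChartedSpace H M] [IsManifold I ∞ M]
  [RiemannianBundle (fun x : M => TangentSpace I x)]
  [IsRiemannianManifold I M]

lemma edist_extChartAt_symm_le (q : M) {η : ℝ → E} (hη : ContDiffOn ℝ 1 η (Icc 0 1))
    (hmaps : MapsTo η (Icc 0 1) (extChartAt I q).target) :
    edist ((extChartAt I q).symm (η 0)) ((extChartAt I q).symm (η 1)) ≤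
      ∫⁻ t in Icc (0 : ℝ) 1, ‖mfderivWithin 𝓘(ℝ, E) I (extChartAt I q).symm (range I) (η t)
        (derivWithin η (Icc 0 1) t)‖ₑ := by
  rw [IsRiemannianManifold.out (I := I), ← pathELength_extChartAt_symm_comp q hη hmaps]
  refine riemannianEDist_le_pathELength ?_ rfl rfl zero_le_one
  exact (contMDiffOn_extChartAt_symm q).comp (contMDiffOn_iff_contDiffOn.2 hη) hmaps

omit [IsManifold I ∞ M] in
lemma edist_le_pathELength {γ : ℝ → M} {a b : ℝ} (hγ : ContMDiffOn 𝓘(ℝ, ℝ) I 1 γ (Icc a b))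
    (hab : a ≤ b) : edist (γ a) (γ b) ≤ pathELength I γ a b := by
  rw [IsRiemannianManifold.out (I := I)]
  exact riemannianEDist_le_pathELength hγ rfl rfl hab

/-- A curve from `x` of length less than `L` stays in the ball of radius `L` around `x`. When this
ball lies in the domain of a chart, the almost shortest curves can therefore be read in the
chart. -/
lemma exists_path_extChartAt (q : M) {u : Set M} (hu : u ⊆ (extChartAt I q).source) {x y : M}
    {L : ℝ≥0∞} (hball : ∀ m, edist x m < L → m ∈ u) (hL : edist x y < L) :
    ∃ η : ℝ → E, ContDiffOn ℝ 1 η (Icc 0 1) ∧ η 0 = extChartAt I q x ∧ η 1 = extChartAt I q y ∧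
      MapsTo η (Icc 0 1) ((extChartAt I q).target ∩ (extChartAt I q).symm ⁻¹' u) ∧
      ∫⁻ t in Icc (0 : ℝ) 1, ‖mfderivWithin 𝓘(ℝ, E) I (extChartAt I q).symm (range I) (η t)
        (derivWithin η (Icc 0 1) t)‖ₑ < L := by
  rw [IsRiemannianManifold.out (I := I)] at hL
  obtain ⟨γ, h0, h1, hγ, hlen⟩ := exists_lt_of_riemannianEDist_lt hL
  have hmem : ∀ t ∈ Icc (0 : ℝ) 1, γ t ∈ u := by
    intro t ht
    apply hball
    rw [← h0]
    refine lt_of_le_of_lt (edist_le_pathELength (I := I) (hγ.mono ?_) ht.1)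
      (lt_of_le_of_lt (pathELength_mono le_rfl ht.2) hlen)
    exact Icc_subset_Icc le_rfl ht.2
  have hη : ContDiffOn ℝ 1 (extChartAt I q ∘ γ) (Icc 0 1) := by
    rw [← contMDiffOn_iff_contDiffOn]
    exact contMDiffOn_extChartAt.comp (t := (chartAt H q).source) hγ
      fun t ht => by simpa using hu (hmem t ht)
  have hinv : ∀ t ∈ Icc (0 : ℝ) 1, (extChartAt I q).symm (extChartAt I q (γ t)) = γ t :=
    fun t ht => (extChartAt I q).left_inv (hu (hmem t ht))
  have hmaps : MapsTo (extChartAt I q ∘ γ) (Icc 0 1) (extChartAt I q).target :=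
    fun t ht => (extChartAt I q).map_source (hu (hmem t ht))
  refine ⟨extChartAt I q ∘ γ, hη, by simp [h0], by simp [h1], fun t ht => ⟨hmaps ht, ?_⟩, ?_⟩
  · simp only [mem_preimage, Function.comp, hinv t ht]
    exact hmem t ht
  · rw [← pathELength_extChartAt_symm_comp q hη hmaps]
    exact (pathELength_congr (γ' := γ) fun t ht => hinv t ht).trans_lt hlen

end

variable {d : ℕ} {H : Type*} [TopologicalSpace H]
  {I : ModelWithCorners ℝ (EuclideanSpace ℝ (Fin d)) H}
  {M : Type*} [TopologicalSpace M] [ChartedSpace H M] [IsManifold I ∞ M]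
variable [RiemannianBundle (fun x : M => TangentSpace I x)]
  [IsContMDiffRiemannianBundle I ∞ (EuclideanSpace ℝ (Fin d)) (fun x : M => TangentSpace I x)]

lemma contDiffOn_metricMatrix (q : M) (i j : Fin d) :
    ContDiffOn ℝ ∞ (fun z => metricMatrix I q z i j) (extChartAt I q).target :=
  contDiffOn_inner_mfderivWithin_extChartAt_symm q _ _

variable (I) in
/-- The Riemannian metric in the chart centred at `q`, as a bilinear form on the model space. -/
noncomputable def metricForm (q : M) (z : EuclideanSpace ℝ (Fin d)) :
    EuclideanSpace ℝ (Fin d) →L[ℝ] EuclideanSpace ℝ (Fin d) →L[ℝ] ℝ :=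
  ∑ i, ∑ j, metricMatrix I q z i j •
    (EuclideanSpace.proj i : EuclideanSpace ℝ (Fin d) →L[ℝ] ℝ).smulRight
      (EuclideanSpace.proj j : EuclideanSpace ℝ (Fin d) →L[ℝ] ℝ)

lemma contDiffOn_metricForm (q : M) :
    ContDiffOn ℝ ∞ (metricForm I q) (extChartAt I q).target := by
  unfold metricForm
  refine ContDiffOn.sum fun i _ => ContDiffOn.sum fun j _ => ?_
  exact contDiffOn_smul_const (contDiffOn_metricMatrix q i j) _

lemma sum_inner_single_mul {F : Type*} [NormedAddCommGroup F] [InnerProductSpace ℝ F]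
    (S : EuclideanSpace ℝ (Fin d) →ₗ[ℝ] F) (u w : EuclideanSpace ℝ (Fin d)) :
    ∑ i, ∑ j, (inner ℝ (S (EuclideanSpace.single i 1)) (S (EuclideanSpace.single j 1)) : ℝ)
        * (u i * w j) = inner ℝ (S u) (S w) := by
  have hS : ∀ u : EuclideanSpace ℝ (Fin d), S u = ∑ i, u i • S (EuclideanSpace.single i 1) := by
    intro u
    conv_lhs => rw [← (EuclideanSpace.basisFun (Fin d) ℝ).sum_repr u]
    simp only [map_sum, map_smul, EuclideanSpace.basisFun_repr, EuclideanSpace.basisFun_apply]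
  rw [hS u, hS w, sum_inner]
  refine Finset.sum_congr rfl fun i _ => ?_
  rw [inner_sum]
  refine Finset.sum_congr rfl fun j _ => ?_
  rw [inner_smul_left, inner_smul_right]
  simp
  ring

omit [IsManifold I ∞ M] [IsContMDiffRiemannianBundle I ∞ (EuclideanSpace ℝ (Fin d))
  (fun x : M => TangentSpace I x)] in
lemma metricForm_apply (q : M) (z u w : EuclideanSpace ℝ (Fin d)) :
    metricForm I q z u w = inner ℝ
      (mfderivWithin 𝓘(ℝ, EuclideanSpace ℝ (Fin d)) I (extChartAt I q).symm (range I) z u)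
      (mfderivWithin 𝓘(ℝ, EuclideanSpace ℝ (Fin d)) I (extChartAt I q).symm (range I) z w) := by
  refine Eq.trans ?_ (sum_inner_single_mul (F := TangentSpace I ((extChartAt I q).symm z))
    (mfderivWithin 𝓘(ℝ, EuclideanSpace ℝ (Fin d)) I (extChartAt I q).symm
      (range I) z).toLinearMap u w)
  simp only [metricForm, sum_apply, smul_apply, ContinuousLinearMap.smulRight_apply, smul_eq_mul]
  rfl

end Chart

/-! ### Deformation of curves in a chart -/

/-- A chart of a metric space `M` in which the distance is the infimum of the lengths of curves for
a Riemannian metric: a parametrization `e` of a piece of `M` by the part of a convex set `K` in a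
ball around `z₀`, and the coefficients `B` of the metric. At boundary and corner points, `K` is not
a neighbourhood of `z₀`. The metric is bounded, uniformly positive and Lipschitz, and all these
estimates use one constant `C`. The distance of `M` enters only through lengths of curves in the
chart. -/
structure MetricChart (M E : Type*) [MetricSpace M] [NormedAddCommGroup E] [NormedSpace ℝ E] where
  /-- the convex set that models `M` -/
  K : Set E
  /-- the parametrization -/
  e : E → M
  /-- the centre of the chart -/
  z₀ : E
  /-- the radius of the chart -/
  r : ℝ
  /-- a smaller radius, between points of which short curves stay in the chart -/
  s : ℝ
  /-- the constant of all the estimates -/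
  C : ℝ
  /-- the Riemannian metric -/
  B : E → E →L[ℝ] E →L[ℝ] ℝ
  r_pos : 0 < r
  s_pos : 0 < s
  s_le : s ≤ r
  one_le_C : 1 ≤ C
  z₀_mem : z₀ ∈ K
  convex : Convex ℝ K
  symm : ∀ z ∈ K ∩ Metric.ball z₀ r, ∀ u w, B z u w = B z w u
  norm_le : ∀ z ∈ K ∩ Metric.ball z₀ r, ∀ u, ‖u‖ ≤ C * √(B z u u)
  norm_B_le : ∀ z ∈ K ∩ Metric.ball z₀ r, ‖B z‖ ≤ C
  norm_B_sub_le : ∀ z ∈ K ∩ Metric.ball z₀ r, ∀ z' ∈ K ∩ Metric.ball z₀ r,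
    ‖B z - B z'‖ ≤ C * ‖z - z'‖
  /-- the distance is at most the length of a curve in the chart -/
  dist_le_length : ∀ η : ℝ → E, ContDiffOn ℝ 1 η (Icc 0 1) →
    MapsTo η (Icc 0 1) (K ∩ Metric.ball z₀ r) →
    dist (e (η 0)) (e (η 1)) ≤
      ∫ t in (0 : ℝ)..1, √(B (η t) (derivWithin η (Icc 0 1) t) (derivWithin η (Icc 0 1) t))
  /-- the distance between points near the centre is approximated by the length of curves that stay
  in the chart -/
  exists_length_le : ∀ a ∈ K ∩ Metric.ball z₀ s, ∀ b ∈ K ∩ Metric.ball z₀ s, ∀ ε > 0,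
    ∃ η : ℝ → E, ContDiffOn ℝ 1 η (Icc 0 1) ∧ η 0 = a ∧ η 1 = b ∧
      MapsTo η (Icc 0 1) (K ∩ Metric.ball z₀ (r / 2)) ∧
      ∫ t in (0 : ℝ)..1, √(B (η t) (derivWithin η (Icc 0 1) t) (derivWithin η (Icc 0 1) t)) ≤
        dist (e a) (e b) + ε
  /-- the points of `M` near `e b` are the images of points near `b` -/
  eventually_mem_image : ∀ b ∈ K ∩ Metric.ball z₀ r, ∀ ε > 0,
    ∀ᶠ m in 𝓝 (e b), ∃ b' ∈ K ∩ Metric.ball b ε, e b' = m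

namespace MetricChart

variable {M E : Type*} [MetricSpace M] [NormedAddCommGroup E] [NormedSpace ℝ E]
  (𝓒 : MetricChart M E)

/-- The domain of the parametrization. -/
def dom : Set E := 𝓒.K ∩ Metric.ball 𝓒.z₀ 𝓒.r

lemma nonneg_B {z : E} (hz : z ∈ 𝓒.dom) (u : E) : 0 ≤ 𝓒.B z u u := by
  by_contra h
  have h0 := 𝓒.norm_le z hz u
  rw [Real.sqrt_eq_zero_of_nonpos (not_le.1 h).le, mul_zero] at h0
  have : u = 0 := norm_le_zero_iff.1 h0
  simp [this] at h

lemma abs_B_le {z : E} (hz : z ∈ 𝓒.dom) (u w : E) : |𝓒.B z u w| ≤ 𝓒.C * ‖u‖ * ‖w‖ := by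
  rw [← Real.norm_eq_abs]
  refine ((𝓒.B z).le_opNorm₂ u w).trans ?_
  gcongr
  exact 𝓒.norm_B_le z hz

lemma abs_B_sub_le {z z' : E} (hz : z ∈ 𝓒.dom) (hz' : z' ∈ 𝓒.dom) (u w : E) :
    |𝓒.B z u w - 𝓒.B z' u w| ≤ 𝓒.C * ‖z - z'‖ * ‖u‖ * ‖w‖ := by
  rw [← Real.norm_eq_abs]
  refine ((𝓒.B z - 𝓒.B z').le_opNorm₂ u w).trans ?_
  gcongr
  exact 𝓒.norm_B_sub_le z hz z' hz'

lemma C_pos : 0 < 𝓒.C := zero_lt_one.trans_le 𝓒.one_le_C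

lemma convex_dom : Convex ℝ 𝓒.dom := 𝓒.convex.inter (convex_ball _ _)

lemma sqrt_B_le {z : E} (hz : z ∈ 𝓒.dom) (u : E) : √(𝓒.B z u u) ≤ 𝓒.C * ‖u‖ := by
  have hC := 𝓒.one_le_C
  rw [Real.sqrt_le_left (by positivity)]
  refine (le_abs_self _).trans ((𝓒.abs_B_le hz u u).trans ?_)
  nlinarith [mul_nonneg (norm_nonneg u) (norm_nonneg u), mul_nonneg (mul_nonneg (sub_nonneg.2 hC)
    𝓒.C_pos.le) (mul_nonneg (norm_nonneg u) (norm_nonneg u))]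

set_option synthInstance.maxHeartbeats 200000 in
lemma continuousOn_B : ContinuousOn 𝓒.B 𝓒.dom := by
  have : LipschitzOnWith (Real.toNNReal 𝓒.C) 𝓒.B 𝓒.dom := by
    refine LipschitzOnWith.of_dist_le_mul fun z hz z' hz' => ?_
    rw [dist_eq_norm, dist_eq_norm, Real.coe_toNNReal _ 𝓒.C_pos.le]
    exact 𝓒.norm_B_sub_le z hz z' hz'
  exact this.continuousOn

lemma continuousOn_sqrt_B {η ξ : ℝ → E} {S : Set ℝ} (hη : ContinuousOn η S)
    (hξ : ContinuousOn ξ S) (hmaps : MapsTo η S 𝓒.dom) :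
    ContinuousOn (fun t => √(𝓒.B (η t) (ξ t) (ξ t))) S :=
  (((𝓒.continuousOn_B.comp hη hmaps).clm_apply hξ).clm_apply hξ).sqrt

/-- The speed of a curve, extended continuously to the whole line. -/
lemma exists_speed {η : ℝ → E} (hη : ContDiffOn ℝ 1 η (Icc 0 1))
    (hmaps : MapsTo η (Icc 0 1) 𝓒.dom) :
    ∃ l : ℝ → ℝ, Continuous l ∧ (∀ t, 0 ≤ l t) ∧ ∀ t ∈ Icc (0 : ℝ) 1, l t =
      √(𝓒.B (η t) (derivWithin η (Icc 0 1) t) (derivWithin η (Icc 0 1) t)) := by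
  have hc := 𝓒.continuousOn_sqrt_B hη.continuousOn
    (hη.continuousOn_derivWithin (uniqueDiffOn_Icc zero_lt_one) le_rfl) hmaps
  refine ⟨IccExtend zero_le_one ((Icc (0 : ℝ) 1).domRestrict fun t =>
      √(𝓒.B (η t) (derivWithin η (Icc 0 1) t) (derivWithin η (Icc 0 1) t))),
    (continuousOn_iff_continuous_domRestrict.1 hc).Icc_extend', fun t => Real.sqrt_nonneg _, ?_⟩
  intro t ht
  rw [IccExtend_of_mem _ _ ht]
  rfl

/-- The curve obtained from `η` by moving the point at arclength `l` by `(α + κ l) • w`. -/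
noncomputable def deform (η : ℝ → E) (l : ℝ → ℝ) (α κ : ℝ) (w : E) (t : ℝ) : E :=
  η t + (α + κ * ∫ τ in (0 : ℝ)..t, l τ) • w

lemma hasDerivWithinAt_deform {η : ℝ → E} {l : ℝ → ℝ} (hη : ContDiffOn ℝ 1 η (Icc 0 1))
    (hl : Continuous l) (α κ : ℝ) (w : E) {t : ℝ} (ht : t ∈ Icc (0 : ℝ) 1) :
    HasDerivWithinAt (deform η l α κ w) (derivWithin η (Icc 0 1) t + (κ * l t) • w)
      (Icc 0 1) t := by
  have h1 := ((hη.differentiableOn one_ne_zero) t ht).hasDerivWithinAt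
  have h2 : HasDerivAt (fun t => ∫ τ in (0 : ℝ)..t, l τ) (l t) t :=
    hl.integral_hasStrictDerivAt 0 t |>.hasDerivAt
  exact h1.add ((((h2.const_mul κ).const_add α).smul_const w).hasDerivWithinAt)

lemma contDiffOn_deform {η : ℝ → E} {l : ℝ → ℝ} (hη : ContDiffOn ℝ 1 η (Icc 0 1))
    (hl : Continuous l) (α κ : ℝ) (w : E) : ContDiffOn ℝ 1 (deform η l α κ w) (Icc 0 1) := by
  have h2 : ContDiff ℝ 1 (fun t => ∫ τ in (0 : ℝ)..t, l τ) := by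
    rw [contDiff_one_iff_deriv]
    refine ⟨fun t => (hl.integral_hasStrictDerivAt 0 t).hasDerivAt.differentiableAt, ?_⟩
    have : deriv (fun t => ∫ τ in (0 : ℝ)..t, l τ) = l :=
      funext fun t => (hl.integral_hasStrictDerivAt 0 t).hasDerivAt.deriv
    rwa [this]
  exact hη.add (((contDiff_const.add (contDiff_const.mul h2)).smul contDiff_const).contDiffOn)

lemma derivWithin_deform {η : ℝ → E} {l : ℝ → ℝ} (hη : ContDiffOn ℝ 1 η (Icc 0 1))
    (hl : Continuous l) (α κ : ℝ) (w : E) {t : ℝ} (ht : t ∈ Icc (0 : ℝ) 1) :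
    derivWithin (deform η l α κ w) (Icc 0 1) t = derivWithin η (Icc 0 1) t + (κ * l t) • w :=
  (hasDerivWithinAt_deform hη hl α κ w ht).derivWithin (uniqueDiffOn_Icc zero_lt_one t ht)

/-- The inequality `√Q ≤ (l + Q / l) / 2`, with `b = (Q / l - l) / 2` as a variable, in order to
allow `l = 0`. -/
lemma sqrt_le_of_le_mul {Q l b : ℝ} (h : Q ≤ l * (l + 2 * b)) (hb : 0 ≤ l + b) :
    √Q ≤ l + b := by
  rw [Real.sqrt_le_left hb]
  nlinarith [sq_nonneg b]

/-- If the mean of `Q` and `Q'` exceeds `l ^ 2` only slightly, then the mean of `√Q` and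
`√Q'` exceeds `l` only slightly: this is the concavity of the square root. -/
lemma sqrt_add_sqrt_le {Q Q' l b : ℝ} (hl : 0 ≤ l) (hb : 0 ≤ b)
    (h : Q + Q' ≤ 2 * l ^ 2 + 2 * b * l ^ 2) (hQ : 0 ≤ Q) (hQ' : 0 ≤ Q') :
    √Q + √Q' ≤ (2 + b) * l := by
  have h1 : (√Q + √Q') ^ 2 ≤ 2 * (Q + Q') := by
    nlinarith [sq_nonneg (√Q - √Q'), Real.sq_sqrt hQ, Real.sq_sqrt hQ']
  refine abs_le_of_sq_le_sq' ?_ (by positivity) |>.2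
  nlinarith [sq_nonneg (b * l)]

lemma integral_eq_of_speed {η : ℝ → E} {l : ℝ → ℝ}
    (hle : ∀ t ∈ Icc (0 : ℝ) 1, l t =
      √(𝓒.B (η t) (derivWithin η (Icc 0 1) t) (derivWithin η (Icc 0 1) t))) :
    ∫ t in (0 : ℝ)..1, √(𝓒.B (η t) (derivWithin η (Icc 0 1) t) (derivWithin η (Icc 0 1) t)) =
      ∫ t in (0 : ℝ)..1, l t := by
  refine intervalIntegral.integral_congr fun t ht => ?_
  rw [uIcc_of_le zero_le_one] at ht
  exact (hle t ht).symm

/-- Arclength lies between `0` and the total length. -/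
lemma arclength_mem {l : ℝ → ℝ} (hl : Continuous l) (hl0 : ∀ t, 0 ≤ l t) {t : ℝ}
    (ht : t ∈ Icc (0 : ℝ) 1) :
    ∫ τ in (0 : ℝ)..t, l τ ∈ Icc 0 (∫ τ in (0 : ℝ)..1, l τ) := by
  have h2 : 0 ≤ ∫ τ in t..1, l τ :=
    intervalIntegral.integral_nonneg ht.2 fun τ _ => hl0 τ
  have h3 := intervalIntegral.integral_add_adjacent_intervals
    (hl.intervalIntegrable (μ := volume) 0 t) (hl.intervalIntegrable t 1)
  exact ⟨intervalIntegral.integral_nonneg ht.1 fun τ _ => hl0 τ, by linarith⟩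

lemma norm_derivWithin_le_of_speed {η : ℝ → E} {l : ℝ → ℝ} (hmaps : MapsTo η (Icc 0 1) 𝓒.dom)
    (hle : ∀ t ∈ Icc (0 : ℝ) 1, l t =
      √(𝓒.B (η t) (derivWithin η (Icc 0 1) t) (derivWithin η (Icc 0 1) t)))
    {t : ℝ} (ht : t ∈ Icc (0 : ℝ) 1) : ‖derivWithin η (Icc 0 1) t‖ ≤ 𝓒.C * l t := by
  rw [hle t ht]
  exact 𝓒.norm_le _ (hmaps ht) _

/-- The length of the deformed curve bounds the distance between its endpoints, which are displaced
by `α` and `α + κ L` times `w`, where `L` is the length of `η`. -/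
lemma dist_deform_le {η : ℝ → E} {l : ℝ → ℝ} (hη : ContDiffOn ℝ 1 η (Icc 0 1))
    (hl : Continuous l) (α κ : ℝ) (w : E)
    (hmaps : MapsTo (deform η l α κ w) (Icc 0 1) 𝓒.dom) :
    dist (𝓒.e (η 0 + α • w)) (𝓒.e (η 1 + (α + κ * ∫ τ in (0 : ℝ)..1, l τ) • w)) ≤
      ∫ t in (0 : ℝ)..1, √(𝓒.B (deform η l α κ w t) (derivWithin η (Icc 0 1) t + (κ * l t) • w)
        (derivWithin η (Icc 0 1) t + (κ * l t) • w)) := by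
  have h := 𝓒.dist_le_length _ (contDiffOn_deform hη hl α κ w) hmaps
  have h0 : deform η l α κ w 0 = η 0 + α • w := by simp [deform]
  rw [h0] at h
  refine h.trans_eq (intervalIntegral.integral_congr fun t ht => ?_)
  rw [uIcc_of_le zero_le_one] at ht
  simp only [derivWithin_deform hη hl α κ w ht]

lemma intervalIntegrable_deform {η : ℝ → E} {l : ℝ → ℝ} (hη : ContDiffOn ℝ 1 η (Icc 0 1))
    (hl : Continuous l) (α κ : ℝ) (w : E)
    (hmaps : MapsTo (deform η l α κ w) (Icc 0 1) 𝓒.dom) :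
    IntervalIntegrable (fun t => √(𝓒.B (deform η l α κ w t)
      (derivWithin η (Icc 0 1) t + (κ * l t) • w)
      (derivWithin η (Icc 0 1) t + (κ * l t) • w))) volume 0 1 := by
  refine ContinuousOn.intervalIntegrable ?_
  rw [uIcc_of_le zero_le_one]
  refine 𝓒.continuousOn_sqrt_B (contDiffOn_deform hη hl α κ w).continuousOn ?_ hmaps
  exact (hη.continuousOn_derivWithin (uniqueDiffOn_Icc zero_lt_one) le_rfl).add
    ((continuous_const.mul hl).smul continuous_const).continuousOn

/-- Second variation of the length, pointwise: `u` is the velocity of a curve at `z`, where its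
speed is `l`, and `φw` the displacement of `z`, whose derivative is `(κ * l) • w`. -/
lemma second_variation_le {z φw u w : E} {l κ : ℝ} (hl : 0 ≤ l)
    (hp : z + φw ∈ 𝓒.dom) (hm : z - φw ∈ 𝓒.dom) (hlu : 𝓒.B z u u = l ^ 2)
    (hu : ‖u‖ ≤ 𝓒.C * l) (hφ : ‖φw‖ ≤ ‖w‖)
    (hB : |𝓒.B (z + φw) u u + 𝓒.B (z - φw) u u - 2 * 𝓒.B z u u| ≤
      𝓒.C * ‖φw‖ ^ 2 * ‖u‖ ^ 2) :
    √(𝓒.B (z + φw) (u + (κ * l) • w) (u + (κ * l) • w)) +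
      √(𝓒.B (z - φw) (u - (κ * l) • w) (u - (κ * l) • w)) ≤
      (2 + 2 * 𝓒.C ^ 3 * (1 + κ ^ 2) * ‖w‖ ^ 2) * l := by
  have hC := 𝓒.one_le_C
  have hC0 := 𝓒.C_pos
  set C := 𝓒.C
  refine sqrt_add_sqrt_le hl (by positivity) ?_ (𝓒.nonneg_B hp _) (𝓒.nonneg_B hm _)
  have e1 : |𝓒.B (z + φw) u u + 𝓒.B (z - φw) u u - 2 * 𝓒.B z u u| ≤ C ^ 3 * ‖w‖ ^ 2 * l ^ 2 := by
    refine hB.trans ?_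
    calc C * ‖φw‖ ^ 2 * ‖u‖ ^ 2 ≤ C * ‖w‖ ^ 2 * (C * l) ^ 2 := by gcongr
      _ = _ := by ring
  have e2 : ∀ x y, ‖x‖ * ‖y‖ ≤ C * l * ‖w‖ →
      |𝓒.B (z + φw) x y - 𝓒.B (z - φw) x y| ≤ 2 * C ^ 2 * ‖w‖ ^ 2 * l := by
    intro x y hxy
    have h1 := 𝓒.abs_B_sub_le hp hm x y
    have h2 : ‖z + φw - (z - φw)‖ ≤ 2 * ‖w‖ := by
      rw [show z + φw - (z - φw) = (2 : ℝ) • φw by rw [two_smul]; abel, norm_smul]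
      simpa using hφ
    calc _ ≤ _ := h1
      _ = C * ‖z + φw - (z - φw)‖ * (‖x‖ * ‖y‖) := by ring
      _ ≤ C * (2 * ‖w‖) * (C * l * ‖w‖) := by gcongr
      _ = _ := by ring
  have e3 : 𝓒.B (z + φw) w w + 𝓒.B (z - φw) w w ≤ 2 * C * ‖w‖ ^ 2 := by
    have h1 := (le_abs_self _).trans (𝓒.abs_B_le hp w w)
    have h2 := (le_abs_self _).trans (𝓒.abs_B_le hm w w)
    nlinarith
  have e4 := e2 u w (by gcongr)
  have e5 := e2 w u (by rw [mul_comm]; gcongr)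
  have e6 : κ * ((𝓒.B (z + φw) u w - 𝓒.B (z - φw) u w) + (𝓒.B (z + φw) w u - 𝓒.B (z - φw) w u)) ≤
      |κ| * (4 * C ^ 2 * ‖w‖ ^ 2 * l) := by
    refine (le_abs_self _).trans ?_
    rw [abs_mul]
    gcongr
    refine (abs_add_le _ _).trans ?_
    linarith
  have hk : 4 * |κ| ≤ 2 + 2 * κ ^ 2 := by nlinarith [sq_nonneg (|κ| - 1), sq_abs κ]
  have hC2 : C ^ 2 ≤ C ^ 3 := pow_le_pow_right₀ hC (by norm_num)
  have hC1 : C ≤ C ^ 3 := le_self_pow₀ hC (by norm_num)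
  simp only [map_add, map_sub, map_smul, add_apply, sub_apply, smul_apply, smul_eq_mul]
  have e1' := (le_abs_self _).trans e1
  rw [hlu] at e1'
  have e7 : l * (κ * ((𝓒.B (z + φw) u w - 𝓒.B (z - φw) u w) +
      (𝓒.B (z + φw) w u - 𝓒.B (z - φw) w u))) ≤ l * (|κ| * (4 * C ^ 2 * ‖w‖ ^ 2 * l)) := by gcongr
  have e8 : (κ * l) ^ 2 * (𝓒.B (z + φw) w w + 𝓒.B (z - φw) w w) ≤
      (κ * l) ^ 2 * (2 * C * ‖w‖ ^ 2) := by gcongr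
  have e9 : |κ| * (4 * C ^ 2) ≤ (2 + 2 * κ ^ 2) * C ^ 3 := by nlinarith [abs_nonneg κ, sq_nonneg κ]
  have e10 : κ ^ 2 * (2 * C) ≤ κ ^ 2 * (2 * C ^ 3) := by gcongr
  have e11 : 0 ≤ ‖w‖ ^ 2 * l ^ 2 := by positivity
  nlinarith [mul_le_mul_of_nonneg_left e9 e11, mul_le_mul_of_nonneg_left e10 e11]

/-- First variation of the length, pointwise, with the notation of `second_variation_le`. The first
order term is evaluated with the metric at the centre, where it can be integrated. -/
lemma first_variation_le {z φw u w : E} {l κ ρ : ℝ} (hl : 0 ≤ l) (hz : z ∈ 𝓒.dom)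
    (hz₀ : 𝓒.z₀ ∈ 𝓒.dom)
    (hp : z + φw ∈ 𝓒.dom) (hlu : 𝓒.B z u u = l ^ 2) (hρ : ‖z - 𝓒.z₀‖ ≤ ρ)
    (hu : ‖u‖ ≤ 𝓒.C * l) (hφ : ‖φw‖ ≤ ‖w‖) (hκ : |κ| * ‖w‖ ≤ 1) :
    √(𝓒.B (z + φw) (u + (κ * l) • w) (u + (κ * l) • w)) ≤
      l + (κ * 𝓒.B 𝓒.z₀ u w +
        l * (‖w‖ * (𝓒.C ^ 2 * |κ| * ρ + 𝓒.C * κ ^ 2 * ‖w‖ + 2 * 𝓒.C ^ 3))) := by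
  have hC := 𝓒.one_le_C
  have hC0 := 𝓒.C_pos
  set C := 𝓒.C
  set W := ‖w‖
  have hW : 0 ≤ W := norm_nonneg _
  have hρ0 : 0 ≤ ρ := (norm_nonneg _).trans hρ
  set b := κ * 𝓒.B 𝓒.z₀ u w + l * (W * (C ^ 2 * |κ| * ρ + C * κ ^ 2 * W + 2 * C ^ 3)) with hb
  have key : 𝓒.B (z + φw) (u + (κ * l) • w) (u + (κ * l) • w) ≤ l * (l + 2 * b) := by
    set x := u + (κ * l) • w
    have hx : ‖x‖ ≤ 2 * C * l := by
      have : ‖(κ * l) • w‖ = |κ| * W * l := by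
        rw [norm_smul, Real.norm_eq_abs, abs_mul, abs_of_nonneg hl]; ring
      have h2 := norm_add_le u ((κ * l) • w)
      have h3 : |κ| * W * l ≤ 1 * l := by gcongr
      nlinarith
    have h1 : 𝓒.B (z + φw) x x - 𝓒.B z x x ≤ 4 * C ^ 3 * W * l ^ 2 := by
      refine (le_abs_self _).trans ((𝓒.abs_B_sub_le hp hz x x).trans ?_)
      rw [add_sub_cancel_left]
      calc C * ‖φw‖ * ‖x‖ * ‖x‖ ≤ C * W * (2 * C * l) * (2 * C * l) := by gcongr
        _ = _ := by ring
    have h2 : κ * (𝓒.B z u w - 𝓒.B 𝓒.z₀ u w) ≤ |κ| * (C ^ 2 * ρ * W * l) := by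
      refine (le_abs_self _).trans ?_
      rw [abs_mul]
      gcongr
      refine (𝓒.abs_B_sub_le hz hz₀ u w).trans ?_
      calc C * ‖z - 𝓒.z₀‖ * ‖u‖ * ‖w‖ ≤ C * ρ * (C * l) * W := by gcongr
        _ = _ := by ring
    have h3 : 𝓒.B z w w ≤ C * W * W := (le_abs_self _).trans (𝓒.abs_B_le hz w w)
    have h4 : 𝓒.B z x x = l ^ 2 + 2 * (κ * l) * 𝓒.B z u w + (κ * l) ^ 2 * 𝓒.B z w w := by
      simp only [x, map_add, map_smul, add_apply, smul_apply, smul_eq_mul, hlu,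
        𝓒.symm z hz w u]
      ring
    have h5 : (κ * l) ^ 2 * 𝓒.B z w w ≤ (κ * l) ^ 2 * (C * W * W) := by gcongr
    have h6 := mul_le_mul_of_nonneg_left h2 hl
    have h7 : 0 ≤ C * κ ^ 2 * W ^ 2 * l ^ 2 := by positivity
    rw [hb]
    nlinarith
  refine sqrt_le_of_le_mul key ?_
  rcases hl.eq_or_lt with rfl | hl'
  · have : u = 0 := by simpa using hu
    simp [hb, this]
  · have := (𝓒.nonneg_B hp _).trans key
    have := nonneg_of_mul_nonneg_right this hl'
    linarith

end MetricChart

/-! ### Variation of the distance in a chart -/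

namespace MetricChart

variable {M E : Type*} [MetricSpace M] [NormedAddCommGroup E] [NormedSpace ℝ E]
  (𝓒 : MetricChart M E)

lemma mem_dom_of_half {z w : E} (hz : z ∈ 𝓒.K ∩ Metric.ball 𝓒.z₀ (𝓒.r / 2))
    (hK : z + w ∈ 𝓒.K) (hw : ‖w‖ < 𝓒.r / 2) : z + w ∈ 𝓒.dom := by
  refine ⟨hK, ?_⟩
  have h1 := hz.2
  rw [mem_ball_iff_norm] at h1 ⊢
  have := norm_add_le (z - 𝓒.z₀) w
  rw [show z + w - 𝓒.z₀ = z - 𝓒.z₀ + w by abel]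
  linarith

lemma half_subset_dom : 𝓒.K ∩ Metric.ball 𝓒.z₀ (𝓒.r / 2) ⊆ 𝓒.dom :=
  inter_subset_inter_right _ (Metric.ball_subset_ball (by linarith [𝓒.r_pos]))

lemma small_subset_dom : 𝓒.K ∩ Metric.ball 𝓒.z₀ 𝓒.s ⊆ 𝓒.dom :=
  inter_subset_inter_right _ (Metric.ball_subset_ball 𝓒.s_le)

lemma z₀_mem_dom : 𝓒.z₀ ∈ 𝓒.dom := ⟨𝓒.z₀_mem, Metric.mem_ball_self 𝓒.r_pos⟩

/-- A curve of almost minimal length, with its speed. -/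
lemma exists_short_curve {a b : E} (ha : a ∈ 𝓒.K ∩ Metric.ball 𝓒.z₀ 𝓒.s)
    (hb : b ∈ 𝓒.K ∩ Metric.ball 𝓒.z₀ 𝓒.s) {ε : ℝ} (hε : 0 < ε) :
    ∃ (η : ℝ → E) (l : ℝ → ℝ), ContDiffOn ℝ 1 η (Icc 0 1) ∧ η 0 = a ∧ η 1 = b ∧
      MapsTo η (Icc 0 1) (𝓒.K ∩ Metric.ball 𝓒.z₀ (𝓒.r / 2)) ∧ Continuous l ∧ (∀ t, 0 ≤ l t) ∧
      (∀ t ∈ Icc (0 : ℝ) 1, l t =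
        √(𝓒.B (η t) (derivWithin η (Icc 0 1) t) (derivWithin η (Icc 0 1) t))) ∧
      dist (𝓒.e a) (𝓒.e b) ≤ ∫ t in (0 : ℝ)..1, l t ∧
      ∫ t in (0 : ℝ)..1, l t ≤ dist (𝓒.e a) (𝓒.e b) + ε := by
  obtain ⟨η, hη, h0, h1, hmaps, hlen⟩ := 𝓒.exists_length_le a ha b hb ε hε
  have hmaps' := hmaps.mono_right 𝓒.half_subset_dom
  obtain ⟨l, hl, hl0, hle⟩ := 𝓒.exists_speed hη hmaps'
  have hlow := 𝓒.dist_le_length η hη hmaps'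
  rw [𝓒.integral_eq_of_speed hle] at hlow hlen
  rw [h0, h1] at hlow
  exact ⟨η, l, hη, h0, h1, hmaps, hl, hl0, hle, hlow, hlen⟩

lemma norm_sub_le_of_speed {η : ℝ → E} {l : ℝ → ℝ} (hη : ContDiffOn ℝ 1 η (Icc 0 1))
    (hmaps : MapsTo η (Icc 0 1) 𝓒.dom) (hl : Continuous l) (hl0 : ∀ t, 0 ≤ l t)
    (hle : ∀ t ∈ Icc (0 : ℝ) 1, l t =
      √(𝓒.B (η t) (derivWithin η (Icc 0 1) t) (derivWithin η (Icc 0 1) t)))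
    {t : ℝ} (ht : t ∈ Icc (0 : ℝ) 1) : ‖η t - η 0‖ ≤ 𝓒.C * ∫ τ in (0 : ℝ)..1, l τ := by
  have hd : ∀ t, HasDerivAt (fun t => 𝓒.C * ∫ τ in (0 : ℝ)..t, l τ) (𝓒.C * l t) t := fun t =>
    (hl.integral_hasStrictDerivAt 0 t).hasDerivAt.const_mul _
  have h := image_norm_le_of_norm_deriv_right_le_deriv_boundary' (a := 0) (b := 1)
    (f := fun t => η t - η 0) (f' := derivWithin η (Icc 0 1))
    (B := fun t => 𝓒.C * ∫ τ in (0 : ℝ)..t, l τ) (B' := fun t => 𝓒.C * l t)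
    (hη.continuousOn.sub continuousOn_const) ?_ (by simp)
    (fun t _ => (hd t).continuousAt.continuousWithinAt)
    (fun t _ => (hd t).hasDerivWithinAt)
    (fun t ht => 𝓒.norm_derivWithin_le_of_speed hmaps hle (Ico_subset_Icc_self ht)) ht
  · refine h.trans ?_
    have := 𝓒.C_pos
    gcongr
    exact (arclength_mem hl hl0 ht).2
  · intro t ht
    have := ((hη.differentiableOn one_ne_zero) t (Ico_subset_Icc_self ht)).hasDerivWithinAt
    refine HasDerivWithinAt.mono_of_mem_nhdsWithin (this.sub_const _) ?_
    exact Icc_mem_nhdsGE_of_mem ht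

/-- The coordinates are Lipschitz functions for the distance of `M`. -/
lemma norm_sub_le_mul_dist {a b : E} (ha : a ∈ 𝓒.K ∩ Metric.ball 𝓒.z₀ 𝓒.s)
    (hb : b ∈ 𝓒.K ∩ Metric.ball 𝓒.z₀ 𝓒.s) : ‖b - a‖ ≤ 𝓒.C * dist (𝓒.e a) (𝓒.e b) := by
  refine le_of_forall_pos_le_add fun ε hε => ?_
  have hC := 𝓒.C_pos
  obtain ⟨η, l, hη, h0, h1, hmaps, hl, hl0, hle, -, hlen⟩ :=
    𝓒.exists_short_curve ha hb (div_pos hε hC)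
  have := 𝓒.norm_sub_le_of_speed hη (hmaps.mono_right 𝓒.half_subset_dom) hl hl0 hle
    (t := 1) (by simp)
  rw [h0, h1] at this
  calc ‖b - a‖ ≤ 𝓒.C * ∫ τ in (0 : ℝ)..1, l τ := this
    _ ≤ 𝓒.C * (dist (𝓒.e a) (𝓒.e b) + ε / 𝓒.C) := by gcongr
    _ = _ := by field_simp

/-- The parametrization is Lipschitz: segments are admissible curves. -/
lemma dist_le_mul_norm_sub {a b : E} (ha : a ∈ 𝓒.dom) (hb : b ∈ 𝓒.dom) :
    dist (𝓒.e a) (𝓒.e b) ≤ 𝓒.C * ‖b - a‖ := by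
  set η : ℝ → E := fun t => a + t • (b - a) with hη
  have hη1 : ContDiffOn ℝ 1 η (Icc 0 1) := by
    refine ContDiff.contDiffOn ?_
    fun_prop
  have hmaps : MapsTo η (Icc 0 1) 𝓒.dom := fun t ht => by
    have := 𝓒.convex_dom ha hb (a := 1 - t) (b := t) (by linarith [ht.2]) ht.1 (by ring)
    convert this using 1
    simp only [hη, smul_sub, sub_smul, one_smul]
    abel
  have hder : ∀ t ∈ Icc (0 : ℝ) 1, derivWithin η (Icc 0 1) t = b - a := by
    intro t ht
    refine HasDerivWithinAt.derivWithin ?_ (uniqueDiffOn_Icc zero_lt_one t ht)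
    have h := (((hasDerivAt_id t).smul_const (b - a)).const_add a).hasDerivWithinAt (s := Icc 0 1)
    rw [one_smul] at h
    exact h
  have h := 𝓒.dist_le_length η hη1 hmaps
  simp only [hη, zero_smul, add_zero, one_smul, add_sub_cancel] at h
  rw [← hη] at h
  refine h.trans ?_
  have hb : ∀ t ∈ Icc (0 : ℝ) 1, √(𝓒.B (η t) (derivWithin η (Icc 0 1) t)
      (derivWithin η (Icc 0 1) t)) ≤ 𝓒.C * ‖b - a‖ := fun t ht => by
    rw [hder t ht]
    exact 𝓒.sqrt_B_le (hmaps ht) _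
  have hint : IntervalIntegrable (fun t => √(𝓒.B (η t) (derivWithin η (Icc 0 1) t)
      (derivWithin η (Icc 0 1) t))) volume 0 1 := by
    refine ContinuousOn.intervalIntegrable ?_
    rw [uIcc_of_le zero_le_one]
    exact 𝓒.continuousOn_sqrt_B hη1.continuousOn
      (hη1.continuousOn_derivWithin (uniqueDiffOn_Icc zero_lt_one) le_rfl) hmaps
  have := intervalIntegral.integral_mono_on zero_le_one hint intervalIntegrable_const hb
  simpa using this

/-- An inequality that holds for lengths arbitrarily close to the distance `D` holds for `D`. -/
lemma le_of_approx {X D : ℝ} {Φ : ℝ → ℝ} (hΦ : ContinuousAt Φ D)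
    (h : ∀ ε > 0, ∃ L, D ≤ L ∧ L ≤ D + ε ∧ X ≤ Φ L) : X ≤ Φ D := by
  by_contra! hlt
  obtain ⟨ε, hε, h'⟩ := Metric.eventually_nhds_iff.1 (hΦ.eventually (gt_mem_nhds hlt))
  obtain ⟨L, h1, h2, h3⟩ := h (ε / 2) (by positivity)
  have := h' (y := L) (by rw [Real.dist_eq, abs_lt]; constructor <;> linarith)
  linarith

/-- First variation formula: when the first endpoint of a curve of length close to the distance
`D` is moved by `w`, its length decreases at the rate given by the component of `b - a` along `w`,
up to errors due to the variation of the metric. -/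
theorem dist_add_le {a b w : E} (ha : a ∈ 𝓒.K ∩ Metric.ball 𝓒.z₀ 𝓒.s)
    (hb : b ∈ 𝓒.K ∩ Metric.ball 𝓒.z₀ 𝓒.s)
    (hK : ∀ z ∈ 𝓒.K ∩ Metric.ball 𝓒.z₀ (𝓒.r / 2), ∀ θ ∈ Icc (0 : ℝ) 1, z + θ • w ∈ 𝓒.K)
    (hw : ‖w‖ < 𝓒.r / 2) {D : ℝ} (hD : dist (𝓒.e a) (𝓒.e b) = D) (hD0 : 0 < D)
    (hwD : ‖w‖ ≤ D) :
    dist (𝓒.e (a + w)) (𝓒.e b) ≤ D - 𝓒.B 𝓒.z₀ (b - a) w / D +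
      ‖w‖ * (𝓒.C ^ 2 * (‖a - 𝓒.z₀‖ + 𝓒.C * D) + 𝓒.C * ‖w‖ / D + 2 * 𝓒.C ^ 3 * D) := by
  refine le_of_approx (Φ := fun L => L - 𝓒.B 𝓒.z₀ (b - a) w / L +
      ‖w‖ * (𝓒.C ^ 2 * (‖a - 𝓒.z₀‖ + 𝓒.C * L) + 𝓒.C * ‖w‖ / L + 2 * 𝓒.C ^ 3 * L)) ?_ ?_
  · have : D ≠ 0 := hD0.ne'
    fun_prop (disch := assumption)
  intro ε hε
  obtain ⟨η, l, hη, h0, h1, hmaps, hl, hl0, hle, hlow, hlen⟩ := 𝓒.exists_short_curve ha hb hε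
  have hmaps' := hmaps.mono_right 𝓒.half_subset_dom
  rw [hD] at hlow hlen
  set L := ∫ t in (0 : ℝ)..1, l t with hL
  have hL0 : 0 < L := hD0.trans_le hlow
  refine ⟨L, hlow, hlen, ?_⟩
  have hφ : ∀ t ∈ Icc (0 : ℝ) 1, 1 + -L⁻¹ * ∫ τ in (0 : ℝ)..t, l τ ∈ Icc (0 : ℝ) 1 := by
    intro t ht
    have h := arclength_mem hl hl0 ht
    have h2 : L⁻¹ * ∫ τ in (0 : ℝ)..t, l τ ≤ 1 := by
      rw [inv_mul_le_iff₀ hL0, mul_one]; exact h.2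
    have h3 : 0 ≤ L⁻¹ * ∫ τ in (0 : ℝ)..t, l τ := mul_nonneg (inv_nonneg.2 hL0.le) h.1
    constructor <;> linarith
  -- the displacement `(1 - arclength / L) • w` is `w` at the first endpoint and `0` at the second
  have hdm : MapsTo (deform η l 1 (-L⁻¹) w) (Icc 0 1) 𝓒.dom := by
    intro t ht
    refine 𝓒.mem_dom_of_half (hmaps ht) (hK _ (hmaps ht) _ (hφ t ht)) ?_
    refine lt_of_le_of_lt ?_ hw
    rw [norm_smul, Real.norm_of_nonneg (hφ t ht).1]
    exact mul_le_of_le_one_left (norm_nonneg _) (hφ t ht).2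
  have hmain := 𝓒.dist_deform_le hη hl 1 (-L⁻¹) w hdm
  have hL1 : 1 + -L⁻¹ * L = 0 := by field_simp; ring
  rw [h0, h1, one_smul, ← hL, hL1, zero_smul, add_zero] at hmain
  refine hmain.trans ?_
  set ρ := ‖a - 𝓒.z₀‖ + 𝓒.C * L with hρ
  set c := ‖w‖ * (𝓒.C ^ 2 * |-L⁻¹| * ρ + 𝓒.C * (-L⁻¹) ^ 2 * ‖w‖ + 2 * 𝓒.C ^ 3) with hc
  have hbound : ∀ t ∈ Icc (0 : ℝ) 1, √(𝓒.B (deform η l 1 (-L⁻¹) w t)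
      (derivWithin η (Icc 0 1) t + (-L⁻¹ * l t) • w)
      (derivWithin η (Icc 0 1) t + (-L⁻¹ * l t) • w)) ≤
      l t + (-L⁻¹ * 𝓒.B 𝓒.z₀ (derivWithin η (Icc 0 1) t) w + l t * c) := by
    intro t ht
    have hdt := hdm ht
    refine 𝓒.first_variation_le (hl0 t) (hmaps' ht) 𝓒.z₀_mem_dom hdt ?_ ?_ ?_ ?_ ?_
    · rw [hle t ht, Real.sq_sqrt (𝓒.nonneg_B (hmaps' ht) _)]
    · have h2 := 𝓒.norm_sub_le_of_speed hη hmaps' hl hl0 hle ht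
      have h3 := norm_add_le (η t - η 0) (η 0 - 𝓒.z₀)
      rw [sub_add_sub_cancel, h0] at h3
      rw [h0] at h2
      linarith
    · exact 𝓒.norm_derivWithin_le_of_speed hmaps' hle ht
    · rw [norm_smul, Real.norm_of_nonneg (hφ t ht).1]
      exact mul_le_of_le_one_left (norm_nonneg _) (hφ t ht).2
    · rw [abs_neg, abs_of_pos (inv_pos.2 hL0), inv_mul_le_iff₀ hL0, mul_one]
      exact hwD.trans hlow
  have hcd : ContDiffOn ℝ 1 (fun t => 𝓒.B 𝓒.z₀ (η t) w) (Icc 0 1) :=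
    ((𝓒.B 𝓒.z₀).flip w).contDiff.comp_contDiffOn hη
  have hder : ∀ t ∈ Icc (0 : ℝ) 1, derivWithin (fun t => 𝓒.B 𝓒.z₀ (η t) w) (Icc 0 1) t =
      𝓒.B 𝓒.z₀ (derivWithin η (Icc 0 1) t) w := by
    intro t ht
    have := ((𝓒.B 𝓒.z₀).flip w).hasFDerivAt.comp_hasDerivWithinAt t
      ((hη.differentiableOn one_ne_zero) t ht).hasDerivWithinAt
    exact this.derivWithin (uniqueDiffOn_Icc zero_lt_one t ht)
  have hcont : ContinuousOn (fun t => 𝓒.B 𝓒.z₀ (derivWithin η (Icc 0 1) t) w) (Icc 0 1) :=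
    ((𝓒.B 𝓒.z₀).flip w).continuous.comp_continuousOn
      (hη.continuousOn_derivWithin (uniqueDiffOn_Icc zero_lt_one) le_rfl)
  have hii : IntervalIntegrable (fun t => 𝓒.B 𝓒.z₀ (derivWithin η (Icc 0 1) t) w) volume 0 1 := by
    refine ContinuousOn.intervalIntegrable ?_
    rwa [uIcc_of_le zero_le_one]
  have hli : IntervalIntegrable l volume 0 1 := hl.intervalIntegrable 0 1
  have hFTC : ∫ t in (0 : ℝ)..1, 𝓒.B 𝓒.z₀ (derivWithin η (Icc 0 1) t) w =
      𝓒.B 𝓒.z₀ (b - a) w := by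
    have h2 := intervalIntegral.integral_derivWithin_Icc_of_contDiffOn_Icc hcd zero_le_one
    rw [h0, h1] at h2
    rw [map_sub, sub_apply, ← h2]
    refine intervalIntegral.integral_congr fun t ht => ?_
    rw [uIcc_of_le zero_le_one] at ht
    exact (hder t ht).symm
  have hmono := intervalIntegral.integral_mono_on zero_le_one
    (𝓒.intervalIntegrable_deform hη hl 1 (-L⁻¹) w hdm)
    (hli.add ((hii.const_mul (-L⁻¹)).add (hli.mul_const c))) hbound
  refine hmono.trans_eq ?_
  rw [intervalIntegral.integral_add hli ((hii.const_mul (-L⁻¹)).add (hli.mul_const c)),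
    intervalIntegral.integral_add (hii.const_mul (-L⁻¹)) (hli.mul_const c),
    intervalIntegral.integral_const_mul, intervalIntegral.integral_mul_const, hFTC, ← hL, hc,
    abs_neg, abs_of_pos (inv_pos.2 hL0)]
  field_simp
  ring

/-- The second differences of the coefficients of the metric are bounded: this is the form in
which two derivatives of the metric are used. -/
def SecondDifferencesBounded : Prop :=
  ∀ z φ u, z ∈ 𝓒.dom → z + φ ∈ 𝓒.dom → z - φ ∈ 𝓒.dom →
    |𝓒.B (z + φ) u u + 𝓒.B (z - φ) u u - 2 * 𝓒.B z u u| ≤ 𝓒.C * ‖φ‖ ^ 2 * ‖u‖ ^ 2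

/-- Integrated second variation of the length: the curves displaced in opposite directions are
compared with `η`. -/
lemma dist_add_dist_deform_le (h2 : 𝓒.SecondDifferencesBounded)
    (hball : Metric.ball 𝓒.z₀ 𝓒.r ⊆ 𝓒.K) {η : ℝ → E} {l : ℝ → ℝ}
    (hη : ContDiffOn ℝ 1 η (Icc 0 1))
    (hmaps : MapsTo η (Icc 0 1) (𝓒.K ∩ Metric.ball 𝓒.z₀ (𝓒.r / 2)))
    (hl : Continuous l) (hl0 : ∀ t, 0 ≤ l t)
    (hle : ∀ t ∈ Icc (0 : ℝ) 1, l t =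
      √(𝓒.B (η t) (derivWithin η (Icc 0 1) t) (derivWithin η (Icc 0 1) t)))
    {α κ : ℝ} (hφ : ∀ t ∈ Icc (0 : ℝ) 1, α + κ * ∫ τ in (0 : ℝ)..t, l τ ∈ Icc (0 : ℝ) 1)
    {w : E} (hw : ‖w‖ < 𝓒.r / 2) :
    dist (𝓒.e (η 0 + α • w)) (𝓒.e (η 1 + (α + κ * ∫ τ in (0 : ℝ)..1, l τ) • w)) +
      dist (𝓒.e (η 0 - α • w)) (𝓒.e (η 1 - (α + κ * ∫ τ in (0 : ℝ)..1, l τ) • w)) ≤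
      (2 + 2 * 𝓒.C ^ 3 * (1 + κ ^ 2) * ‖w‖ ^ 2) * ∫ τ in (0 : ℝ)..1, l τ := by
  have hmaps' := hmaps.mono_right 𝓒.half_subset_dom
  have hφw : ∀ t ∈ Icc (0 : ℝ) 1, ‖(α + κ * ∫ τ in (0 : ℝ)..t, l τ) • w‖ ≤ ‖w‖ := by
    intro t ht
    rw [norm_smul, Real.norm_of_nonneg (hφ t ht).1]
    exact mul_le_of_le_one_left (norm_nonneg _) (hφ t ht).2
  have hin : ∀ z ∈ 𝓒.K ∩ Metric.ball 𝓒.z₀ (𝓒.r / 2), ∀ v : E, ‖v‖ ≤ ‖w‖ → z + v ∈ 𝓒.dom := by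
    intro z hz v hv
    have : z + v ∈ Metric.ball 𝓒.z₀ 𝓒.r := by
      have h1 := hz.2
      rw [mem_ball_iff_norm] at h1 ⊢
      have := norm_add_le (z - 𝓒.z₀) v
      rw [show z + v - 𝓒.z₀ = z - 𝓒.z₀ + v by abel]
      linarith
    exact ⟨hball this, this⟩
  have hp : MapsTo (deform η l α κ w) (Icc 0 1) 𝓒.dom := fun t ht =>
    hin _ (hmaps ht) _ (hφw t ht)
  have hm : MapsTo (deform η l α κ (-w)) (Icc 0 1) 𝓒.dom := fun t ht =>
    hin _ (hmaps ht) _ (by rw [smul_neg, norm_neg]; exact hφw t ht)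
  have h3 := 𝓒.dist_deform_le hη hl α κ w hp
  have h4 := 𝓒.dist_deform_le hη hl α κ (-w) hm
  simp only [smul_neg, ← sub_eq_add_neg] at h4
  refine (add_le_add h3 h4).trans ?_
  have i3 := 𝓒.intervalIntegrable_deform hη hl α κ w hp
  have i4 := 𝓒.intervalIntegrable_deform hη hl α κ (-w) hm
  simp only [smul_neg, ← sub_eq_add_neg] at i4
  rw [← intervalIntegral.integral_add i3 i4, ← intervalIntegral.integral_const_mul]
  refine intervalIntegral.integral_mono_on zero_le_one (i3.add i4)
    ((hl.intervalIntegrable 0 1).const_mul _) fun t ht => ?_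
  have ht1 := hp ht
  have ht2 := hm ht
  simp only [deform, smul_neg, ← sub_eq_add_neg] at ht1 ht2 ⊢
  refine 𝓒.second_variation_le (hl0 t) ht1 ht2 ?_ (𝓒.norm_derivWithin_le_of_speed hmaps' hle ht)
    (hφw t ht) (h2 _ _ _ (hmaps' ht) ht1 ht2)
  rw [hle t ht, Real.sq_sqrt (𝓒.nonneg_B (hmaps' ht) _)]

/-- Moving both endpoints by `±w` increases the mean of the two distances at most by a second order
term, proportional to the distance itself; it does not blow up as `b` tends to `a`. -/
theorem dist_translate_le (h2 : 𝓒.SecondDifferencesBounded)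
    (hball : Metric.ball 𝓒.z₀ 𝓒.r ⊆ 𝓒.K) {a b w : E} (ha : a ∈ 𝓒.K ∩ Metric.ball 𝓒.z₀ 𝓒.s)
    (hb : b ∈ 𝓒.K ∩ Metric.ball 𝓒.z₀ 𝓒.s) (hw : ‖w‖ < 𝓒.r / 2) :
    dist (𝓒.e (a + w)) (𝓒.e (b + w)) + dist (𝓒.e (a - w)) (𝓒.e (b - w)) ≤
      (2 + 2 * 𝓒.C ^ 3 * ‖w‖ ^ 2) * dist (𝓒.e a) (𝓒.e b) := by
  refine le_of_approx (Φ := fun L => (2 + 2 * 𝓒.C ^ 3 * ‖w‖ ^ 2) * L) (by fun_prop) ?_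
  intro ε hε
  obtain ⟨η, l, hη, h0, h1, hmaps, hl, hl0, hle, hlow, hlen⟩ := 𝓒.exists_short_curve ha hb hε
  refine ⟨_, hlow, hlen, ?_⟩
  -- the whole curve is translated
  have := 𝓒.dist_add_dist_deform_le h2 hball hη hmaps hl hl0 hle (α := 1) (κ := 0) (by simp) hw
  simpa [h0, h1] using this

/-- Moving one endpoint by `±w` increases the mean of the two distances at most by a second order
term, which blows up as the points get close. -/
theorem dist_add_dist_le (h2 : 𝓒.SecondDifferencesBounded)
    (hball : Metric.ball 𝓒.z₀ 𝓒.r ⊆ 𝓒.K) {a b w : E} (ha : a ∈ 𝓒.K ∩ Metric.ball 𝓒.z₀ 𝓒.s)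
    (hb : b ∈ 𝓒.K ∩ Metric.ball 𝓒.z₀ 𝓒.s) (hw : ‖w‖ < 𝓒.r / 2) {D : ℝ}
    (hD : dist (𝓒.e a) (𝓒.e b) = D) (hD0 : 0 < D) :
    dist (𝓒.e (a + w)) (𝓒.e b) + dist (𝓒.e (a - w)) (𝓒.e b) ≤
      2 * D + 2 * 𝓒.C ^ 3 * (D + D⁻¹) * ‖w‖ ^ 2 := by
  refine le_of_approx (Φ := fun L => 2 * L + 2 * 𝓒.C ^ 3 * (L + L⁻¹) * ‖w‖ ^ 2) ?_ ?_
  · have : D ≠ 0 := hD0.ne'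
    fun_prop (disch := assumption)
  intro ε hε
  obtain ⟨η, l, hη, h0, h1, hmaps, hl, hl0, hle, hlow, hlen⟩ := 𝓒.exists_short_curve ha hb hε
  rw [hD] at hlow hlen
  refine ⟨_, hlow, hlen, ?_⟩
  set L := ∫ t in (0 : ℝ)..1, l t with hL
  have hL0 : 0 < L := hD0.trans_le hlow
  have hφ : ∀ t ∈ Icc (0 : ℝ) 1, 1 + -L⁻¹ * ∫ τ in (0 : ℝ)..t, l τ ∈ Icc (0 : ℝ) 1 := by
    intro t ht
    have h := arclength_mem hl hl0 ht
    have h2 : L⁻¹ * ∫ τ in (0 : ℝ)..t, l τ ≤ 1 := by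
      rw [inv_mul_le_iff₀ hL0, mul_one]; exact h.2
    have h3 : 0 ≤ L⁻¹ * ∫ τ in (0 : ℝ)..t, l τ := mul_nonneg (inv_nonneg.2 hL0.le) h.1
    constructor <;> linarith
  -- the displacement decreases linearly in arclength and vanishes at the second endpoint
  have := 𝓒.dist_add_dist_deform_le h2 hball hη hmaps hl hl0 hle hφ hw
  have hL1 : 1 + -L⁻¹ * L = 0 := by field_simp; ring
  rw [h0, h1, one_smul, ← hL, hL1, zero_smul, add_zero, sub_zero] at this
  refine this.trans_eq ?_
  field_simp

end MetricChart

/-! ### Charts of a Riemannian manifold -/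

section

/-- A positive definite form in finite dimension is bounded below on the unit sphere. -/
lemma exists_pos_mul_sq_le {E : Type*} [NormedAddCommGroup E] [NormedSpace ℝ E]
    [FiniteDimensional ℝ E] (B : E →L[ℝ] E →L[ℝ] ℝ) (hB : ∀ u, u ≠ 0 → 0 < B u u) :
    ∃ m > 0, ∀ u, m * ‖u‖ ^ 2 ≤ B u u := by
  rcases (Metric.sphere (0 : E) 1).eq_empty_or_nonempty with h | h
  · refine ⟨1, one_pos, fun u => ?_⟩
    by_cases hu : u = 0
    · simp [hu]
    · exfalso
      have : (‖u‖⁻¹ • u) ∈ Metric.sphere (0 : E) 1 := by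
        simp [norm_smul, norm_ne_zero_iff.2 hu]
      rw [h] at this
      exact this
  · have hc : Continuous fun u => B u u := B.continuous.clm_apply continuous_id
    obtain ⟨v, hv, hmin⟩ := (isCompact_sphere (0 : E) 1).exists_isMinOn h hc.continuousOn
    have hv0 : v ≠ 0 := by
      rintro rfl
      simp at hv
    refine ⟨B v v, hB v hv0, fun u => ?_⟩
    by_cases hu : u = 0
    · simp [hu]
    · have hn : ‖u‖ ≠ 0 := norm_ne_zero_iff.2 hu
      have h1 : (‖u‖⁻¹ • u) ∈ Metric.sphere (0 : E) 1 := by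
        simp [norm_smul, hn]
      have h2 := isMinOn_iff.1 hmin _ h1
      simp only [map_smul, smul_apply, smul_eq_mul] at h2
      calc B v v * ‖u‖ ^ 2 ≤ (‖u‖⁻¹ * (‖u‖⁻¹ * B u u)) * ‖u‖ ^ 2 := by gcongr
        _ = B u u := by field_simp

/-- A map with Lipschitz derivative has bounded second differences: its error to the tangent map at
`z` is quadratic on both sides. -/
lemma norm_second_difference_le {E F : Type*} [NormedAddCommGroup E] [NormedSpace ℝ E]
    [NormedAddCommGroup F] [NormedSpace ℝ F] {f : E → F} {S : Set E} (hS : Convex ℝ S)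
    (hd : ∀ y ∈ S, DifferentiableAt ℝ f y) {L : NNReal} (hL : LipschitzOnWith L (fderiv ℝ f) S)
    {z φ : E} (hz : z ∈ S) (hp : z + φ ∈ S) (hm : z - φ ∈ S) :
    ‖f (z + φ) + f (z - φ) - (2 : ℝ) • f z‖ ≤ 2 * L * ‖φ‖ ^ 2 := by
  have key : ∀ ψ : E, ‖ψ‖ = ‖φ‖ → z + ψ ∈ S →
      ‖f (z + ψ) - f z - fderiv ℝ f z ψ‖ ≤ L * ‖φ‖ ^ 2 := by
    intro ψ hψ hzψ
    have hconv : Convex ℝ (S ∩ Metric.closedBall z ‖φ‖) := hS.inter (convex_closedBall _ _)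
    have := hconv.norm_image_sub_le_of_norm_hasFDerivWithin_le' (f := f) (f' := fderiv ℝ f)
      (φ := fderiv ℝ f z) (C := L * ‖φ‖) (x := z) (y := z + ψ)
      (fun y hy => (hd y hy.1).hasFDerivAt.hasFDerivWithinAt) ?_
      ⟨hz, Metric.mem_closedBall_self (norm_nonneg _)⟩ ⟨hzψ, by simp [hψ]⟩
    · rw [add_sub_cancel_left, hψ] at this
      linarith [this]
    · intro y hy
      have h2 := hL.dist_le_mul y hy.1 z hz
      rw [dist_eq_norm] at h2
      exact h2.trans (by gcongr; exact hy.2)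
  have e1 := key φ rfl hp
  have e2 := key (-φ) (norm_neg _) (by rwa [← sub_eq_add_neg])
  rw [← sub_eq_add_neg, map_neg, sub_neg_eq_add] at e2
  have e3 := norm_add_le (f (z + φ) - f z - fderiv ℝ f z φ) (f (z - φ) - f z + fderiv ℝ f z φ)
  have e4 : f (z + φ) + f (z - φ) - (2 : ℝ) • f z =
      f (z + φ) - f z - fderiv ℝ f z φ + (f (z - φ) - f z + fderiv ℝ f z φ) := by
    rw [two_smul]; abel
  rw [e4]
  linarith

/-- A `C²` map has bounded second differences near a point. -/
lemma exists_second_difference_le {E F : Type*} [NormedAddCommGroup E] [NormedSpace ℝ E]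
    [NormedAddCommGroup F] [NormedSpace ℝ F] {f : E → F} {x : E} (hf : ContDiffAt ℝ 2 f x) :
    ∃ C : ℝ, ∃ r > 0, ∀ z φ, z ∈ Metric.ball x r → z + φ ∈ Metric.ball x r →
      z - φ ∈ Metric.ball x r → ‖f (z + φ) + f (z - φ) - (2 : ℝ) • f z‖ ≤ C * ‖φ‖ ^ 2 := by
  have h1 : ContDiffAt ℝ 1 (fderiv ℝ f) x := hf.fderiv_right (m := 1) (by norm_num)
  obtain ⟨L, t, ht, hL⟩ := h1.exists_lipschitzOnWith
  have hd : ∀ᶠ y in 𝓝 x, DifferentiableAt ℝ f y :=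
    (hf.eventually (by simp)).mono fun y hy => hy.differentiableAt (by norm_num)
  obtain ⟨r, hr, hball⟩ := Metric.mem_nhds_iff.1 (inter_mem ht hd)
  exact ⟨2 * L, r, hr, fun z φ hz hp hm => norm_second_difference_le (convex_ball x r)
    (fun y hy => (hball hy).2) (hL.mono fun y hy => (hball hy).1) hz hp hm⟩

/-- A compactly supported `C²` function is bounded, Lipschitz, and has bounded second
differences. -/
lemma exists_forall_difference_le {E : Type*} [NormedAddCommGroup E] [NormedSpace ℝ E]
    {f : E → ℝ} (hf : ContDiff ℝ 2 f) (hc : HasCompactSupport f) :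
    ∃ L ≥ (0 : ℝ), (∀ z, |f z| ≤ L) ∧ (∀ z w, |f (z + w) - f z| ≤ L * ‖w‖) ∧
      ∀ z w, |f (z + w) + f (z - w) - 2 * f z| ≤ L * ‖w‖ ^ 2 := by
  obtain ⟨L₀, h₀⟩ := hc.exists_bound_of_continuous hf.continuous
  obtain ⟨L₁, h₁⟩ := hf.lipschitzWith_of_hasCompactSupport hc (by norm_num)
  have h1 : ContDiff ℝ 1 (fderiv ℝ f) := hf.fderiv_right (m := 1) (by norm_num)
  obtain ⟨L₂, h₂⟩ := h1.lipschitzWith_of_hasCompactSupport (hc.fderiv ℝ) (by norm_num)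
  have hL₀ : 0 ≤ L₀ := (norm_nonneg _).trans (h₀ 0)
  have n1 := L₁.coe_nonneg
  have n2 := L₂.coe_nonneg
  refine ⟨L₀ + L₁ + 2 * L₂, by positivity, fun z => ?_, fun z w => ?_, fun z w => ?_⟩
  · exact (h₀ z).trans (by linarith)
  · have := h₁.dist_le_mul (z + w) z
    rw [dist_eq_norm, dist_eq_norm, add_sub_cancel_left] at this
    exact this.trans (by gcongr; linarith)
  · have := norm_second_difference_le convex_univ
      (fun y _ => (hf.differentiable (by norm_num)).differentiableAt) h₂.lipschitzOnWith
      (mem_univ z) (mem_univ (z + w)) (mem_univ (z - w))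
    exact this.trans (by gcongr; linarith)

lemma exists_norm_sub_le_of_contDiffWithinAt {E F : Type*} [NormedAddCommGroup E]
    [NormedSpace ℝ E] [NormedAddCommGroup F] [NormedSpace ℝ F] {f : E → F} {K : Set E}
    (hK : Convex ℝ K) {x : E} (hf : ContDiffWithinAt ℝ 1 f K x) :
    ∃ L ≥ (0 : ℝ), ∃ r > 0, ∀ z ∈ K ∩ Metric.ball x r, ∀ z' ∈ K ∩ Metric.ball x r,
      ‖f z - f z'‖ ≤ L * ‖z - z'‖ := by
  obtain ⟨L, t, ht, hL⟩ := hf.exists_lipschitzOnWith hK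
  obtain ⟨r, hr, hball⟩ := Metric.mem_nhdsWithin_iff.1 ht
  refine ⟨L, L.2, r, hr, fun z hz z' hz' => ?_⟩
  rw [← dist_eq_norm, ← dist_eq_norm]
  exact hL.dist_le_mul z (hball hz.symm) z' (hball hz'.symm)

/-- A symmetric positive definite bilinear form that is `C¹` on a convex set stays bounded,
uniformly positive and Lipschitz near a point of the set. -/
lemma exists_uniform_bounds {E : Type*} [NormedAddCommGroup E] [NormedSpace ℝ E]
    [FiniteDimensional ℝ E] {B : E → E →L[ℝ] E →L[ℝ] ℝ} {K : Set E} (hK : Convex ℝ K) {x : E}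
    (hx : x ∈ K) (hB : ContDiffWithinAt ℝ 1 B K x) (hpos : ∀ u, u ≠ 0 → 0 < B x u u) :
    ∃ C ≥ 1, ∃ r > 0, ∀ z ∈ K ∩ Metric.ball x r, (∀ u, ‖u‖ ≤ C * √(B z u u)) ∧ ‖B z‖ ≤ C ∧
      ∀ z' ∈ K ∩ Metric.ball x r, ‖B z - B z'‖ ≤ C * ‖z - z'‖ := by
  obtain ⟨L, hL0, r, hr, hLip⟩ := exists_norm_sub_le_of_contDiffWithinAt hK hB
  obtain ⟨m, hm, hmB⟩ := exists_pos_mul_sq_le (B x) hpos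
  have hxt : x ∈ K ∩ Metric.ball x r := ⟨hx, Metric.mem_ball_self hr⟩
  -- within distance `m / (2 * (L + 1))` of `x`, the form is still at least `m / 2`
  set ρ := min r (min 1 (m / (2 * (L + 1)))) with hρ
  have hρ0 : 0 < ρ := by positivity
  refine ⟨1 + L + ‖B x‖ + √(2 / m), ?_, ρ, hρ0, fun z hz => ?_⟩
  · have := norm_nonneg (B x)
    have := Real.sqrt_nonneg (2 / m)
    linarith
  have hsub : ∀ z ∈ K ∩ Metric.ball x ρ, z ∈ K ∩ Metric.ball x r := fun z hz =>
    ⟨hz.1, Metric.ball_subset_ball (min_le_left _ _) hz.2⟩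
  have hzx : ‖z - x‖ < ρ := mem_ball_iff_norm.1 hz.2
  have hz1 : ‖z - x‖ ≤ 1 := hzx.le.trans ((min_le_right _ _).trans (min_le_left _ _))
  have hz2 : ‖z - x‖ ≤ m / (2 * (L + 1)) :=
    hzx.le.trans ((min_le_right _ _).trans (min_le_right _ _))
  have hBz : ‖B z - B x‖ ≤ L * ‖z - x‖ := hLip z (hsub z hz) x hxt
  have hs0 := Real.sqrt_nonneg (2 / m)
  have hn0 := norm_nonneg (B x)
  refine ⟨fun u => ?_, ?_, fun z' hz' => ?_⟩
  · have h1 : |B z u u - B x u u| ≤ m / 2 * ‖u‖ ^ 2 := by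
      have h2 := (B z - B x).le_opNorm₂ u u
      rw [Real.norm_eq_abs] at h2
      refine (by simpa using h2 : _ ≤ _).trans ?_
      have h3 : ‖B z - B x‖ ≤ m / 2 := by
        refine hBz.trans ?_
        calc L * ‖z - x‖ ≤ (L + 1) * (m / (2 * (L + 1))) := by gcongr; linarith
          _ = m / 2 := by field_simp
      calc _ ≤ m / 2 * ‖u‖ * ‖u‖ := by gcongr
        _ = _ := by ring
    have h2 : m / 2 * ‖u‖ ^ 2 ≤ B z u u := by
      have := hmB u
      have := (abs_le.1 h1).1
      linarith
    have h3 : ‖u‖ ≤ √(2 / m) * √(B z u u) := by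
      rw [← Real.sqrt_mul (by positivity)]
      refine Real.le_sqrt_of_sq_le ?_
      calc ‖u‖ ^ 2 = 2 / m * (m / 2 * ‖u‖ ^ 2) := by field_simp
        _ ≤ _ := by gcongr
    refine h3.trans ?_
    gcongr
    linarith
  · have := norm_le_norm_add_norm_sub' (B z) (B x)
    nlinarith
  · refine (hLip z (hsub z hz) z' (hsub z' hz')).trans ?_
    gcongr
    linarith

end

section

variable {d : ℕ} {H : Type*} [TopologicalSpace H]
  {I : ModelWithCorners ℝ (EuclideanSpace ℝ (Fin d)) H}
  {M : Type*} [MetricSpace M] [ChartedSpace H M]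
  [RiemannianBundle (fun x : M => TangentSpace I x)]

lemma norm_mfderivWithin_extChartAt_symm (q : M) (z u : EuclideanSpace ℝ (Fin d)) :
    ‖mfderivWithin 𝓘(ℝ, EuclideanSpace ℝ (Fin d)) I (extChartAt I q).symm (range I) z u‖ =
      √(metricForm I q z u u) := by
  rw [metricForm_apply, real_inner_self_eq_norm_sq, Real.sqrt_sq (norm_nonneg _)]

lemma metricForm_comm (q : M) (z u w : EuclideanSpace ℝ (Fin d)) :
    metricForm I q z u w = metricForm I q z w u := by
  rw [metricForm_apply, metricForm_apply, real_inner_comm]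

variable [IsManifold I ∞ M]

lemma metricForm_pos (q : M) {z u : EuclideanSpace ℝ (Fin d)} (hz : z ∈ (extChartAt I q).target)
    (hu : u ≠ 0) : 0 < metricForm I q z u u := by
  rw [metricForm_apply, real_inner_self_eq_norm_sq]
  have hinv := isInvertible_mfderivWithin_extChartAt_symm hz
  have : mfderivWithin 𝓘(ℝ, EuclideanSpace ℝ (Fin d)) I (extChartAt I q).symm (range I) z u ≠
      0 := by
    intro h
    exact hu (hinv.injective (h.trans (map_zero _).symm))
  have := norm_pos_iff.2 this
  positivity

/-- The length of a curve in a chart, as a real integral. -/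
lemma setLIntegral_speed_eq [IsContMDiffRiemannianBundle I ∞ (EuclideanSpace ℝ (Fin d))
    (fun x : M => TangentSpace I x)] (q : M) {η : ℝ → EuclideanSpace ℝ (Fin d)}
    (hη : ContDiffOn ℝ 1 η (Icc 0 1)) (hmaps : MapsTo η (Icc 0 1) (extChartAt I q).target) :
    ∫⁻ t in Icc (0 : ℝ) 1, ‖mfderivWithin 𝓘(ℝ, EuclideanSpace ℝ (Fin d)) I (extChartAt I q).symm
        (range I) (η t) (derivWithin η (Icc 0 1) t)‖ₑ =
      ENNReal.ofReal (∫ t in (0 : ℝ)..1, √(metricForm I q (η t) (derivWithin η (Icc 0 1) t)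
        (derivWithin η (Icc 0 1) t))) := by
  have hc : ContinuousOn (fun t => √(metricForm I q (η t) (derivWithin η (Icc 0 1) t)
      (derivWithin η (Icc 0 1) t))) (Icc 0 1) := by
    have h1 := (contDiffOn_metricForm q).continuousOn.comp hη.continuousOn hmaps
    have h2 := hη.continuousOn_derivWithin (uniqueDiffOn_Icc zero_lt_one) le_rfl
    exact ((h1.clm_apply h2).clm_apply h2).sqrt
  rw [intervalIntegral.integral_of_le zero_le_one, ← integral_Icc_eq_integral_Ioc,
    ofReal_integral_eq_lintegral_ofReal (hc.integrableOn_Icc)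
      (Eventually.of_forall fun t => Real.sqrt_nonneg _)]
  refine lintegral_congr fun t => ?_
  rw [← norm_mfderivWithin_extChartAt_symm, ofReal_norm]
  rfl

omit [RiemannianBundle (fun x : M => TangentSpace I x)] [IsManifold I ∞ M] in
lemma exists_ball_extChartAt_symm_mem (q : M) {u : Set M} (hu : u ∈ 𝓝 q) :
    ∃ s > 0, ∀ a ∈ range I ∩ Metric.ball (extChartAt I q q) s, (extChartAt I q).symm a ∈ u := by
  have h : (extChartAt I q).symm ⁻¹' u ∈ 𝓝 (extChartAt I q q) := extChartAt_preimage_mem_nhds hu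
  obtain ⟨s, hs, hball⟩ := Metric.mem_nhds_iff.1 h
  exact ⟨s, hs, fun a ha => hball ha.2⟩

/-- Every point of a Riemannian manifold is the centre of arbitrarily small metric charts; at an
interior point, two derivatives of the metric are controlled as well. -/
theorem exists_metricChart [IsContMDiffRiemannianBundle I ∞ (EuclideanSpace ℝ (Fin d))
    (fun x : M => TangentSpace I x)] [IsRiemannianManifold I M] (q : M) {R : ℝ} (hR : 0 < R) :
    ∃ 𝓒 : MetricChart M (EuclideanSpace ℝ (Fin d)), 𝓒.r ≤ R ∧ 𝓒.K = range I ∧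
      𝓒.e = (extChartAt I q).symm ∧ 𝓒.z₀ = extChartAt I q q ∧ 𝓒.B = metricForm I q ∧
      𝓒.dom ⊆ (extChartAt I q).target ∧
      (extChartAt I q q ∈ interior (range I) →
        Metric.ball 𝓒.z₀ 𝓒.r ⊆ 𝓒.K ∧ 𝓒.SecondDifferencesBounded) := by
  set z₀ := extChartAt I q q with hz₀
  have hz₀t : z₀ ∈ (extChartAt I q).target := mem_extChartAt_target q
  have hz₀K : z₀ ∈ range I := extChartAt_target_subset_range q hz₀t
  have hK : Convex ℝ (range I) := I.convex_range
  have htn : (extChartAt I q).target ∈ 𝓝[range I] z₀ := extChartAt_target_mem_nhdsWithin q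
  have hB : ContDiffWithinAt ℝ 2 (metricForm I q) (range I) z₀ :=
    ((contDiffOn_metricForm q z₀ hz₀t).mono_of_mem_nhdsWithin htn).of_le ENat.LEInfty.out
  obtain ⟨C₁, hC₁, r₁, hr₁, h₁⟩ := exists_uniform_bounds hK hz₀K (hB.of_le (by norm_num))
    fun u hu => metricForm_pos q hz₀t hu
  obtain ⟨r₂, hr₂, h₂⟩ := Metric.mem_nhdsWithin_iff.1 htn
  obtain ⟨C₃, r₃', hr₃', h₃'⟩ : ∃ C : ℝ, ∃ r > 0, z₀ ∈ interior (range I) →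
      Metric.ball z₀ r ⊆ range I ∧ ∀ z φ, z ∈ Metric.ball z₀ r → z + φ ∈ Metric.ball z₀ r →
      z - φ ∈ Metric.ball z₀ r → ‖metricForm I q (z + φ) + metricForm I q (z - φ) -
        (2 : ℝ) • metricForm I q z‖ ≤ C * ‖φ‖ ^ 2 := by
    by_cases hi : z₀ ∈ interior (range I)
    · have hn : range I ∈ 𝓝 z₀ := mem_interior_iff_mem_nhds.1 hi
      obtain ⟨C, r, hr, h⟩ := exists_second_difference_le (hB.contDiffAt hn)
      obtain ⟨r', hr', hb⟩ := Metric.mem_nhds_iff.1 hn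
      refine ⟨C, min r r', by positivity, fun _ =>
        ⟨(Metric.ball_subset_ball (min_le_right _ _)).trans hb, fun z φ hz hp hm => ?_⟩⟩
      have hsub := Metric.ball_subset_ball (x := z₀) (min_le_left r r')
      exact h z φ (hsub hz) (hsub hp) (hsub hm)
    · exact ⟨0, 1, one_pos, fun h => absurd h hi⟩
  set r₃ := min r₃' R with hr₃def
  have hr₃ : 0 < r₃ := by positivity
  have h₃ : z₀ ∈ interior (range I) → Metric.ball z₀ r₃ ⊆ range I ∧
      ∀ z φ, z ∈ Metric.ball z₀ r₃ → z + φ ∈ Metric.ball z₀ r₃ →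
      z - φ ∈ Metric.ball z₀ r₃ → ‖metricForm I q (z + φ) + metricForm I q (z - φ) -
        (2 : ℝ) • metricForm I q z‖ ≤ C₃ * ‖φ‖ ^ 2 := fun hi => by
    have hsub := Metric.ball_subset_ball (x := z₀) (min_le_left r₃' R)
    exact ⟨hsub.trans (h₃' hi).1, fun z φ hz hp hm =>
      (h₃' hi).2 z φ (hsub hz) (hsub hp) (hsub hm)⟩
  set r := min r₁ (min r₂ r₃) with hr
  have hr0 : 0 < r := by positivity
  have hrr₁ : r ≤ r₁ := min_le_left _ _
  have hrr₂ : r ≤ r₂ := (min_le_right _ _).trans (min_le_left _ _)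
  have hrr₃ : r ≤ r₃ := (min_le_right _ _).trans (min_le_right _ _)
  have hsub₁ : ∀ z ∈ range I ∩ Metric.ball z₀ r, z ∈ range I ∩ Metric.ball z₀ r₁ := fun z hz =>
    ⟨hz.1, Metric.ball_subset_ball hrr₁ hz.2⟩
  have hdom : range I ∩ Metric.ball z₀ r ⊆ (extChartAt I q).target := fun z hz =>
    h₂ ⟨Metric.ball_subset_ball hrr₂ hz.2, hz.1⟩
  -- curves that start near `q` and are short do not leave the half-sized chart
  set u : Set M := (extChartAt I q).source ∩ extChartAt I q ⁻¹' Metric.ball z₀ (r / 2) with hu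
  have hun : u ∈ 𝓝 q := inter_mem (extChartAt_source_mem_nhds q)
    ((continuousAt_extChartAt q).preimage_mem_nhds (Metric.ball_mem_nhds _ (by positivity)))
  obtain ⟨δ, hδ, hδu⟩ := Metric.mem_nhds_iff.1 hun
  obtain ⟨s, hs, hsδ⟩ := exists_ball_extChartAt_symm_mem (I := I) q
    (Metric.ball_mem_nhds q (by positivity : 0 < δ / 4))
  set C := max C₁ C₃ with hC
  have hC1 : C₁ ≤ C := le_max_left _ _
  have hC3 : C₃ ≤ C := le_max_right _ _
  refine ⟨
    { K := range I
      e := (extChartAt I q).symm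
      z₀ := z₀
      r := r
      s := min s r
      C := C
      B := metricForm I q
      r_pos := hr0
      s_pos := by positivity
      s_le := min_le_right _ _
      one_le_C := hC₁.trans hC1
      z₀_mem := hz₀K
      convex := hK
      symm := fun z _ u w => metricForm_comm q z u w
      norm_le := fun z hz u => ((h₁ z (hsub₁ z hz)).1 u).trans (by gcongr)
      norm_B_le := fun z hz => (h₁ z (hsub₁ z hz)).2.1.trans hC1
      norm_B_sub_le := fun z hz z' hz' =>
        ((h₁ z (hsub₁ z hz)).2.2 z' (hsub₁ z' hz')).trans (by gcongr)
      dist_le_length := ?_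
      exists_length_le := ?_
      eventually_mem_image := ?_ },
    hrr₃.trans (min_le_right _ _), rfl, rfl, rfl, rfl, hdom, fun hi => ⟨?_, ?_⟩⟩
  · intro η hη hmaps
    have h := edist_extChartAt_symm_le q hη (hmaps.mono_right hdom)
    rw [setLIntegral_speed_eq q hη (hmaps.mono_right hdom), edist_dist] at h
    exact (ENNReal.ofReal_le_ofReal_iff (intervalIntegral.integral_nonneg zero_le_one
      fun t _ => Real.sqrt_nonneg _)).1 h
  · intro a ha b hb ε hε
    have hmin : ∀ z ∈ range I ∩ Metric.ball z₀ (min s r), z ∈ (extChartAt I q).target ∧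
        dist ((extChartAt I q).symm z) q < δ / 4 := fun z hz =>
      ⟨hdom ⟨hz.1, Metric.ball_subset_ball (min_le_right _ _) hz.2⟩,
        hsδ z ⟨hz.1, Metric.ball_subset_ball (min_le_left _ _) hz.2⟩⟩
    obtain ⟨hat, had⟩ := hmin a ha
    obtain ⟨hbt, hbd⟩ := hmin b hb
    set x := (extChartAt I q).symm a with hx
    set y := (extChartAt I q).symm b with hy
    have hxy : dist x y < δ / 2 := by
      have := dist_triangle_right x y q
      linarith
    set ε' := min ε (δ / 4) with hε'
    have hε'0 : 0 < ε' := by positivity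
    have hε'1 : ε' ≤ ε := min_le_left _ _
    have hε'2 : ε' ≤ δ / 4 := min_le_right _ _
    have hball : ∀ m, edist x m < ENNReal.ofReal (dist x y + ε') → m ∈ u := by
      intro m hm
      rw [edist_dist, ENNReal.ofReal_lt_ofReal_iff_of_nonneg dist_nonneg] at hm
      apply hδu
      rw [Metric.mem_ball]
      have := dist_triangle_left m q x
      linarith
    have hL : edist x y < ENNReal.ofReal (dist x y + ε') := by
      rw [edist_dist]
      exact (ENNReal.ofReal_lt_ofReal_iff_of_nonneg dist_nonneg).2 (by linarith)
    obtain ⟨η, hη, h0, h1, hmaps, hlen⟩ := exists_path_extChartAt (I := I) q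
      (fun m hm => hm.1) hball hL
    rw [hx, (extChartAt I q).right_inv hat] at h0
    rw [hy, (extChartAt I q).right_inv hbt] at h1
    refine ⟨η, hη, h0, h1, fun t ht => ?_, ?_⟩
    · obtain ⟨m1, m2⟩ := hmaps ht
      refine ⟨extChartAt_target_subset_range q m1, ?_⟩
      have m3 : extChartAt I q ((extChartAt I q).symm (η t)) ∈ Metric.ball z₀ (r / 2) := m2.2
      rwa [(extChartAt I q).right_inv m1] at m3
    · rw [setLIntegral_speed_eq q hη fun t ht => (hmaps ht).1] at hlen
      have := (ENNReal.ofReal_lt_ofReal_iff_of_nonneg (intervalIntegral.integral_nonneg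
        zero_le_one fun t _ => Real.sqrt_nonneg _)).1 hlen
      linarith
  · intro b hb ε hε
    have hbt := hdom hb
    have hc : ContinuousAt (extChartAt I q) ((extChartAt I q).symm b) :=
      continuousAt_extChartAt' ((extChartAt I q).map_target hbt)
    have hn : ∀ᶠ m in 𝓝 ((extChartAt I q).symm b), extChartAt I q m ∈ Metric.ball b ε := by
      refine hc.eventually ?_
      rw [(extChartAt I q).right_inv hbt]
      exact Metric.ball_mem_nhds b hε
    filter_upwards [hn, (isOpen_extChartAt_source q).mem_nhds ((extChartAt I q).map_target hbt)]
      with m hm hms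
    exact ⟨extChartAt I q m, ⟨mem_range_self _, hm⟩, (extChartAt I q).left_inv hms⟩
  · exact (Metric.ball_subset_ball hrr₃).trans (h₃ hi).1
  · intro z φ v hz hp hm
    have hsub : ∀ z ∈ range I ∩ Metric.ball z₀ r, z ∈ Metric.ball z₀ r₃ := fun z hz =>
      Metric.ball_subset_ball hrr₃ hz.2
    have h := (h₃ hi).2 z φ (hsub z hz) (hsub _ hp) (hsub _ hm)
    have h' := (metricForm I q (z + φ) + metricForm I q (z - φ) -
      (2 : ℝ) • metricForm I q z).le_opNorm₂ v v
    rw [Real.norm_eq_abs] at h'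
    simp only [sub_apply, add_apply, smul_apply, smul_eq_mul] at h'
    refine h'.trans ?_
    calc _ ≤ C * ‖φ‖ ^ 2 * ‖v‖ * ‖v‖ := by
          gcongr
          exact h.trans (by gcongr)
      _ = _ := by ring

end

/-! ### The Riemannian volume in a chart -/

section

variable {d : ℕ} {H : Type*} [TopologicalSpace H]
  {I : ModelWithCorners ℝ (EuclideanSpace ℝ (Fin d)) H}
  {M : Type*} [MetricSpace M] [ChartedSpace H M]
  [RiemannianBundle (fun x : M => TangentSpace I x)]

lemma metricMatrix_eq (q : M) (z : EuclideanSpace ℝ (Fin d)) (i j : Fin d) :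
    metricMatrix I q z i j =
      metricForm I q z (EuclideanSpace.single i 1) (EuclideanSpace.single j 1) := by
  rw [metricForm_apply]
  rfl

/-- Two metric tensors related by a linear map have related determinants. -/
lemma det_of_bilin_comp {B B' : EuclideanSpace ℝ (Fin d) →L[ℝ] EuclideanSpace ℝ (Fin d) →L[ℝ] ℝ}
    (T : EuclideanSpace ℝ (Fin d) →L[ℝ] EuclideanSpace ℝ (Fin d))
    (h : ∀ u w, B u w = B' (T u) (T w)) :
    (Matrix.of fun i j => B (EuclideanSpace.single i 1) (EuclideanSpace.single j 1)).det =
      T.det ^ 2 *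
        (Matrix.of fun i j => B' (EuclideanSpace.single i 1) (EuclideanSpace.single j 1)).det := by
  set b := (EuclideanSpace.basisFun (Fin d) ℝ).toBasis
  set A := LinearMap.toMatrix b b T.toLinearMap with hA
  set G := Matrix.of fun i j => B' (EuclideanSpace.single i 1) (EuclideanSpace.single j 1) with hG
  have hTe : ∀ i, T (EuclideanSpace.single i 1) = ∑ k, A k i • EuclideanSpace.single k 1 := by
    intro i
    have h1 := b.sum_repr (T (EuclideanSpace.single i 1))
    conv_lhs => rw [← h1]
    refine Finset.sum_congr rfl fun k _ => ?_
    rw [hA, LinearMap.toMatrix_apply]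
    simp [b]
  have hmat : (Matrix.of fun i j => B (EuclideanSpace.single i 1) (EuclideanSpace.single j 1)) =
      A.transpose * G * A := by
    ext i j
    rw [Matrix.of_apply, h, hTe i, hTe j]
    simp only [map_sum, map_smul, Matrix.mul_apply, Matrix.transpose_apply, sum_apply, smul_apply,
      smul_eq_mul, Finset.sum_mul, Finset.mul_sum, hG, Matrix.of_apply]
    refine Finset.sum_congr rfl fun k _ => Finset.sum_congr rfl fun l _ => ?_
    ring
  have hdet : A.det = T.det := by
    rw [hA, LinearMap.det_toMatrix]
  rw [hmat, Matrix.det_mul, Matrix.det_mul, Matrix.det_transpose, hdet]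
  ring

lemma metricMatrix_eq_of (q : M) (z : EuclideanSpace ℝ (Fin d)) :
    metricMatrix I q z = Matrix.of fun i j =>
      metricForm I q z (EuclideanSpace.single i 1) (EuclideanSpace.single j 1) := by
  ext i j
  exact metricMatrix_eq q z i j

variable [IsManifold I ∞ M]

lemma det_metricMatrix_pos (q : M) {z : EuclideanSpace ℝ (Fin d)}
    (hz : z ∈ (extChartAt I q).target) : 0 < (metricMatrix I q z).det := by
  refine Matrix.PosDef.det_pos ?_
  refine Matrix.PosDef.of_dotProduct_mulVec_pos ?_ ?_
  · ext i j
    simp [metricMatrix_eq, metricForm_comm q z]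
  · intro x hx
    have h := metricForm_pos (I := I) q hz (u := WithLp.toLp 2 x) (by simpa using hx)
    have hx' : (WithLp.toLp 2 x : EuclideanSpace ℝ (Fin d)) =
        ∑ i, x i • EuclideanSpace.single i (1 : ℝ) := by
      ext i
      simp [Finset.sum_apply, Pi.single_apply]
    rw [hx'] at h
    simp only [map_sum, map_smul, sum_apply, smul_apply, smul_eq_mul] at h
    refine h.trans_eq ?_
    simp only [dotProduct, Matrix.mulVec, metricMatrix_eq, Pi.star_apply, star_trivial,
      Finset.mul_sum]
    rw [Finset.sum_comm]
    refine Finset.sum_congr rfl fun k _ => Finset.sum_congr rfl fun l _ => ?_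
    ring

/-- The change of coordinates from the chart at `q` to the chart at `q'` transforms the metric
tensors into one another. -/
lemma metricForm_coord_change (q q' : M) {z : EuclideanSpace ℝ (Fin d)}
    (hz : z ∈ (extChartAt I q).target) (hz' : (extChartAt I q).symm z ∈ (extChartAt I q').source)
    (u w : EuclideanSpace ℝ (Fin d)) :
    metricForm I q z u w = metricForm I q' (extChartAt I q' ((extChartAt I q).symm z))
      (fderivWithin ℝ (extChartAt I q' ∘ (extChartAt I q).symm) (range I) z u)
      (fderivWithin ℝ (extChartAt I q' ∘ (extChartAt I q).symm) (range I) z w) := by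
  set τ := extChartAt I q' ∘ (extChartAt I q).symm with hτ
  have hτz : τ z ∈ (extChartAt I q').target := (extChartAt I q').map_source hz'
  have hzr : z ∈ range I := extChartAt_target_subset_range q hz
  have hτd : DifferentiableWithinAt ℝ τ (range I) z :=
    (contDiffWithinAt_ext_coord_change (n := ∞) q' q (by
      simp only [PartialEquiv.trans_source, PartialEquiv.symm_source]
      exact ⟨hz, hz'⟩)).differentiableWithinAt (by simp)
  have hev : (extChartAt I q).symm =ᶠ[𝓝[range I] z] (extChartAt I q').symm ∘ τ := by
    have hc : ContinuousWithinAt (extChartAt I q).symm (range I) z :=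
      (continuousAt_extChartAt_symm'' hz).continuousWithinAt
    have := hc.preimage_mem_nhdsWithin ((isOpen_extChartAt_source q').mem_nhds hz')
    filter_upwards [this] with y hy
    exact ((extChartAt I q').left_inv hy).symm
  have hcomp : mfderivWithin 𝓘(ℝ, EuclideanSpace ℝ (Fin d)) I ((extChartAt I q').symm ∘ τ)
      (range I) z =
      (mfderivWithin 𝓘(ℝ, EuclideanSpace ℝ (Fin d)) I (extChartAt I q').symm (range I) (τ z)) ∘L
        (mfderivWithin 𝓘(ℝ, EuclideanSpace ℝ (Fin d)) 𝓘(ℝ, EuclideanSpace ℝ (Fin d)) τ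
          (range I) z) := by
    apply mfderivWithin_comp_of_eq (y := τ z)
    · exact mdifferentiableWithinAt_extChartAt_symm hτz
    · exact mdifferentiableWithinAt_iff_differentiableWithinAt.2 hτd
    · exact fun y _ => mem_range_self _
    · exact uniqueMDiffWithinAt_iff_uniqueDiffWithinAt.2 (I.uniqueDiffOn z hzr)
    · rfl
  have hτs : (extChartAt I q').symm (τ z) = (extChartAt I q).symm z :=
    (extChartAt I q').left_inv hz'
  have hS : ∀ v : EuclideanSpace ℝ (Fin d),
      (mfderivWithin 𝓘(ℝ, EuclideanSpace ℝ (Fin d)) I (extChartAt I q).symm (range I) z v :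
        EuclideanSpace ℝ (Fin d)) =
      mfderivWithin 𝓘(ℝ, EuclideanSpace ℝ (Fin d)) I (extChartAt I q').symm (range I) (τ z)
        (fderivWithin ℝ τ (range I) z v) := by
    intro v
    have h1 := hev.mfderivWithin_eq (I := 𝓘(ℝ, EuclideanSpace ℝ (Fin d))) (I' := I) hτs.symm
    rw [mfderivWithin_eq_fderivWithin] at hcomp
    exact congrArg (fun S : EuclideanSpace ℝ (Fin d) →L[ℝ] EuclideanSpace ℝ (Fin d) => S v)
      (h1.trans hcomp)
  -- all tangent spaces are the model space, but their inner products depend on the point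
  have hin : ∀ (p p' : M) (_ : p = p') (a b : EuclideanSpace ℝ (Fin d)),
      @inner ℝ (TangentSpace I p) _ a b = @inner ℝ (TangentSpace I p') _ a b := by
    rintro p _ rfl a b
    rfl
  rw [metricForm_apply, metricForm_apply]
  refine (hin _ _ hτs.symm _ _).trans ?_
  exact congrArg₂ (fun a b : EuclideanSpace ℝ (Fin d) =>
    @inner ℝ (TangentSpace I ((extChartAt I q').symm (τ z))) _ a b) (hS u) (hS w)

/-- The densities `√(det g)` of two charts differ by the Jacobian of the change of coordinates. -/
lemma sqrt_det_coord_change (q q' : M) {z : EuclideanSpace ℝ (Fin d)}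
    (hz : z ∈ (extChartAt I q).target)
    (hz' : (extChartAt I q).symm z ∈ (extChartAt I q').source) :
    √(metricMatrix I q z).det =
      |(fderivWithin ℝ (extChartAt I q' ∘ (extChartAt I q).symm) (range I) z).det| *
        √(metricMatrix I q' (extChartAt I q' ((extChartAt I q).symm z))).det := by
  rw [metricMatrix_eq_of, metricMatrix_eq_of,
    det_of_bilin_comp _ (metricForm_coord_change q q' hz hz'), Real.sqrt_mul (sq_nonneg _),
    Real.sqrt_sq_eq_abs]

variable [MeasurableSpace M] [BorelSpace M]

omit [RiemannianBundle (fun x : M => TangentSpace I x)] [IsManifold I ∞ M] [MeasurableSpace M]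
  [BorelSpace M] in
lemma measurableSet_extChartAt_target (q : M) : MeasurableSet (extChartAt I q).target := by
  rw [extChartAt_target]
  exact ((chartAt H q).open_target.preimage I.continuous_symm).measurableSet.inter
    I.isClosed_range.measurableSet

omit [RiemannianBundle (fun x : M => TangentSpace I x)] [IsManifold I ∞ M] in
lemma measurableSet_target_inter_preimage (q : M) {S : Set M} (hS : MeasurableSet S) :
    MeasurableSet ((extChartAt I q).target ∩ (extChartAt I q).symm ⁻¹' S) := by
  have h1 := (continuousOn_iff_continuous_domRestrict.1
    (continuousOn_extChartAt_symm (I := I) q)).measurable hS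
  convert (measurableSet_extChartAt_target q).subtype_image h1 using 1
  ext z
  simp [and_comm]

omit [RiemannianBundle (fun x : M => TangentSpace I x)] [IsManifold I ∞ M] in
lemma aemeasurable_extChartAt_symm (q : M) :
    AEMeasurable (extChartAt I q).symm
      (volume.restrict (extChartAt I q).target) :=
  (continuousOn_extChartAt_symm q).aemeasurable (measurableSet_extChartAt_target q)

omit [IsManifold I ∞ M] in
lemma chartVolume_apply (q : M) {S : Set M} (hS : MeasurableSet S) :
    chartVolume I q S = ∫⁻ z in (extChartAt I q).target ∩ (extChartAt I q).symm ⁻¹' S,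
      ENNReal.ofReal √(metricMatrix I q z).det := by
  rw [chartVolume, Measure.map_apply_of_aemeasurable
    ((aemeasurable_extChartAt_symm q).mono_ac (withDensity_absolutelyContinuous _ _)) hS,
    withDensity_apply', Measure.restrict_restrict' (measurableSet_extChartAt_target q), inter_comm]

omit [IsManifold I ∞ M] in
lemma chartVolume_compl_source (q : M) : chartVolume I q (extChartAt I q).sourceᶜ = 0 := by
  rw [chartVolume_apply q (isOpen_extChartAt_source q).measurableSet.compl]
  have : (extChartAt I q).target ∩ (extChartAt I q).symm ⁻¹' (extChartAt I q).sourceᶜ = ∅ := by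
    ext z
    simp only [mem_inter_iff, mem_preimage, mem_compl_iff, mem_empty_iff_false, iff_false, not_and,
      not_not]
    exact fun hz => (extChartAt I q).map_target hz
  rw [this, Measure.restrict_empty, lintegral_zero_measure]

/-- The volumes of two charts agree on the intersection of their domains: this is the change of
variables formula. -/
lemma chartVolume_eq_of_subset (q q' : M) {S : Set M} (hS : MeasurableSet S)
    (h : S ⊆ (extChartAt I q).source) (h' : S ⊆ (extChartAt I q').source) :
    chartVolume I q S = chartVolume I q' S := by
  set τ := extChartAt I q' ∘ (extChartAt I q).symm with hτ
  set A := (extChartAt I q).target ∩ (extChartAt I q).symm ⁻¹' S with hA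
  have hAS : ∀ z ∈ A, (extChartAt I q).symm z ∈ (extChartAt I q').source := fun z hz => h' hz.2
  have himg : τ '' A = (extChartAt I q').target ∩ (extChartAt I q').symm ⁻¹' S := by
    ext w
    constructor
    · rintro ⟨z, hz, rfl⟩
      refine ⟨(extChartAt I q').map_source (hAS z hz), ?_⟩
      simp only [hτ, mem_preimage, Function.comp, (extChartAt I q').left_inv (hAS z hz)]
      exact hz.2
    · rintro ⟨hw, hwS⟩
      refine ⟨extChartAt I q ((extChartAt I q').symm w), ⟨(extChartAt I q).map_source (h hwS), ?_⟩,
        ?_⟩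
      · simpa only [mem_preimage, (extChartAt I q).left_inv (h hwS)] using hwS
      · simp only [hτ, Function.comp, (extChartAt I q).left_inv (h hwS),
          (extChartAt I q').right_inv hw]
  have hinj : InjOn τ A := by
    intro z hz w hw hzw
    have h1 := (extChartAt I q').injOn (hAS z hz) (hAS w hw) hzw
    exact (extChartAt I q).symm.injOn hz.1 hw.1 h1
  have hder : ∀ z ∈ A, HasFDerivWithinAt τ (fderivWithin ℝ τ (range I) z) A z := by
    intro z hz
    have hτd : DifferentiableWithinAt ℝ τ (range I) z :=
      (contDiffWithinAt_ext_coord_change (n := ∞) q' q (by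
        simp only [PartialEquiv.trans_source, PartialEquiv.symm_source]
        exact ⟨hz.1, hAS z hz⟩)).differentiableWithinAt (by simp)
    exact hτd.hasFDerivWithinAt.mono fun y hy => extChartAt_target_subset_range q hy.1
  have hAm : MeasurableSet A := measurableSet_target_inter_preimage q hS
  rw [chartVolume_apply q hS, chartVolume_apply q' hS, ← himg,
    lintegral_image_eq_lintegral_abs_det_fderiv_mul volume hAm hder hinj]
  refine setLIntegral_congr_fun hAm fun z hz => ?_
  rw [sqrt_det_coord_change q q' hz.1 (hAS z hz), ENNReal.ofReal_mul (abs_nonneg _)]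
  rfl

/-- In the domain of a chart, the Riemannian volume is the volume of the chart. -/
lemma riemannianVolume_eq_chartVolume (q : M) {S : Set M} (hS : MeasurableSet S)
    (h : S ⊆ (extChartAt I q).source) : riemannianVolume I M S = chartVolume I q S := by
  have hs : MeasurableSet (extChartAt I q).source := (isOpen_extChartAt_source q).measurableSet
  -- all chart volumes are bounded by the measure on the right-hand side, hence so is their supremum
  have hle : riemannianVolume I M ≤
      chartVolume I q + (riemannianVolume I M).restrict (extChartAt I q).sourceᶜ := by
    refine iSup_le fun x => Measure.le_iff.2 fun T hT => ?_
    rw [← measure_inter_add_sdiff T hs, Measure.add_apply, Measure.restrict_apply hT, Set.sdiff_eq]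
    refine add_le_add ?_ (Measure.le_iff'.1 (le_iSup (chartVolume I (M := M)) x) _)
    have hx : MeasurableSet (extChartAt I x).source := (isOpen_extChartAt_source x).measurableSet
    rw [← measure_inter_add_sdiff (T ∩ (extChartAt I q).source) hx,
      measure_mono_null (t := (extChartAt I x).sourceᶜ) (s := _ \ _) (fun y hy => hy.2)
        (chartVolume_compl_source x), add_zero,
      chartVolume_eq_of_subset x q ((hT.inter hs).inter hx) (fun y hy => hy.2)
        (fun y hy => hy.1.2)]
    exact measure_mono fun y hy => hy.1.1
  refine le_antisymm ?_ (Measure.le_iff'.1 (le_iSup (chartVolume I (M := M)) q) S)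
  refine (Measure.le_iff'.1 hle S).trans ?_
  rw [Measure.add_apply, Measure.restrict_apply hS]
  have : S ∩ (extChartAt I q).sourceᶜ = ∅ := by
    rw [← Set.sdiff_eq, sdiff_eq_empty.2 h]
  rw [this, measure_empty, add_zero]

end

/-! ### Properties of the Riemannian volume -/

section

variable {d : ℕ} {H : Type*} [TopologicalSpace H]
  {I : ModelWithCorners ℝ (EuclideanSpace ℝ (Fin d)) H}
  {M : Type*} [MetricSpace M] [ChartedSpace H M] [IsManifold I ∞ M]
  [RiemannianBundle (fun x : M => TangentSpace I x)]

section Smooth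

variable [IsContMDiffRiemannianBundle I ∞ (EuclideanSpace ℝ (Fin d))
  (fun x : M => TangentSpace I x)]

lemma contDiffOn_sqrt_det_metricMatrix (q : M) :
    ContDiffOn ℝ ∞ (fun z => √(metricMatrix I q z).det) (extChartAt I q).target := by
  refine ContDiffOn.sqrt ?_ fun z hz => (det_metricMatrix_pos q hz).ne'
  simp only [Matrix.det_apply]
  refine ContDiffOn.sum fun σ _ => ?_
  refine ContDiffOn.const_smul _ ?_
  exact contDiffOn_prod fun i _ => contDiffOn_metricMatrix q _ _

variable [MeasurableSpace M] [BorelSpace M]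

/-- The density `√(det g)` is bounded near the centre of a chart. -/
lemma isLocallyFiniteMeasure_riemannianVolume :
    IsLocallyFiniteMeasure (riemannianVolume I M) := by
  refine ⟨fun q => ?_⟩
  set z₀ := extChartAt I q q with hz₀
  have hc := (contDiffOn_sqrt_det_metricMatrix (I := I) q).continuousOn z₀ (mem_extChartAt_target q)
  obtain ⟨ε, hε, hb⟩ := Metric.mem_nhdsWithin_iff.1
    (hc.eventually (gt_mem_nhds (lt_add_one (√(metricMatrix I q z₀).det))))
  set U := (extChartAt I q).source ∩ extChartAt I q ⁻¹' Metric.ball z₀ ε with hU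
  have hUo : IsOpen U := (continuousOn_extChartAt q).isOpen_inter_preimage
    (isOpen_extChartAt_source q) Metric.isOpen_ball
  refine ⟨U, hUo.mem_nhds ⟨mem_extChartAt_source q, Metric.mem_ball_self hε⟩, ?_⟩
  rw [riemannianVolume_eq_chartVolume q hUo.measurableSet inter_subset_left,
    chartVolume_apply q hUo.measurableSet]
  have hsub : (extChartAt I q).target ∩ (extChartAt I q).symm ⁻¹' U ⊆
      Metric.ball z₀ ε ∩ (extChartAt I q).target := by
    rintro z ⟨hz, hzU⟩
    have : extChartAt I q ((extChartAt I q).symm z) ∈ Metric.ball z₀ ε := hzU.2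
    rw [(extChartAt I q).right_inv hz] at this
    exact ⟨this, hz⟩
  calc ∫⁻ z in (extChartAt I q).target ∩ (extChartAt I q).symm ⁻¹' U,
        ENNReal.ofReal √(metricMatrix I q z).det
      ≤ ∫⁻ z in (extChartAt I q).target ∩ (extChartAt I q).symm ⁻¹' U,
        ENNReal.ofReal (√(metricMatrix I q z₀).det + 1) := by
        refine setLIntegral_mono' (measurableSet_target_inter_preimage q hUo.measurableSet)
          fun z hz => ENNReal.ofReal_le_ofReal ?_
        exact (hb (hsub hz)).le
    _ ≤ ENNReal.ofReal (√(metricMatrix I q z₀).det + 1) * volume (Metric.ball z₀ ε) := by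
        rw [setLIntegral_const]
        gcongr
        exact fun z hz => (hsub hz).1
    _ < ⊤ := ENNReal.mul_lt_top ENNReal.ofReal_lt_top Metric.isBounded_ball.measure_lt_top

lemma isFiniteMeasure_riemannianVolume [CompactSpace M] :
    IsFiniteMeasure (riemannianVolume I M) := by
  have := isLocallyFiniteMeasure_riemannianVolume (I := I) (M := M)
  exact ⟨isCompact_univ.measure_lt_top⟩

/-- The integral, for the Riemannian volume, of a function supported in the domain of a chart. -/
lemma integral_riemannianVolume_eq (q : M) {F : M → ℝ} (hF : Measurable F)
    (hsupp : ∀ x ∉ (extChartAt I q).source, F x = 0) :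
    ∫ x, F x ∂(riemannianVolume I M) =
      ∫ z in (extChartAt I q).target, √(metricMatrix I q z).det * F ((extChartAt I q).symm z) := by
  have hs : MeasurableSet (extChartAt I q).source := (isOpen_extChartAt_source q).measurableSet
  have hr : (riemannianVolume I M).restrict (extChartAt I q).source =
      (chartVolume I q).restrict (extChartAt I q).source := by
    ext S hS
    rw [Measure.restrict_apply hS, Measure.restrict_apply hS]
    exact riemannianVolume_eq_chartVolume q (hS.inter hs) inter_subset_right
  have h1 : ∀ μ : Measure M, ∫ x in (extChartAt I q).source, F x ∂μ = ∫ x, F x ∂μ := fun μ =>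
    setIntegral_eq_integral_of_forall_compl_eq_zero hsupp
  rw [← h1, hr, h1, chartVolume, integral_map
    ((aemeasurable_extChartAt_symm q).mono_ac (withDensity_absolutelyContinuous _ _))
    hF.aestronglyMeasurable, integral_withDensity_eq_integral_toReal_smul₀]
  · simp only [ENNReal.toReal_ofReal (Real.sqrt_nonneg _), smul_eq_mul]
  · exact ((contDiffOn_sqrt_det_metricMatrix q).continuousOn.aemeasurable
      (measurableSet_extChartAt_target q)).ennreal_ofReal
  · exact Eventually.of_forall fun _ => ENNReal.ofReal_lt_top

/-- The Riemannian volume is positive on nonempty open sets, including those around boundary points: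
the model set `range I` is the closure of its interior. -/
lemma isOpenPosMeasure_riemannianVolume : (riemannianVolume I M).IsOpenPosMeasure := by
  refine ⟨fun U hU hne h0 => ?_⟩
  obtain ⟨q, hq⟩ := hne
  set V := U ∩ (extChartAt I q).source with hV
  have hVo : IsOpen V := hU.inter (isOpen_extChartAt_source q)
  have hV0 : chartVolume I q V = 0 := by
    rw [← riemannianVolume_eq_chartVolume q hVo.measurableSet inter_subset_right]
    exact measure_mono_null inter_subset_left h0
  rw [chartVolume_apply q hVo.measurableSet] at hV0
  have hA := measurableSet_target_inter_preimage (I := I) q hVo.measurableSet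
  set A := (extChartAt I q).target ∩ (extChartAt I q).symm ⁻¹' V with hAdef
  -- the coordinates of points of `V` contain a nonempty open set
  obtain ⟨ε, hε, hb⟩ : ∃ ε > 0, range I ∩ Metric.ball (extChartAt I q q) ε ⊆ A := by
    have h1 : (extChartAt I q).symm ⁻¹' V ∈ 𝓝 (extChartAt I q q) :=
      extChartAt_preimage_mem_nhds (hVo.mem_nhds ⟨hq, mem_extChartAt_source q⟩)
    obtain ⟨ε, hε, hb⟩ := Metric.mem_nhdsWithin_iff.1
      (inter_mem (extChartAt_target_mem_nhdsWithin q) (mem_nhdsWithin_of_mem_nhds h1))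
    exact ⟨ε, hε, fun z hz => hb hz.symm⟩
  have hcl : extChartAt I q q ∈ closure (interior (range I)) := by
    rw [I.convex_range.closure_interior_eq_closure_of_nonempty_interior I.nonempty_interior]
    exact subset_closure (extChartAt_target_subset_range q (mem_extChartAt_target q))
  obtain ⟨z, hz, hzi⟩ := mem_closure_iff.1 hcl _ Metric.isOpen_ball (Metric.mem_ball_self hε)
  have hO : IsOpen (Metric.ball (extChartAt I q q) ε ∩ interior (range I)) :=
    Metric.isOpen_ball.inter isOpen_interior
  have hpos : 0 < volume A := (hO.measure_pos volume ⟨z, hz, hzi⟩).trans_le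
    (measure_mono fun y hy => hb ⟨interior_subset hy.2, hy.1⟩)
  have hm : AEMeasurable (fun z => ENNReal.ofReal √(metricMatrix I q z).det)
      (volume.restrict A) :=
    (((contDiffOn_sqrt_det_metricMatrix q).continuousOn.mono inter_subset_left).aemeasurable
      hA).ennreal_ofReal
  rw [setLIntegral_eq_zero_iff' hA hm] at hV0
  refine hpos.ne' (measure_mono_null (fun z hz => ?_) (ae_iff.1 hV0))
  have := Real.sqrt_pos.2 (det_metricMatrix_pos q hz.1)
  simp only [mem_ofPred_eq, Classical.not_imp]
  exact ⟨hz, (ENNReal.ofReal_pos.2 this).ne'⟩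

end Smooth

variable [MeasurableSpace M] [BorelSpace M]

lemma riemannianVolume_singleton (hd : 0 < d) (q : M) : riemannianVolume I M {q} = 0 := by
  rw [riemannianVolume_eq_chartVolume q (measurableSet_singleton q)
    (singleton_subset_iff.2 (mem_extChartAt_source q)),
    chartVolume_apply q (measurableSet_singleton q)]
  have : Nonempty (Fin d) := ⟨⟨0, hd⟩⟩
  refine setLIntegral_measure_zero _ _ ?_
  refine measure_mono_null (t := {extChartAt I q q}) ?_ (measure_singleton _)
  rintro z ⟨hz, hzq⟩
  have hzq' : (extChartAt I q).symm z = q := hzq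
  have h := (extChartAt I q).right_inv hz
  rw [hzq'] at h
  exact h.symm

end

/-! ### Geodesics and displacements which bring closer to an open set -/

section

/-- A compact Riemannian manifold is a geodesic space. -/
lemma exists_dist_eq_dist_eq_sub {E : Type*} [NormedAddCommGroup E] [NormedSpace ℝ E]
    {H : Type*} [TopologicalSpace H] (I : ModelWithCorners ℝ E H)
    {M : Type*} [MetricSpace M] [ChartedSpace H M]
    [RiemannianBundle (fun x : M => TangentSpace I x)] [IsRiemannianManifold I M]
    [CompactSpace M] (a x : M) {ρ : ℝ} (hρ : 0 ≤ ρ) (hρx : ρ ≤ dist a x) :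
    ∃ m, dist a m = ρ ∧ dist m x = dist a x - ρ := by
  -- an almost shortest curve meets the sphere of radius `ρ`, which is compact
  have key : ∀ ε > 0, ∃ m, dist a m = ρ ∧ dist m x ≤ dist a x - ρ + ε := by
    intro ε hε
    have h : edist a x < ENNReal.ofReal (dist a x + ε) := by
      rw [edist_dist]
      exact (ENNReal.ofReal_lt_ofReal_iff_of_nonneg dist_nonneg).2 (by linarith)
    rw [IsRiemannianManifold.out (I := I)] at h
    obtain ⟨γ, h0, h1, hγ, hlen⟩ := exists_lt_of_riemannianEDist_lt h
    have hf : ContinuousOn (fun t => dist a (γ t)) (Icc 0 1) :=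
      continuousOn_const.prodMk hγ.continuousOn |> continuous_dist.comp_continuousOn
    obtain ⟨t, ht, htρ⟩ := intermediate_value_Icc zero_le_one hf
      (show ρ ∈ Icc (dist a (γ 0)) (dist a (γ 1)) by rw [h0, h1, dist_self]; exact ⟨hρ, hρx⟩)
    refine ⟨γ t, htρ, ?_⟩
    have e1 := edist_le_pathELength (I := I) (hγ.mono (Icc_subset_Icc le_rfl ht.2)) ht.1
    have e2 := edist_le_pathELength (I := I) (hγ.mono (Icc_subset_Icc ht.1 le_rfl)) ht.2
    have e3 := (add_le_add e1 e2).trans_lt ((pathELength_add ht.1 ht.2).trans_lt hlen)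
    rw [h0, h1, edist_dist, edist_dist, ← ENNReal.ofReal_add dist_nonneg dist_nonneg,
      ENNReal.ofReal_lt_ofReal_iff_of_nonneg (by positivity)] at e3
    have htρ' : dist a (γ t) = ρ := htρ
    linarith
  have hc : IsCompact {m : M | dist a m = ρ} :=
    (isClosed_eq (Continuous.dist continuous_const continuous_id) continuous_const).isCompact
  obtain ⟨m₁, hm₁, -⟩ := key 1 one_pos
  obtain ⟨m, hm, hmin⟩ := hc.exists_isMinOn ⟨m₁, hm₁⟩
    (Continuous.dist continuous_id continuous_const : Continuous fun m => dist m x).continuousOn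
  refine ⟨m, hm, le_antisymm ?_ ?_⟩
  · refine le_of_forall_pos_le_add fun ε hε => ?_
    obtain ⟨m', hm', h'⟩ := key ε hε
    exact (isMinOn_iff.1 hmin m' hm').trans h'
  · have := dist_triangle a m x
    have hm' : dist a m = ρ := hm
    linarith

end

namespace MetricChart

variable {M E : Type*} [MetricSpace M] [NormedAddCommGroup E] [NormedSpace ℝ E]
  (𝓒 : MetricChart M E)

lemma continuousOn_e : ContinuousOn 𝓒.e 𝓒.dom := by
  have : LipschitzOnWith (Real.toNNReal 𝓒.C) 𝓒.e 𝓒.dom := by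
    refine LipschitzOnWith.of_dist_le_mul fun z hz z' hz' => ?_
    rw [dist_comm z, dist_eq_norm, Real.coe_toNNReal _ 𝓒.C_pos.le]
    exact 𝓒.dist_le_mul_norm_sub hz hz'
  exact this.continuousOn

/-- The points of `M` whose distance to `𝓒.e 𝓒.z₀` is small are in the image of a small ball. -/
lemma exists_dist_lt_imp {σ : ℝ} (hσ : 0 < σ) :
    ∃ δ > 0, ∀ m, dist m (𝓒.e 𝓒.z₀) < δ → ∃ a ∈ 𝓒.K ∩ Metric.ball 𝓒.z₀ σ, 𝓒.e a = m := by
  obtain ⟨δ, hδ, h⟩ := Metric.eventually_nhds_iff.1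
    (𝓒.eventually_mem_image 𝓒.z₀ 𝓒.z₀_mem_dom σ hσ)
  exact ⟨δ, hδ, fun m hm => h hm⟩

/-- The vector `v` points into the chart: small displacements along `v` stay in the chart. -/
def PointsInward (v : E) : Prop :=
  ∃ h₀ > 0, ∀ z ∈ 𝓒.K ∩ Metric.ball 𝓒.z₀ (𝓒.r / 2), ∀ θ ∈ Icc (0 : ℝ) h₀, z + θ • v ∈ 𝓒.K

/-- When a point near the centre moves in the direction `v`, its distance to the points of some
open set decreases at a definite rate: these are the points near `z₀ + t v`, with `t` small and
fixed. -/
theorem exists_isOpen_dist_add_le {v : E} (hv : v ≠ 0) (hin : 𝓒.PointsInward v) :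
    ∃ A : Set M, IsOpen A ∧ A.Nonempty ∧ ∃ κ > 0, ∃ σ > 0, ∃ h₁ > 0, σ ≤ 𝓒.s ∧
      ∀ a ∈ 𝓒.K ∩ Metric.ball 𝓒.z₀ σ, ∀ h ∈ Ioc 0 h₁, ∀ x ∈ A,
        dist x (𝓒.e (a + h • v)) - dist x (𝓒.e a) ≤ -κ * h := by
  obtain ⟨h₀, hh₀, hin⟩ := hin
  have hC := 𝓒.C_pos
  have hC1 := 𝓒.one_le_C
  have hV : 0 < ‖v‖ := norm_pos_iff.2 hv
  have hr := 𝓒.r_pos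
  have hs := 𝓒.s_pos
  set C := 𝓒.C
  set V := ‖v‖
  set g := 𝓒.B 𝓒.z₀ v v with hg
  have hg0 : 0 < g := by
    rcases (𝓒.nonneg_B 𝓒.z₀_mem_dom v).lt_or_eq with h | h
    · exact h
    · have := 𝓒.norm_le _ 𝓒.z₀_mem_dom v
      rw [← h, Real.sqrt_zero, mul_zero] at this
      linarith
  -- the rate of decrease is `κ / 2` once `t` is so small that the metric is nearly constant
  set κ := g / (C * V) with hκ
  have hκ0 : 0 < κ := by positivity
  set t := min (min h₀ (𝓒.s / (2 * V))) (κ / (12 * C ^ 4 * V ^ 2)) with ht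
  have ht0 : 0 < t := by positivity
  have ht1 : t ≤ h₀ := (min_le_left _ _).trans (min_le_left _ _)
  have ht2 : t * V ≤ 𝓒.s / 2 := by
    have : t ≤ 𝓒.s / (2 * V) := (min_le_left _ _).trans (min_le_right _ _)
    rw [le_div_iff₀ (by positivity)] at this
    linarith
  have ht3 : 3 * C ^ 4 * V ^ 2 * t ≤ κ / 4 := by
    have : t ≤ κ / (12 * C ^ 4 * V ^ 2) := min_le_right _ _
    rw [le_div_iff₀ (by positivity)] at this
    linarith
  set b₀ := 𝓒.z₀ + t • v with hb₀
  have hz₀s : 𝓒.z₀ ∈ 𝓒.K ∩ Metric.ball 𝓒.z₀ 𝓒.s := ⟨𝓒.z₀_mem, Metric.mem_ball_self hs⟩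
  have hb₀s : b₀ ∈ 𝓒.K ∩ Metric.ball 𝓒.z₀ 𝓒.s := by
    refine ⟨hin _ ⟨𝓒.z₀_mem, Metric.mem_ball_self (by positivity)⟩ t ⟨ht0.le, ht1⟩, ?_⟩
    rw [mem_ball_iff_norm, hb₀, add_sub_cancel_left, norm_smul, Real.norm_of_nonneg ht0.le]
    linarith
  have hb₀d := 𝓒.small_subset_dom hb₀s
  set D₀ := dist (𝓒.e 𝓒.z₀) (𝓒.e b₀) with hD₀
  have hD₀le : D₀ ≤ C * (t * V) := by
    have := 𝓒.dist_le_mul_norm_sub 𝓒.z₀_mem_dom hb₀d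
    rwa [hb₀, add_sub_cancel_left, norm_smul, Real.norm_of_nonneg ht0.le] at this
  have hD₀pos : 0 < D₀ := by
    have := 𝓒.norm_sub_le_mul_dist hz₀s hb₀s
    rw [hb₀, add_sub_cancel_left, norm_smul, Real.norm_of_nonneg ht0.le] at this
    have h2 : 0 < t * V := by positivity
    exact pos_of_mul_pos_right (h2.trans_le this) hC.le
  -- the bound of `dist_add_le` as a function of the three parameters
  set Ψ : E × E × ℝ → ℝ := fun p => -(𝓒.B 𝓒.z₀ (p.2.1 - p.1) v / dist (𝓒.e p.1) (𝓒.e p.2.1)) +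
    V * (C ^ 2 * (‖p.1 - 𝓒.z₀‖ + C * dist (𝓒.e p.1) (𝓒.e p.2.1)) +
      C * (p.2.2 * V) / dist (𝓒.e p.1) (𝓒.e p.2.1) +
      2 * C ^ 3 * dist (𝓒.e p.1) (𝓒.e p.2.1)) with hΨ
  have hΨ0 : Ψ (𝓒.z₀, b₀, 0) < -(κ / 2) := by
    have e1 : κ ≤ 𝓒.B 𝓒.z₀ (b₀ - 𝓒.z₀) v / D₀ := by
      rw [hb₀, add_sub_cancel_left, map_smul, smul_apply, smul_eq_mul, le_div_iff₀ hD₀pos]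
      calc κ * D₀ ≤ κ * (C * (t * V)) := by gcongr
        _ = t * g := by rw [hκ]; field_simp
    have e2 : V * (3 * C ^ 3 * D₀) ≤ κ / 4 := by
      refine le_trans ?_ ht3
      calc V * (3 * C ^ 3 * D₀) ≤ V * (3 * C ^ 3 * (C * (t * V))) := by gcongr
        _ = _ := by ring
    simp only [hΨ, sub_self, norm_zero, zero_mul, mul_zero, zero_div]
    rw [← hD₀]
    linarith
  have hΨc : ContinuousWithinAt Ψ (𝓒.dom ×ˢ 𝓒.dom ×ˢ univ) (𝓒.z₀, b₀, 0) := by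
    have e1 : ContinuousWithinAt (fun p : E × E × ℝ => 𝓒.e p.1) (𝓒.dom ×ˢ 𝓒.dom ×ˢ univ)
        (𝓒.z₀, b₀, 0) :=
      (𝓒.continuousOn_e 𝓒.z₀ 𝓒.z₀_mem_dom).comp (t := 𝓒.dom) (f := fun p : E × E × ℝ => p.1)
        continuous_fst.continuousWithinAt (fun p hp => hp.1)
    have e2 : ContinuousWithinAt (fun p : E × E × ℝ => 𝓒.e p.2.1) (𝓒.dom ×ˢ 𝓒.dom ×ˢ univ)
        (𝓒.z₀, b₀, 0) :=
      ContinuousWithinAt.comp (f := fun p : E × E × ℝ => p.2.1) (𝓒.continuousOn_e b₀ hb₀d)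
        (by fun_prop) (fun p hp => hp.2.1)
    have e3 := e1.dist e2
    have hne : dist (𝓒.e (𝓒.z₀, b₀, (0 : ℝ)).1) (𝓒.e (𝓒.z₀, b₀, (0 : ℝ)).2.1) ≠ 0 := hD₀pos.ne'
    have e4 : ContinuousWithinAt (fun p : E × E × ℝ => 𝓒.B 𝓒.z₀ (p.2.1 - p.1) v)
        (𝓒.dom ×ˢ 𝓒.dom ×ˢ univ) (𝓒.z₀, b₀, 0) := by fun_prop
    have e5 : ContinuousWithinAt (fun p : E × E × ℝ => C * (p.2.2 * V))
        (𝓒.dom ×ˢ 𝓒.dom ×ˢ univ) (𝓒.z₀, b₀, 0) := by fun_prop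
    have e6 : ContinuousWithinAt (fun p : E × E × ℝ => ‖p.1 - 𝓒.z₀‖)
        (𝓒.dom ×ˢ 𝓒.dom ×ˢ univ) (𝓒.z₀, b₀, 0) := by fun_prop
    exact (e4.div e3 hne).neg.add (continuousWithinAt_const.mul
      (((continuousWithinAt_const.mul (e6.add (continuousWithinAt_const.mul e3))).add
        (e5.div e3 hne)).add (continuousWithinAt_const.mul e3)))
  -- by continuity, the bound persists near `(z₀, b₀, 0)`
  obtain ⟨τ, hτ, hball⟩ : ∃ τ > 0, ∀ a ∈ 𝓒.dom ∩ Metric.ball 𝓒.z₀ τ,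
      ∀ b ∈ 𝓒.dom ∩ Metric.ball b₀ τ, ∀ h ∈ Ioo (-τ) τ, Ψ (a, b, h) < -(κ / 2) := by
    obtain ⟨τ, hτ, hb⟩ := Metric.mem_nhdsWithin_iff.1 (hΨc.eventually (gt_mem_nhds hΨ0))
    refine ⟨τ, hτ, fun a ha b hb' h hh => hb ⟨?_, ha.1, hb'.1, mem_univ _⟩⟩
    rw [← ball_prod_same, ← ball_prod_same]
    refine ⟨ha.2, hb'.2, ?_⟩
    rw [Real.ball_eq_Ioo]
    simpa using hh
  set τ' := min (min τ (𝓒.s - t * V)) (t * V / 4) with hτ'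
  have hτ'0 : 0 < τ' := by
    have : 0 < 𝓒.s - t * V := by linarith
    positivity
  have hτ1 : τ' ≤ τ := (min_le_left _ _).trans (min_le_left _ _)
  have hτ2 : τ' ≤ 𝓒.s - t * V := (min_le_left _ _).trans (min_le_right _ _)
  have hτ3 : τ' ≤ t * V / 4 := min_le_right _ _
  obtain ⟨A, hAsub, hAo, hbA⟩ := mem_nhds_iff.1 (𝓒.eventually_mem_image b₀ hb₀d τ' hτ'0)
  set h₁ := min (min (min h₀ (τ / 2)) (𝓒.r / (4 * V))) (t / (2 * C)) with hh₁
  have hh₁0 : 0 < h₁ := by positivity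
  have hh1 : h₁ ≤ h₀ := (min_le_left _ _).trans ((min_le_left _ _).trans (min_le_left _ _))
  have hh2 : h₁ ≤ τ / 2 := (min_le_left _ _).trans ((min_le_left _ _).trans (min_le_right _ _))
  have hh3 : h₁ * (4 * V) ≤ 𝓒.r := by
    rw [← le_div_iff₀ (by positivity)]
    exact (min_le_left _ _).trans (min_le_right _ _)
  have hh4 : h₁ * (2 * C) ≤ t := by
    rw [← le_div_iff₀ (by positivity)]
    exact min_le_right _ _
  refine ⟨A, hAo, ⟨_, hbA⟩, κ / 2, by positivity, min τ' 𝓒.s, by positivity, h₁, hh₁0,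
    min_le_right _ _, ?_⟩
  intro a ha h hh x hx
  obtain ⟨b, ⟨hbK, hbb⟩, rfl⟩ := hAsub hx
  have has : a ∈ 𝓒.K ∩ Metric.ball 𝓒.z₀ 𝓒.s :=
    ⟨ha.1, Metric.ball_subset_ball (min_le_right _ _) ha.2⟩
  have haτ : ‖a - 𝓒.z₀‖ < τ' :=
    mem_ball_iff_norm.1 (Metric.ball_subset_ball (min_le_left _ _) ha.2)
  have hbτ : ‖b - b₀‖ < τ' := mem_ball_iff_norm.1 hbb
  have hbz : ‖b₀ - 𝓒.z₀‖ = t * V := by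
    rw [hb₀, add_sub_cancel_left, norm_smul, Real.norm_of_nonneg ht0.le]
  have hbs : b ∈ 𝓒.K ∩ Metric.ball 𝓒.z₀ 𝓒.s := by
    refine ⟨hbK, ?_⟩
    rw [mem_ball_iff_norm]
    have := norm_sub_le_norm_sub_add_norm_sub b b₀ 𝓒.z₀
    linarith
  set D := dist (𝓒.e a) (𝓒.e b) with hD
  have hDlow : t * V / 2 ≤ C * D := by
    have h1 := 𝓒.norm_sub_le_mul_dist has hbs
    have h2 := norm_sub_le_norm_sub_add_norm_sub b₀ b 𝓒.z₀
    have h3 := norm_sub_le_norm_sub_add_norm_sub b a 𝓒.z₀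
    rw [norm_sub_rev b₀ b] at h2
    linarith
  have hDpos : 0 < D := by
    have h2 : 0 < t * V / 2 := by positivity
    exact pos_of_mul_pos_right (h2.trans_le hDlow) hC.le
  have hnw : ‖h • v‖ = h * V := by rw [norm_smul, Real.norm_of_nonneg hh.1.le]
  have hhV : h * V ≤ D := by
    have h1 : h * (2 * C) ≤ t := (mul_le_mul_of_nonneg_right hh.2 (by positivity)).trans hh4
    have h2 : C * (h * V) ≤ C * D := by nlinarith
    exact le_of_mul_le_mul_left h2 hC
  have hmain := 𝓒.dist_add_le has hbs (w := h • v) ?_ ?_ hD.symm hDpos (hnw.trans_le hhV)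
  · have hΨh := hball a ⟨𝓒.small_subset_dom has, mem_ball_iff_norm.2 (haτ.trans_le hτ1)⟩ b
      ⟨𝓒.small_subset_dom hbs, mem_ball_iff_norm.2 (hbτ.trans_le hτ1)⟩ h
      ⟨by linarith [hh.1], by linarith [hh.2]⟩
    simp only [hΨ] at hΨh
    rw [← hD] at hΨh
    rw [hnw, map_smul, smul_eq_mul] at hmain
    rw [dist_comm (𝓒.e b), dist_comm (𝓒.e b), ← hD]
    have h2 := mul_le_mul_of_nonneg_left hΨh.le hh.1.le
    calc _ ≤ h * (-(𝓒.B 𝓒.z₀ (b - a) v / D) + V * (C ^ 2 * (‖a - 𝓒.z₀‖ + C * D) +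
          C * (h * V) / D + 2 * C ^ 3 * D)) := by
          rw [sub_le_iff_le_add]
          refine hmain.trans_eq ?_
          ring
      _ ≤ _ := h2
      _ = _ := by ring
  · intro z hz θ hθ
    rw [smul_smul]
    refine hin z hz _ ⟨mul_nonneg hθ.1 hh.1.le, ?_⟩
    calc θ * h ≤ 1 * h := mul_le_mul_of_nonneg_right hθ.2 hh.1.le
      _ ≤ h₀ := by rw [one_mul]; exact hh.2.trans hh1
  · rw [hnw]
    have := mul_le_mul_of_nonneg_right hh.2 (by positivity : (0:ℝ) ≤ 4 * V)
    linarith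

end MetricChart

/-! ### Decrease of the mean distance at the boundary -/

lemma integrable_of_continuous {M : Type*} [TopologicalSpace M] [CompactSpace M]
    [MeasurableSpace M] [OpensMeasurableSpace M] {μ : Measure M} [IsFiniteMeasure μ] {f : M → ℝ}
    (hf : Continuous f) : Integrable f μ :=
  hf.integrable_of_hasCompactSupport (HasCompactSupport.of_compactSpace f)

/-- `M` is geodesic: the distance between two points splits at every intermediate value. -/
def IsGeodesic (M : Type*) [MetricSpace M] : Prop :=
  ∀ a x : M, ∀ ρ : ℝ, 0 ≤ ρ → ρ ≤ dist a x → ∃ m, dist a m = ρ ∧ dist m x = dist a x - ρ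

namespace MetricChart

variable {M E : Type*} [MetricSpace M] [NormedAddCommGroup E] [NormedSpace ℝ E]
  (𝓒 : MetricChart M E)

/-- A displacement which is nonzero in the chart changes the point of `M`. -/
lemma dist_pos_of_move {a v : E} {h : ℝ} (hv : v ≠ 0) (hh : h ≠ 0)
    (ha : a ∈ 𝓒.K ∩ Metric.ball 𝓒.z₀ 𝓒.s)
    (hav : a + h • v ∈ 𝓒.K ∩ Metric.ball 𝓒.z₀ 𝓒.s) : 0 < dist (𝓒.e (a + h • v)) (𝓒.e a) := by
  have h1 := 𝓒.norm_sub_le_mul_dist ha hav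
  rw [add_sub_cancel_left, dist_comm] at h1
  have h2 : 0 < ‖h • v‖ := norm_pos_iff.2 (smul_ne_zero hh hv)
  exact pos_of_mul_pos_right (h2.trans_le h1) 𝓒.C_pos.le

variable [CompactSpace M] [MeasurableSpace M] [BorelSpace M]

set_option maxHeartbeats 1000000 in
/-- If `v` makes a nonobtuse angle with all the directions from `𝓒.z₀` to points of `𝓒.K`, then
moving along `v` decreases the mean distance to the points of `M` at a definite rate: the distance
to far points does not increase to first order, by the first variation formula at a point of a
small sphere, the distance to the points of an open set decreases, and the measure of the remaining
points, which are close to the centre, is negligible. -/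
theorem exists_integral_dist_decrease (μ : Measure M) [IsFiniteMeasure μ] [μ.IsOpenPosMeasure]
    (hgeo : IsGeodesic M) (hnull : μ {𝓒.e 𝓒.z₀} = 0) {v : E} (hv : v ≠ 0)
    (hin : 𝓒.PointsInward v) (hdual : ∀ b ∈ 𝓒.K, 0 ≤ 𝓒.B 𝓒.z₀ (b - 𝓒.z₀) v) :
    ∃ δ₀ > 0, ∀ ybar, dist ybar (𝓒.e 𝓒.z₀) < δ₀ → ∃ η > 0, ∀ ε > 0, ∃ y, y ≠ ybar ∧
      dist y ybar < ε ∧ ∫ x, (dist x y - dist x ybar) ∂μ ≤ -η * dist y ybar := by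
  obtain ⟨A, hAo, hAne, κ, hκ, σ, hσ, h₁, hh₁, hσs, hA⟩ := 𝓒.exists_isOpen_dist_add_le hv hin
  obtain ⟨h₀, hh₀, hin⟩ := hin
  have hC := 𝓒.C_pos
  have hC1 := 𝓒.one_le_C
  have hV : 0 < ‖v‖ := norm_pos_iff.2 hv
  have hr := 𝓒.r_pos
  have hs := 𝓒.s_pos
  set C := 𝓒.C
  set V := ‖v‖
  set q := 𝓒.e 𝓒.z₀ with hq
  have hα : 0 < μ.real A := ENNReal.toReal_pos (hAo.measure_pos μ hAne).ne' (measure_ne_top _ _)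
  set α := μ.real A with hαdef
  set m := μ.real univ with hm
  have hm0 : 0 ≤ m := measureReal_nonneg
  -- a small neighbourhood `U` of the centre
  obtain ⟨U, hqU, hUo, hU⟩ := Set.exists_isOpen_lt_of_lt {q} (ENNReal.ofReal (κ * α / (4 * C * V)))
    (by rw [hnull]; exact ENNReal.ofReal_pos.2 (by positivity))
  have hU' : C * V * μ.real U ≤ κ * α / 4 := by
    have h1 : μ.real U ≤ κ * α / (4 * C * V) := ENNReal.toReal_le_of_le_ofReal (by positivity) hU.le
    calc C * V * μ.real U ≤ C * V * (κ * α / (4 * C * V)) := by gcongr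
      _ = _ := by field_simp
  obtain ⟨ρU, hρU, hballU⟩ := Metric.isOpen_iff.1 hUo q (hqU rfl)
  obtain ⟨δs, hδs, himg⟩ := 𝓒.exists_dist_lt_imp hs
  set ρ := min (min (ρU / 2) (δs / 2)) (κ * α / (24 * C ^ 3 * V * (m + 1))) with hρ
  have hρ0 : 0 < ρ := by positivity
  have hρ1 : 2 * ρ ≤ ρU := by
    have : ρ ≤ ρU / 2 := (min_le_left _ _).trans (min_le_left _ _)
    linarith
  have hρ2 : 2 * ρ ≤ δs := by
    have : ρ ≤ δs / 2 := (min_le_left _ _).trans (min_le_right _ _)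
    linarith
  have hρ3 : V * (3 * C ^ 3 * ρ) * (m + 1) ≤ κ * α / 8 := by
    have : ρ ≤ κ * α / (24 * C ^ 3 * V * (m + 1)) := min_le_right _ _
    rw [le_div_iff₀ (by positivity)] at this
    linarith
  -- the size `δ` of the set of base points, in the chart
  set δ := min (min σ (min (𝓒.s / 2) (𝓒.r / 2)))
    (κ * α / (8 * V * (C / ρ + C ^ 2) * (m + 1))) with hδ
  have hδ0 : 0 < δ := by positivity
  have hδ1 : δ ≤ σ := (min_le_left _ _).trans (min_le_left _ _)
  have hδ2 : δ ≤ 𝓒.s / 2 :=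
    (min_le_left _ _).trans ((min_le_right _ _).trans (min_le_left _ _))
  have hδr : δ ≤ 𝓒.r / 2 :=
    (min_le_left _ _).trans ((min_le_right _ _).trans (min_le_right _ _))
  have hδ3 : V * (C * δ / ρ + C ^ 2 * δ) * (m + 1) ≤ κ * α / 8 := by
    have : δ ≤ κ * α / (8 * V * (C / ρ + C ^ 2) * (m + 1)) := min_le_right _ _
    rw [le_div_iff₀ (by positivity)] at this
    have h2 : C * δ / ρ = δ * (C / ρ) := by ring
    rw [h2]
    linarith
  obtain ⟨δ', hδ', himg'⟩ := 𝓒.exists_dist_lt_imp hδ0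
  refine ⟨min δ' (ρ / 2), by positivity, fun ybar hybar => ?_⟩
  obtain ⟨a, ha, rfl⟩ := himg' ybar (hybar.trans_le (min_le_left _ _))
  have haρ : dist (𝓒.e a) q < ρ / 2 := hybar.trans_le (min_le_right _ _)
  have haz : ‖a - 𝓒.z₀‖ < δ := mem_ball_iff_norm.1 ha.2
  have has : a ∈ 𝓒.K ∩ Metric.ball 𝓒.z₀ 𝓒.s :=
    ⟨ha.1, Metric.ball_subset_ball (by linarith) ha.2⟩
  refine ⟨κ * α / (4 * (C * V)), by positivity, fun ε hε => ?_⟩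
  -- the displacement `h`
  set h := min (min (min h₀ h₁) (min (𝓒.r / (4 * V)) (𝓒.s / (4 * V))))
    (min (min (ρ / V) (ε / (2 * (C * V)))) (κ * α * ρ / (8 * V * (C * V) * (m + 1)))) with hhdef
  have hh : 0 < h := by positivity
  have l1 : h ≤ h₀ := (min_le_left _ _).trans ((min_le_left _ _).trans (min_le_left _ _))
  have l2 : h ≤ h₁ := (min_le_left _ _).trans ((min_le_left _ _).trans (min_le_right _ _))
  have l3 : h * (4 * V) ≤ 𝓒.r := by
    rw [← le_div_iff₀ (by positivity)]
    exact (min_le_left _ _).trans ((min_le_right _ _).trans (min_le_left _ _))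
  have l4 : h * (4 * V) ≤ 𝓒.s := by
    rw [← le_div_iff₀ (by positivity)]
    exact (min_le_left _ _).trans ((min_le_right _ _).trans (min_le_right _ _))
  have l5 : h * V ≤ ρ := by
    rw [← le_div_iff₀ (by positivity)]
    exact (min_le_right _ _).trans ((min_le_left _ _).trans (min_le_left _ _))
  have l6 : h * (2 * (C * V)) ≤ ε := by
    rw [← le_div_iff₀ (by positivity)]
    exact (min_le_right _ _).trans ((min_le_left _ _).trans (min_le_right _ _))
  have l7 : V * (C * (h * V) / ρ) * (m + 1) ≤ κ * α / 8 := by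
    have : h ≤ κ * α * ρ / (8 * V * (C * V) * (m + 1)) :=
      (min_le_right _ _).trans (min_le_right _ _)
    rw [le_div_iff₀ (by positivity)] at this
    have h2 : V * (C * (h * V) / ρ) * (m + 1) = h * (8 * V * (C * V) * (m + 1)) / (8 * ρ) := by
      field_simp
    rw [h2, div_le_iff₀ (by positivity)]
    linarith
  have hnw : ‖h • v‖ = h * V := by rw [norm_smul, Real.norm_of_nonneg hh.le]
  have hKw : ∀ z ∈ 𝓒.K ∩ Metric.ball 𝓒.z₀ (𝓒.r / 2), ∀ θ ∈ Icc (0 : ℝ) 1,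
      z + θ • h • v ∈ 𝓒.K := by
    intro z hz θ hθ
    rw [smul_smul]
    refine hin z hz _ ⟨mul_nonneg hθ.1 hh.le, ?_⟩
    calc θ * h ≤ 1 * h := mul_le_mul_of_nonneg_right hθ.2 hh.le
      _ ≤ h₀ := by rw [one_mul]; exact l1
  have hconv : a + h • v ∈ 𝓒.K :=
    hin a ⟨ha.1, Metric.ball_subset_ball hδr ha.2⟩ h ⟨hh.le, l1⟩
  have hvs : ‖h • v‖ ≤ 𝓒.s / 4 := by rw [hnw]; linarith
  have hvr : ‖h • v‖ < 𝓒.r / 2 := by rw [hnw]; linarith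
  have hav : a + h • v ∈ 𝓒.K ∩ Metric.ball 𝓒.z₀ 𝓒.s := by
    refine ⟨hconv, mem_ball_iff_norm.2 ?_⟩
    rw [show a + h • v - 𝓒.z₀ = (a - 𝓒.z₀) + h • v by abel]
    exact (norm_add_le _ _).trans_lt (by linarith)
  have hpos := 𝓒.dist_pos_of_move hv hh.ne' has hav
  have hdy : dist (𝓒.e (a + h • v)) (𝓒.e a) ≤ h * (C * V) := by
    rw [dist_comm]
    have := 𝓒.dist_le_mul_norm_sub (𝓒.small_subset_dom has) (𝓒.small_subset_dom hav)
    rw [add_sub_cancel_left, hnw] at this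
    linarith
  set y := 𝓒.e (a + h • v) with hy
  refine ⟨y, dist_pos.1 hpos, by linarith [mul_pos hh (mul_pos hC hV)], ?_⟩
  -- `h * F` bounds the errors of the first variation formula
  set F := V * (C * δ / ρ + C ^ 2 * δ) + V * (3 * C ^ 3 * ρ) + V * (C * (h * V) / ρ) with hF
  have hF0 : 0 ≤ F := by positivity
  have hpt : ∀ x, dist x y - dist x (𝓒.e a) ≤
      h * (A.indicator (fun _ => -κ) x + U.indicator (fun _ => C * V) x + F) := by
    intro x
    have hU0 : 0 ≤ U.indicator (fun _ => C * V) x := indicator_nonneg (fun _ _ => by positivity) x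
    by_cases hxA : x ∈ A
    · have := hA a ⟨ha.1, Metric.ball_subset_ball hδ1 ha.2⟩ h ⟨hh, l2⟩ x hxA
      rw [indicator_of_mem hxA]
      have h1 := mul_nonneg hh.le (add_nonneg hU0 hF0)
      rw [add_assoc, mul_add]
      linarith
    rw [indicator_of_notMem hxA, zero_add]
    by_cases hxρ : dist (𝓒.e a) x < ρ
    · have hxU : x ∈ U := by
        apply hballU
        rw [Metric.mem_ball]
        have := dist_triangle_left x q (𝓒.e a)
        linarith
      rw [indicator_of_mem hxU]
      have := dist_triangle x (𝓒.e a) y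
      rw [dist_comm (𝓒.e a) y] at this
      rw [mul_add]
      linarith [mul_nonneg hh.le hF0]
    -- far from the centre, the first variation formula is applied at a point `m'` of the sphere
    -- of radius `ρ` lying on a minimal geodesic to `x`
    obtain ⟨m', hm1, hm2⟩ := hgeo (𝓒.e a) x ρ hρ0.le (not_lt.1 hxρ)
    obtain ⟨b, hb, rfl⟩ := himg m' (by
      have := dist_triangle_left m' q (𝓒.e a)
      linarith)
    have h1 := 𝓒.dist_add_le has hb hKw hvr hm1 hρ0 (hnw ▸ l5)
    have h2 : -(C * δ * V) ≤ 𝓒.B 𝓒.z₀ (b - a) v := by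
      have h3 := hdual b hb.1
      have h4 := 𝓒.abs_B_le 𝓒.z₀_mem_dom (a - 𝓒.z₀) v
      have h5 : C * ‖a - 𝓒.z₀‖ * V ≤ C * δ * V := by gcongr
      have h6 : 𝓒.B 𝓒.z₀ (b - a) v = 𝓒.B 𝓒.z₀ (b - 𝓒.z₀) v - 𝓒.B 𝓒.z₀ (a - 𝓒.z₀) v := by
        rw [← sub_apply, ← map_sub, sub_sub_sub_cancel_right]
      rw [h6]
      linarith [le_abs_self (𝓒.B 𝓒.z₀ (a - 𝓒.z₀) v)]
    rw [map_smul, smul_eq_mul, hnw] at h1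
    have h3 : dist x y ≤ dist (𝓒.e b) x + dist y (𝓒.e b) := by
      rw [dist_comm x y, add_comm]
      exact dist_triangle _ _ _
    have h4 : h * V * (C ^ 2 * (‖a - 𝓒.z₀‖ + C * ρ) + C * (h * V) / ρ + 2 * C ^ 3 * ρ) ≤
        h * V * (C ^ 2 * (δ + C * ρ) + C * (h * V) / ρ + 2 * C ^ 3 * ρ) := by gcongr
    have h5 : -(h * 𝓒.B 𝓒.z₀ (b - a) v / ρ) ≤ h * (C * δ * V) / ρ := by
      rw [← neg_div, ← mul_neg]
      gcongr
      linarith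
    have h6 : h * F = h * (C * δ * V) / ρ +
        h * V * (C ^ 2 * (δ + C * ρ) + C * (h * V) / ρ + 2 * C ^ 3 * ρ) := by
      rw [hF]; ring
    rw [dist_comm x (𝓒.e a)]
    clear_value F
    rw [mul_add, h6]
    linarith [mul_nonneg hh.le hU0, neg_le.1 (neg_le_neg h5)]
  have hint : ∀ z, Integrable (fun x => dist x z) μ := fun z =>
    integrable_of_continuous (by fun_prop)
  have hiA : Integrable (A.indicator fun _ => -κ) μ :=
    (integrable_const _).indicator hAo.measurableSet
  have hiU : Integrable (U.indicator fun _ => C * V) μ :=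
    (integrable_const _).indicator hUo.measurableSet
  have hI : ∫ x, (dist x y - dist x (𝓒.e a)) ∂μ ≤ h * (-κ * α + C * V * μ.real U + F * m) := by
    refine (integral_mono ((hint _).sub (hint _))
      (((hiA.add hiU).add (integrable_const F)).const_mul h) hpt).trans_eq ?_
    simp only [integral_const_mul]
    congr 1
    rw [integral_add' (hiA.add hiU) (integrable_const F), integral_add' hiA hiU,
      integral_indicator_const _ hAo.measurableSet, integral_indicator_const _ hUo.measurableSet,
      integral_const]
    simp only [smul_eq_mul]
    ring
  have hFm : F * m ≤ 3 * (κ * α / 8) := by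
    have : F * (m + 1) ≤ 3 * (κ * α / 8) := by rw [hF, add_mul, add_mul]; linarith
    linarith
  have hκα : 0 < κ * α := by positivity
  calc _ ≤ h * (-κ * α + C * V * μ.real U + F * m) := hI
    _ ≤ h * (-(κ * α / 4)) := by gcongr; linarith
    _ = -(κ * α / (4 * (C * V))) * (h * (C * V)) := by field_simp
    _ ≤ -(κ * α / (4 * (C * V))) * dist y (𝓒.e a) :=
      mul_le_mul_of_nonpos_left hdy (neg_nonpos.2 (by positivity))

end MetricChart

/-! ### Second differences of the mean distance -/

namespace MetricChart

variable {M E : Type*} [MetricSpace M] [NormedAddCommGroup E] [NormedSpace ℝ E]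
  (𝓒 : MetricChart M E)

section Near

variable [MeasurableSpace E] [BorelSpace E] [CompactSpace M]

omit [MeasurableSpace E] [BorelSpace E] [CompactSpace M] in
lemma ball_subset_small (hball : Metric.ball 𝓒.z₀ 𝓒.r ⊆ 𝓒.K) :
    Metric.ball 𝓒.z₀ 𝓒.s ⊆ 𝓒.K ∩ Metric.ball 𝓒.z₀ 𝓒.s := fun _ hz =>
  ⟨hball (Metric.ball_subset_ball 𝓒.s_le hz), hz⟩

omit [CompactSpace M] in
/-- The product is continuous on the whole space, although `𝓒.e` is continuous only in the chart,
since `J` is supported there. -/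
lemma integrable_mul_comp_e (hball : Metric.ball 𝓒.z₀ 𝓒.r ⊆ 𝓒.K) (ν : Measure E)
    [IsFiniteMeasureOnCompacts ν] {J : E → ℝ} (hJ : Continuous J) (hc : HasCompactSupport J)
    (hJs : tsupport J ⊆ Metric.ball 𝓒.z₀ 𝓒.s) {f : M → ℝ} (hf : Continuous f) :
    Integrable (fun z => J z * f (𝓒.e z)) ν := by
  refine Continuous.integrable_of_hasCompactSupport ?_ hc.mul_right
  have hco : ContinuousOn (fun z => J z * f (𝓒.e z)) (Metric.ball 𝓒.z₀ 𝓒.s) :=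
    hJ.continuousOn.mul (hf.comp_continuousOn (𝓒.continuousOn_e.mono
      ((𝓒.ball_subset_small hball).trans 𝓒.small_subset_dom)))
  exact hco.continuous_of_tsupport_subset Metric.isOpen_ball
    ((tsupport_mul_subset_left).trans hJs)

/-- Second differences of the mean distance to the points near the centre, weighted by a smooth
density `J`: the change of variables which translates these points together with the base point
turns them into second differences of the length under translations, and of `J`. -/
theorem exists_integral_near_le (h2 : 𝓒.SecondDifferencesBounded)
    (hball : Metric.ball 𝓒.z₀ 𝓒.r ⊆ 𝓒.K) (ν : Measure E) [IsFiniteMeasureOnCompacts ν]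
    [ν.IsAddLeftInvariant] [FiniteDimensional ℝ E]
    {J : E → ℝ} (hJ : ContDiff ℝ 2 J) (hJ0 : ∀ z, 0 ≤ J z)
    (hJs : tsupport J ⊆ Metric.ball 𝓒.z₀ (𝓒.s / 4)) :
    ∃ C' ≥ (0 : ℝ), ∀ a ∈ Metric.ball 𝓒.z₀ (𝓒.s / 4), ∀ w, ‖w‖ < 𝓒.s / 4 →
      ∫ z, J z * dist (𝓒.e z) (𝓒.e (a + w)) ∂ν + ∫ z, J z * dist (𝓒.e z) (𝓒.e (a - w)) ∂ν
        - 2 * ∫ z, J z * dist (𝓒.e z) (𝓒.e a) ∂ν ≤ C' * ‖w‖ ^ 2 := by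
  have hs := 𝓒.s_pos
  have hC := 𝓒.C_pos
  have hsr := 𝓒.s_le
  have hc : HasCompactSupport J :=
    (isCompact_closedBall 𝓒.z₀ (𝓒.s / 4)).of_isClosed_subset (isClosed_tsupport J)
      (hJs.trans Metric.ball_subset_closedBall)
  obtain ⟨L, hL0, hL1, hL2, hL3⟩ := exists_forall_difference_le hJ hc
  set C := 𝓒.C
  set Δ := Metric.diam (univ : Set M) with hΔ
  have hΔ' : ∀ x y : M, dist x y ≤ Δ := fun x y =>
    Metric.dist_le_diam_of_mem isCompact_univ.isBounded (mem_univ x) (mem_univ y)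
  have hΔ0 : 0 ≤ Δ := Metric.diam_nonneg
  set P := L * (2 * C ^ 3 * Δ) + 4 * (L * C) + Δ * L with hP
  have hP0 : 0 ≤ P := by positivity
  have hfin : ν (Metric.ball 𝓒.z₀ (𝓒.s / 2)) ≠ ⊤ :=
    ((measure_mono Metric.ball_subset_closedBall).trans_lt
      (isCompact_closedBall 𝓒.z₀ (𝓒.s / 2)).measure_lt_top).ne
  refine ⟨P * ν.real (Metric.ball 𝓒.z₀ (𝓒.s / 2)), by positivity, fun a ha w hw => ?_⟩
  have hJs' : tsupport J ⊆ Metric.ball 𝓒.z₀ 𝓒.s :=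
    hJs.trans (Metric.ball_subset_ball (by linarith))
  have hint : ∀ y, Integrable (fun z => J z * dist (𝓒.e z) y) ν := fun y =>
    𝓒.integrable_mul_comp_e hball ν hJ.continuous hc hJs'
      (by fun_prop : Continuous fun x => dist x y)
  -- translation of the consumers by `u`
  have htr : ∀ u b : E, ∫ z, J z * dist (𝓒.e z) (𝓒.e b) ∂ν =
      ∫ z, J (z + u) * dist (𝓒.e (z + u)) (𝓒.e b) ∂ν := fun u b =>
    (integral_add_right_eq_self (μ := ν) (fun z => J z * dist (𝓒.e z) (𝓒.e b)) u).symm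
  have hintr : ∀ u b : E, Integrable (fun z => J (z + u) * dist (𝓒.e (z + u)) (𝓒.e b)) ν :=
    fun u b => (hint (𝓒.e b)).comp_add_right u
  have hadd : Integrable (fun z => J (z + w) * dist (𝓒.e (z + w)) (𝓒.e (a + w)) +
      J (z + -w) * dist (𝓒.e (z + -w)) (𝓒.e (a - w))) ν := (hintr _ _).add (hintr _ _)
  rw [htr w, htr (-w), ← integral_const_mul, ← integral_add (hintr _ _) (hintr _ _),
    ← integral_sub hadd ((hint _).const_mul 2)]
  have hbd : Integrable ((Metric.ball 𝓒.z₀ (𝓒.s / 2)).indicator fun _ => P * ‖w‖ ^ 2) ν :=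
    (integrable_indicator_iff measurableSet_ball).2 (integrableOn_const hfin)
  refine (integral_mono (hadd.sub ((hint _).const_mul 2)) hbd ?_).trans ?_
  · intro z
    change J (z + w) * dist (𝓒.e (z + w)) (𝓒.e (a + w)) +
      J (z + -w) * dist (𝓒.e (z + -w)) (𝓒.e (a - w)) - 2 * (J z * dist (𝓒.e z) (𝓒.e a)) ≤ _
    simp only [← sub_eq_add_neg]
    by_cases hz : z ∈ Metric.ball 𝓒.z₀ (𝓒.s / 2)
    · rw [indicator_of_mem hz]
      have mem : ∀ {b u : E} {t : ℝ}, b ∈ Metric.ball 𝓒.z₀ t → t + 𝓒.s / 4 ≤ 𝓒.s →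
          ‖u‖ < 𝓒.s / 4 → b + u ∈ 𝓒.K ∩ Metric.ball 𝓒.z₀ 𝓒.s := by
        intro b u t hb ht hu
        refine 𝓒.ball_subset_small hball (mem_ball_iff_norm.2 ?_)
        rw [mem_ball_iff_norm] at hb
        rw [show b + u - 𝓒.z₀ = (b - 𝓒.z₀) + u by abel]
        exact (norm_add_le _ _).trans_lt (by linarith)
      have hwn : ‖-w‖ < 𝓒.s / 4 := by rwa [norm_neg]
      have hz0 : z ∈ 𝓒.K ∩ Metric.ball 𝓒.z₀ 𝓒.s := by
        simpa using mem (u := 0) hz (by linarith) (by simpa using hs)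
      have ha0 : a ∈ 𝓒.K ∩ Metric.ball 𝓒.z₀ 𝓒.s := by
        simpa using mem (u := 0) ha (by linarith) (by simpa using hs)
      have hzp := mem hz (by linarith) hw
      have hzm := mem hz (by linarith) hwn
      have hap := mem ha (by linarith) hw
      have ham := mem ha (by linarith) hwn
      rw [← sub_eq_add_neg] at hzm ham
      have k1 := 𝓒.dist_translate_le h2 hball hz0 ha0 (w := w) (by linarith)
      -- distances between translates differ by a first order term
      have k2 : ∀ u : E, ‖u‖ = ‖w‖ → z + u ∈ 𝓒.K ∩ Metric.ball 𝓒.z₀ 𝓒.s →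
          a + u ∈ 𝓒.K ∩ Metric.ball 𝓒.z₀ 𝓒.s →
          |dist (𝓒.e (z + u)) (𝓒.e (a + u)) - dist (𝓒.e z) (𝓒.e a)| ≤ 2 * (C * ‖w‖) := by
        intro u hu hzu hau
        have e1 := 𝓒.dist_le_mul_norm_sub (𝓒.small_subset_dom hz0) (𝓒.small_subset_dom hzu)
        have e2 := 𝓒.dist_le_mul_norm_sub (𝓒.small_subset_dom ha0) (𝓒.small_subset_dom hau)
        rw [add_sub_cancel_left, hu] at e1 e2
        change _ ≤ C * _ at e1
        change _ ≤ C * _ at e2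
        have e3 := dist_dist_dist_le (𝓒.e (z + u)) (𝓒.e (a + u)) (𝓒.e z) (𝓒.e a)
        rw [Real.dist_eq, dist_comm (𝓒.e (z + u)) (𝓒.e z),
          dist_comm (𝓒.e (a + u)) (𝓒.e a)] at e3
        linarith
      have k2p := k2 w rfl hzp hap
      have k2m := k2 (-w) (norm_neg w) (by rwa [← sub_eq_add_neg]) (by rwa [← sub_eq_add_neg])
      rw [← sub_eq_add_neg, ← sub_eq_add_neg] at k2m
      have l1 := hL1 z
      have l2p := hL2 z w
      have l2m := hL2 z (-w)
      rw [norm_neg, ← sub_eq_add_neg] at l2m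
      have l3 := hL3 z w
      set Dp := dist (𝓒.e (z + w)) (𝓒.e (a + w))
      set Dm := dist (𝓒.e (z - w)) (𝓒.e (a - w))
      have hD := hΔ' (𝓒.e z) (𝓒.e a)
      have hD0 : 0 ≤ dist (𝓒.e z) (𝓒.e a) := dist_nonneg
      set D := dist (𝓒.e z) (𝓒.e a)
      have i1 : J z * (Dp + Dm - 2 * D) ≤ L * (2 * C ^ 3 * ‖w‖ ^ 2 * Δ) := by
        calc J z * (Dp + Dm - 2 * D) ≤ J z * (2 * C ^ 3 * ‖w‖ ^ 2 * Δ) := by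
              refine mul_le_mul_of_nonneg_left ?_ (hJ0 z)
              calc _ ≤ 2 * C ^ 3 * ‖w‖ ^ 2 * D := by linarith
                _ ≤ _ := by gcongr
          _ ≤ _ := by
              gcongr
              exact (le_abs_self _).trans l1
      have i2 : ∀ {x y : ℝ}, |x| ≤ L * ‖w‖ → |y| ≤ 2 * (C * ‖w‖) →
          x * y ≤ L * ‖w‖ * (2 * (C * ‖w‖)) := by
        intro x y hx hy
        refine (le_abs_self _).trans ?_
        rw [abs_mul]
        gcongr
      have i2p := i2 l2p k2p
      have i2m := i2 l2m k2m
      have i3 : D * (J (z + w) + J (z - w) - 2 * J z) ≤ Δ * (L * ‖w‖ ^ 2) := by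
        refine (mul_le_mul_of_nonneg_left ((le_abs_self _).trans l3) hD0).trans ?_
        gcongr
      -- Leibniz rule for the second difference of the product
      calc _ = J z * (Dp + Dm - 2 * D) + (J (z + w) - J z) * (Dp - D) +
            (J (z - w) - J z) * (Dm - D) + D * (J (z + w) + J (z - w) - 2 * J z) := by ring
        _ ≤ _ := by rw [hP]; linarith
    · rw [indicator_of_notMem hz]
      have hJz : ∀ u : E, ‖u‖ < 𝓒.s / 4 → J (z + u) = 0 := by
        intro u hu
        refine image_eq_zero_of_notMem_tsupport fun hm => hz ?_
        have h1 := mem_ball_iff_norm.1 (hJs hm)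
        rw [mem_ball_iff_norm, show z - 𝓒.z₀ = (z + u - 𝓒.z₀) + -u by abel]
        exact (norm_add_le _ _).trans_lt (by rw [norm_neg]; linarith)
      have e1 := hJz w hw
      have e2 := hJz (-w) (by rwa [norm_neg])
      have e3 := hJz 0 (by simpa using hs)
      rw [← sub_eq_add_neg] at e2
      rw [add_zero] at e3
      simp [e1, e2, e3]
  · rw [integral_indicator_const _ measurableSet_ball, smul_eq_mul]
    exact le_of_eq (by ring)

end Near

variable [CompactSpace M] [MeasurableSpace M] [BorelSpace M]

/-- Second differences of the mean distance to the points outside a ball: a minimal geodesic from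
the base point to such a point meets a small sphere, on which second differences of the distance
are bounded. -/
theorem exists_integral_far_le (h2 : 𝓒.SecondDifferencesBounded)
    (hball : Metric.ball 𝓒.z₀ 𝓒.r ⊆ 𝓒.K) (μ : Measure M) [IsFiniteMeasure μ]
    (hgeo : IsGeodesic M) {X : M → ℝ} (hX : Measurable X) (hX0 : ∀ x, 0 ≤ X x)
    (hX1 : ∀ x, X x ≤ 1) (hXq : ∀ᶠ x in 𝓝 (𝓒.e 𝓒.z₀), X x = 1) :
    ∃ C' ≥ (0 : ℝ), ∃ δ > 0, ∀ a ∈ Metric.ball 𝓒.z₀ δ, ∀ w, ‖w‖ < 𝓒.r / 2 →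
      ∫ x, (1 - X x) * (dist x (𝓒.e (a + w)) + dist x (𝓒.e (a - w)) - 2 * dist x (𝓒.e a)) ∂μ ≤
        C' * ‖w‖ ^ 2 := by
  have hC := 𝓒.C_pos
  obtain ⟨ρ₁, hρ₁, hXq⟩ := Metric.eventually_nhds_iff.1 hXq
  obtain ⟨δs, hδs, himg⟩ := 𝓒.exists_dist_lt_imp 𝓒.s_pos
  set ρ := min (ρ₁ / 2) (δs / 2) with hρ
  have hρ0 : 0 < ρ := by positivity
  have hρ1 : 2 * ρ ≤ ρ₁ := by linarith [min_le_left (ρ₁ / 2) (δs / 2)]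
  have hρ2 : 2 * ρ ≤ δs := by linarith [min_le_right (ρ₁ / 2) (δs / 2)]
  set P := 2 * 𝓒.C ^ 3 * (ρ + ρ⁻¹) with hP
  have hP0 : 0 ≤ P := by positivity
  refine ⟨P * μ.real univ, by positivity, min 𝓒.s (ρ / 𝓒.C),
    lt_min 𝓒.s_pos (by positivity), fun a ha w hw => ?_⟩
  have ha' : a ∈ 𝓒.K ∩ Metric.ball 𝓒.z₀ 𝓒.s :=
    𝓒.ball_subset_small hball (Metric.ball_subset_ball (min_le_left _ _) ha)
  have haq : dist (𝓒.e a) (𝓒.e 𝓒.z₀) < ρ := by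
    have h1 := 𝓒.dist_le_mul_norm_sub 𝓒.z₀_mem_dom (𝓒.small_subset_dom ha')
    have h3 : ‖a - 𝓒.z₀‖ < ρ / 𝓒.C := (mem_ball_iff_norm.1 ha).trans_le (min_le_right _ _)
    rw [dist_comm]
    rw [lt_div_iff₀ hC] at h3
    linarith
  have hpt : ∀ x, (1 - X x) *
      (dist x (𝓒.e (a + w)) + dist x (𝓒.e (a - w)) - 2 * dist x (𝓒.e a)) ≤ P * ‖w‖ ^ 2 := by
    intro x
    have hP' : 0 ≤ P * ‖w‖ ^ 2 := by positivity
    by_cases hx : dist x (𝓒.e 𝓒.z₀) < ρ₁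
    · rw [hXq hx]
      simpa using hP'
    · have hxρ : ρ ≤ dist (𝓒.e a) x := by
        have := dist_triangle_left x (𝓒.e 𝓒.z₀) (𝓒.e a)
        linarith
      obtain ⟨m', hm1, hm2⟩ := hgeo (𝓒.e a) x ρ hρ0.le hxρ
      obtain ⟨b, hb, rfl⟩ := himg m' (by
        have := dist_triangle_left m' (𝓒.e 𝓒.z₀) (𝓒.e a)
        linarith)
      have h1 := 𝓒.dist_add_dist_le h2 hball ha' hb hw hm1 hρ0
      have h3 : ∀ y, dist x y ≤ dist y (𝓒.e b) + dist (𝓒.e b) x := fun y => by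
        rw [dist_comm x y]
        exact dist_triangle _ _ _
      have h4 := h3 (𝓒.e (a + w))
      have h5 := h3 (𝓒.e (a - w))
      have h6 : dist x (𝓒.e (a + w)) + dist x (𝓒.e (a - w)) - 2 * dist x (𝓒.e a) ≤
          P * ‖w‖ ^ 2 := by
        rw [dist_comm x (𝓒.e a)]
        linarith
      have h7 := hX0 x
      have h8 := hX1 x
      calc _ ≤ (1 - X x) * (P * ‖w‖ ^ 2) := mul_le_mul_of_nonneg_left h6 (by linarith)
        _ ≤ 1 * (P * ‖w‖ ^ 2) := mul_le_mul_of_nonneg_right (by linarith) hP'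
        _ = _ := one_mul _
  have hint : Integrable (fun x => (1 - X x) *
      (dist x (𝓒.e (a + w)) + dist x (𝓒.e (a - w)) - 2 * dist x (𝓒.e a))) μ := by
    refine (integrable_of_continuous (f := fun x => dist x (𝓒.e (a + w)) + dist x (𝓒.e (a - w)) -
      2 * dist x (𝓒.e a)) (by fun_prop)).bdd_mul (c := 1)
      (measurable_const.sub hX).aestronglyMeasurable (Eventually.of_forall fun x => ?_)
    rw [Real.norm_eq_abs, abs_le]
    constructor <;> linarith [hX0 x, hX1 x]
  refine (integral_mono hint (integrable_const _) hpt).trans_eq ?_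
  rw [integral_const, smul_eq_mul]
  ring

/-- Near an interior point, moving the base point by `± h v` increases the mean distance at most to
second order, whereas the mean square of the change of distance is at least of second order. The
smooth weight `X` separates the points near the centre, where it has the density `J`. -/
theorem exists_integral_second_difference_le [MeasurableSpace E] [BorelSpace E]
    [FiniteDimensional ℝ E] (h2 : 𝓒.SecondDifferencesBounded)
    (hball : Metric.ball 𝓒.z₀ 𝓒.r ⊆ 𝓒.K) (μ : Measure M) [IsFiniteMeasure μ]
    [μ.IsOpenPosMeasure] (ν : Measure E) [IsFiniteMeasureOnCompacts ν] [ν.IsAddLeftInvariant]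
    (hgeo : IsGeodesic M) {X : M → ℝ} (hX : Measurable X) (hX0 : ∀ x, 0 ≤ X x)
    (hX1 : ∀ x, X x ≤ 1) (hXq : ∀ᶠ x in 𝓝 (𝓒.e 𝓒.z₀), X x = 1)
    {J : E → ℝ} (hJ : ContDiff ℝ 2 J) (hJ0 : ∀ z, 0 ≤ J z)
    (hJs : tsupport J ⊆ Metric.ball 𝓒.z₀ (𝓒.s / 4))
    (hXJ : ∀ f : M → ℝ, Continuous f → ∫ x, X x * f x ∂μ = ∫ z, J z * f (𝓒.e z) ∂ν)
    {v : E} (hv : v ≠ 0) :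
    ∃ δ > 0, ∃ C' > 0, ∃ κ > 0, ∃ h₁ > 0, ∀ ybar, dist ybar (𝓒.e 𝓒.z₀) < δ → ∀ h ∈ Ioc 0 h₁,
      ∃ y y', 0 < dist y ybar ∧ 0 < dist y' ybar ∧ dist y ybar ≤ C' * h ∧ dist y' ybar ≤ C' * h ∧
        ∫ x, (dist x y - dist x ybar) ∂μ + ∫ x, (dist x y' - dist x ybar) ∂μ ≤ C' * h ^ 2 ∧
        κ * h ^ 2 ≤ ∫ x, (dist x y - dist x ybar) ^ 2 ∂μ := by
  have hC := 𝓒.C_pos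
  have hs := 𝓒.s_pos
  have hr := 𝓒.r_pos
  have hsr := 𝓒.s_le
  have hV : 0 < ‖v‖ := norm_pos_iff.2 hv
  have hin : 𝓒.PointsInward v := by
    refine ⟨𝓒.r / (4 * ‖v‖), by positivity, fun z hz θ hθ => hball (mem_ball_iff_norm.2 ?_)⟩
    have h1 := mem_ball_iff_norm.1 hz.2
    have h3 : θ * (4 * ‖v‖) ≤ 𝓒.r := (le_div_iff₀ (by positivity)).1 hθ.2
    rw [show z + θ • v - 𝓒.z₀ = z - 𝓒.z₀ + θ • v by abel]
    refine (norm_add_le _ _).trans_lt ?_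
    rw [norm_smul, Real.norm_of_nonneg hθ.1]
    linarith
  obtain ⟨A, hAo, hAne, κ, hκ, σ, hσ, h₁, hh₁, hσs, hA⟩ := 𝓒.exists_isOpen_dist_add_le hv hin
  have hα : 0 < μ.real A := ENNReal.toReal_pos (hAo.measure_pos μ hAne).ne' (measure_ne_top _ _)
  obtain ⟨C₁, hC₁, near⟩ := 𝓒.exists_integral_near_le h2 hball ν hJ hJ0 hJs
  obtain ⟨C₂, hC₂, δ₂, hδ₂, far⟩ := 𝓒.exists_integral_far_le h2 hball μ hgeo hX hX0 hX1 hXq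
  obtain ⟨δ, hδ, himg⟩ := 𝓒.exists_dist_lt_imp (σ := min (min σ δ₂) (𝓒.s / 4)) (by positivity)
  refine ⟨δ, hδ, 𝓒.C * ‖v‖ + (C₁ + C₂) * ‖v‖ ^ 2, by positivity, κ ^ 2 * μ.real A, by positivity,
    min h₁ (𝓒.s / (8 * ‖v‖)), by positivity, fun ybar hybar h hh => ?_⟩
  obtain ⟨a, ⟨haK, ha⟩, rfl⟩ := himg ybar hybar
  have haσ := Metric.ball_subset_ball ((min_le_left _ _).trans (min_le_left _ _)) ha
  have haδ := Metric.ball_subset_ball ((min_le_left _ _).trans (min_le_right _ _)) ha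
  have has := Metric.ball_subset_ball (min_le_right _ _) ha
  have hh0 : 0 < h := hh.1
  have hhs : h * (8 * ‖v‖) ≤ 𝓒.s :=
    (le_div_iff₀ (by positivity)).1 (hh.2.trans (min_le_right _ _))
  have hnw : ‖h • v‖ = h * ‖v‖ := by rw [norm_smul, Real.norm_of_nonneg hh0.le]
  have hws : ‖h • v‖ < 𝓒.s / 4 := by rw [hnw]; linarith
  have hN := near a has _ hws
  have hF := far a haδ _ (hws.trans (by linarith))
  have mem : ∀ u : E, ‖u‖ < 𝓒.s / 4 → a + u ∈ 𝓒.K ∩ Metric.ball 𝓒.z₀ 𝓒.s := by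
    intro u hu
    refine 𝓒.ball_subset_small hball (mem_ball_iff_norm.2 ?_)
    have := mem_ball_iff_norm.1 has
    rw [show a + u - 𝓒.z₀ = (a - 𝓒.z₀) + u by abel]
    exact (norm_add_le _ _).trans_lt (by linarith)
  have ha0 : a ∈ 𝓒.K ∩ Metric.ball 𝓒.z₀ 𝓒.s := by simpa using mem 0 (by simpa using hs)
  have hsub : a - h • v = a + (-h) • v := by rw [neg_smul, sub_eq_add_neg]
  have hwn : ‖(-h) • v‖ < 𝓒.s / 4 := by rwa [neg_smul, norm_neg]
  have hle : ∀ u : E, ‖u‖ = h * ‖v‖ → ‖u‖ < 𝓒.s / 4 → dist (𝓒.e (a + u)) (𝓒.e a) ≤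
      (𝓒.C * ‖v‖ + (C₁ + C₂) * ‖v‖ ^ 2) * h := by
    intro u hu hus
    have := 𝓒.dist_le_mul_norm_sub (𝓒.small_subset_dom ha0) (𝓒.small_subset_dom (mem u hus))
    rw [add_sub_cancel_left, hu, dist_comm] at this
    have h3 : 0 ≤ (C₁ + C₂) * ‖v‖ ^ 2 * h := by positivity
    linarith
  have hint : ∀ z, Integrable (fun x => dist x z) μ := fun z =>
    integrable_of_continuous (by fun_prop)
  refine ⟨𝓒.e (a + h • v), 𝓒.e (a - h • v), 𝓒.dist_pos_of_move hv hh0.ne' ha0 (mem _ hws), ?_,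
    hle _ hnw hws, ?_, ?_, ?_⟩
  · rw [hsub]
    exact 𝓒.dist_pos_of_move hv (neg_ne_zero.2 hh0.ne') ha0 (mem _ hwn)
  · rw [hsub]
    exact hle _ (by rw [neg_smul, norm_neg, hnw]) hwn
  · have hXint : ∀ y, Integrable (fun x => X x * dist x y) μ := fun y => by
      refine (hint y).bdd_mul (c := 1) hX.aestronglyMeasurable (Eventually.of_forall fun x => ?_)
      rw [Real.norm_eq_abs, abs_le]
      constructor <;> linarith [hX0 x, hX1 x]
    have e1 : ∫ x, (1 - X x) * (dist x (𝓒.e (a + h • v)) + dist x (𝓒.e (a - h • v)) -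
        2 * dist x (𝓒.e a)) ∂μ =
        (∫ x, (dist x (𝓒.e (a + h • v)) - dist x (𝓒.e a)) ∂μ +
          ∫ x, (dist x (𝓒.e (a - h • v)) - dist x (𝓒.e a)) ∂μ) -
        (∫ x, X x * dist x (𝓒.e (a + h • v)) ∂μ + ∫ x, X x * dist x (𝓒.e (a - h • v)) ∂μ -
          2 * ∫ x, X x * dist x (𝓒.e a) ∂μ) := by
      have i1 := (hint (𝓒.e (a + h • v))).sub (hint (𝓒.e a))
      have i2 := (hint (𝓒.e (a - h • v))).sub (hint (𝓒.e a))
      have i3 := (hXint (𝓒.e (a + h • v))).add (hXint (𝓒.e (a - h • v)))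
      have i4 := (hXint (𝓒.e a)).const_mul 2
      refine Eq.trans (integral_congr_ae (Eventually.of_forall fun x => ?_))
        ((integral_sub (i1.add i2) (i3.sub i4)).trans (congrArg₂ _ ((integral_add i1 i2).trans rfl)
          ((integral_sub i3 i4).trans (congrArg₂ _ (integral_add (hXint _) (hXint _))
            (integral_const_mul _ _)))))
      simp only [Pi.add_apply, Pi.sub_apply]
      ring
    rw [hXJ _ (by fun_prop), hXJ _ (by fun_prop), hXJ _ (by fun_prop)] at e1
    rw [hnw] at hN hF
    have h3 : 0 ≤ 𝓒.C * ‖v‖ * h ^ 2 := by positivity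
    calc _ ≤ (C₁ + C₂) * (h * ‖v‖) ^ 2 := by linarith
      _ ≤ _ := by rw [add_mul _ _ (h ^ 2), mul_pow]; linarith
  · have hsq : Integrable (fun x => (dist x (𝓒.e (a + h • v)) - dist x (𝓒.e a)) ^ 2) μ :=
      integrable_of_continuous (by fun_prop)
    calc κ ^ 2 * μ.real A * h ^ 2 = ∫ x, A.indicator (fun _ => (κ * h) ^ 2) x ∂μ := by
          rw [integral_indicator_const _ hAo.measurableSet, smul_eq_mul]; ring
      _ ≤ _ := by
        refine integral_mono ((integrable_const _).indicator hAo.measurableSet) hsq fun x => ?_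
        by_cases hx : x ∈ A
        · rw [indicator_of_mem hx]
          have := hA a ⟨haK, haσ⟩ h ⟨hh0, hh.2.trans (min_le_left _ _)⟩ x hx
          have h3 : 0 ≤ κ * h := by positivity
          rw [← neg_sq (dist x (𝓒.e (a + h • v)) - dist x (𝓒.e a))]
          exact pow_le_pow_left₀ h3 (by linarith) 2
        · rw [indicator_of_notMem hx]
          positivity

end MetricChart

/-! ### The mean distance on a Riemannian manifold -/

lemma isGeodesic {E : Type*} [NormedAddCommGroup E] [NormedSpace ℝ E] {H : Type*}
    [TopologicalSpace H] (I : ModelWithCorners ℝ E H) (M : Type*) [MetricSpace M]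
    [ChartedSpace H M] [RiemannianBundle (fun x : M => TangentSpace I x)]
    [IsRiemannianManifold I M] [CompactSpace M] : IsGeodesic M :=
  fun a x _ h0 h1 => exists_dist_eq_dist_eq_sub I a x h0 h1

section Dual

variable {E : Type*} [NormedAddCommGroup E] [NormedSpace ℝ E] [FiniteDimensional ℝ E]

/-- From a point `z₀` of a convex set `K` there is a direction towards the interior of `K` which
makes a nonobtuse angle with all the directions towards points of `K`. Otherwise a hyperplane
separates `interior K - z₀` from the dual cone of `K - z₀`, and its normal is opposite to a vector
of the dual cone. -/
lemma exists_mem_interior_forall_nonneg {K : Set E} (hK : Convex ℝ K)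
    (hne : (interior K).Nonempty) (z₀ : E) (B : E →L[ℝ] E →L[ℝ] ℝ)
    (hsymm : ∀ u w, B u w = B w u) (hpos : ∀ u, u ≠ 0 → 0 < B u u) :
    ∃ z₁ ∈ interior K, ∀ b ∈ K, 0 ≤ B (b - z₀) (z₁ - z₀) := by
  by_contra! hcon
  set O : Set E := (fun z => z + z₀) ⁻¹' interior K with hO
  set T : Set E := {v | ∀ b ∈ K, 0 ≤ B (b - z₀) v} with hT
  have hOc : Convex ℝ O := hK.interior.translate_preimage_left z₀
  have hOo : IsOpen O := isOpen_interior.preimage (by fun_prop)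
  have hTc : Convex ℝ T := by
    intro u hu w hw s t hs ht _ b hb
    rw [map_add, map_smul, map_smul, smul_eq_mul, smul_eq_mul]
    exact add_nonneg (mul_nonneg hs (hu b hb)) (mul_nonneg ht (hw b hb))
  have hdisj : Disjoint O T := by
    refine disjoint_left.2 fun v hv hvT => ?_
    obtain ⟨b, hb, hlt⟩ := hcon _ hv
    rw [add_sub_cancel_right] at hlt
    exact hlt.not_ge (hvT b hb)
  obtain ⟨f, u, hfO, hfT⟩ := geometric_hahn_banach_open hOc hOo hTc hdisj
  have hu : u ≤ 0 := by simpa using hfT 0 fun b _ => by simp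
  have hf0 : ∀ v ∈ T, 0 ≤ f v := by
    intro v hv
    by_contra! hneg
    have hmem : ((u - 1) / f v) • v ∈ T := fun b hb => by
      rw [map_smul, smul_eq_mul]
      exact mul_nonneg (div_nonneg_of_nonpos (by linarith) hneg.le) (hv b hb)
    have := hfT _ hmem
    rw [map_smul, smul_eq_mul, div_mul_cancel₀ _ hneg.ne] at this
    linarith
  -- the vector that represents `f`
  obtain ⟨w, hw⟩ : ∃ w, ∀ v, B w v = f v := by
    let L : E →ₗ[ℝ] Module.Dual ℝ E :=
      { toFun := fun w => (B w).toLinearMap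
        map_add' := fun _ _ => by ext; simp
        map_smul' := fun _ _ => by ext; simp }
    have hL : Function.Injective L := by
      rw [injective_iff_map_eq_zero]
      intro a ha
      by_contra hne
      exact (hpos a hne).ne' (LinearMap.congr_fun ha a)
    obtain ⟨w, hw⟩ := (LinearMap.injective_iff_surjective_of_finrank_eq_finrank
      Subspace.dual_finrank_eq.symm).1 hL f.toLinearMap
    exact ⟨w, fun v => LinearMap.congr_fun hw v⟩
  have hwT : -w ∈ T := by
    intro b hb
    have hcl : b ∈ closure (interior K) := by
      rw [hK.closure_interior_eq_closure_of_nonempty_interior hne]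
      exact subset_closure hb
    have hclosed : IsClosed {z | f (z - z₀) ≤ 0} := isClosed_le (by fun_prop) continuous_const
    have h1 : f (b - z₀) ≤ 0 := closure_minimal (fun z hz =>
      ((hfO (z - z₀) (by simpa [hO] using hz)).trans_le hu).le) hclosed hcl
    rw [map_neg, hsymm, hw]
    linarith
  have h2 : f w ≤ 0 := by simpa using hf0 _ hwT
  have hw0 : w = 0 := by
    by_contra hne
    have := hpos w hne
    rw [hw] at this
    linarith
  obtain ⟨z, hz⟩ := hne
  have h3 := hfO (z - z₀) (by simpa [hO] using hz)
  rw [← hw, hw0, map_zero, zero_apply] at h3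
  linarith

end Dual

section

variable {d : ℕ} {H : Type*} [TopologicalSpace H]
  {I : ModelWithCorners ℝ (EuclideanSpace ℝ (Fin d)) H}
  {M : Type*} [MetricSpace M] [CompactSpace M] [ChartedSpace H M] [IsManifold I ∞ M]
  [RiemannianBundle (fun x : M => TangentSpace I x)]
  [IsContMDiffRiemannianBundle I ∞ (EuclideanSpace ℝ (Fin d)) (fun x : M => TangentSpace I x)]
  [IsRiemannianManifold I M] [MeasurableSpace M] [BorelSpace M]

/-- Near a point of the boundary, there are arbitrarily small displacements which decrease the mean
distance to the points of `M` at a definite rate. -/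
theorem exists_integral_dist_decrease_of_notMem_interior (hd : 0 < d) (q : M)
    (hq : extChartAt I q q ∉ interior (range I)) :
    ∃ δ > 0, ∀ ybar, dist ybar q < δ → ∃ η > 0, ∀ ε > 0, ∃ y, y ≠ ybar ∧ dist y ybar < ε ∧
      ∫ x, (dist x y - dist x ybar) ∂(riemannianVolume I M) ≤ -η * dist y ybar := by
  have := isFiniteMeasure_riemannianVolume (I := I) (M := M)
  have := isOpenPosMeasure_riemannianVolume (I := I) (M := M)
  have hqt : extChartAt I q q ∈ (extChartAt I q).target := mem_extChartAt_target q
  obtain ⟨z₁, hz₁, hdual⟩ := exists_mem_interior_forall_nonneg I.convex_range I.nonempty_interior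
    (extChartAt I q q) (metricForm I q (extChartAt I q q)) (metricForm_comm q _)
    fun u hu => metricForm_pos q hqt hu
  obtain ⟨ρ, hρ, hball⟩ := Metric.isOpen_iff.1 isOpen_interior z₁ hz₁
  obtain ⟨𝓒, hr, hK, he, hz₀, hB, -⟩ := exists_metricChart (I := I) q hρ
  have heq : 𝓒.e 𝓒.z₀ = q := by rw [he, hz₀, extChartAt_to_inv]
  have hv : z₁ - 𝓒.z₀ ≠ 0 := by
    rw [sub_ne_zero, hz₀]
    rintro rfl
    exact hq hz₁
  have hin : 𝓒.PointsInward (z₁ - 𝓒.z₀) := by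
    refine ⟨1, one_pos, fun z hz θ hθ => ?_⟩
    have h1 : z + (z₁ - 𝓒.z₀) ∈ 𝓒.K := by
      rw [hK]
      refine interior_subset (hball (mem_ball_iff_norm.2 ?_))
      rw [show z + (z₁ - 𝓒.z₀) - z₁ = z - 𝓒.z₀ by abel]
      have := mem_ball_iff_norm.1 hz.2
      linarith [𝓒.r_pos]
    have := 𝓒.convex hz.1 h1 (a := 1 - θ) (b := θ) (by linarith [hθ.2]) hθ.1 (by ring)
    convert this using 1
    rw [smul_add, ← add_assoc, ← add_smul, sub_add_cancel, one_smul]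
  obtain ⟨δ, hδ, h⟩ := 𝓒.exists_integral_dist_decrease (riemannianVolume I M) (isGeodesic I M)
    (by rw [heq]; exact riemannianVolume_singleton hd q) hv hin
    (fun b hb => by rw [hB, hz₀]; rw [hK] at hb; exact hdual b hb)
  rw [heq] at h
  exact ⟨δ, hδ, h⟩

omit [CompactSpace M] [IsRiemannianManifold I M] in
/-- A smooth bump around an interior point, as a function on `M` and as a density in the chart. -/
lemma exists_smooth_weight (q : M) {σ : ℝ} (hσ : 0 < σ)
    (hball : Metric.ball (extChartAt I q q) σ ⊆ (extChartAt I q).target) :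
    ∃ (X : M → ℝ) (J : EuclideanSpace ℝ (Fin d) → ℝ), Measurable X ∧ (∀ x, 0 ≤ X x) ∧
      (∀ x, X x ≤ 1) ∧ (∀ᶠ x in 𝓝 q, X x = 1) ∧ ContDiff ℝ 2 J ∧ (∀ z, 0 ≤ J z) ∧
      tsupport J ⊆ Metric.ball (extChartAt I q q) σ ∧
      ∀ f : M → ℝ, Continuous f →
        ∫ x, X x * f x ∂(riemannianVolume I M) = ∫ z, J z * f ((extChartAt I q).symm z) := by
  set z₀ := extChartAt I q q with hz₀
  let φ : ContDiffBump z₀ := ⟨σ / 4, σ / 2, by positivity, by linarith⟩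
  have hφs : tsupport φ ⊆ Metric.ball z₀ σ := by
    rw [φ.tsupport_eq]
    exact Metric.closedBall_subset_ball (by change σ / 2 < σ; linarith)
  set X : M → ℝ := (extChartAt I q).source.indicator fun x => φ (extChartAt I q x) with hX
  set J : EuclideanSpace ℝ (Fin d) → ℝ := fun z => √(metricMatrix I q z).det * φ z with hJ
  have hJs : tsupport J ⊆ Metric.ball z₀ σ := tsupport_mul_subset_right.trans hφs
  have hXm : Measurable X := by
    classical
    rw [hX, ← piecewise_eq_indicator]
    exact ContinuousOn.measurable_piecewise
      (φ.continuous.comp_continuousOn (continuousOn_extChartAt q)) continuousOn_const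
      (isOpen_extChartAt_source q).measurableSet
  have hJ0 : ∀ z ∉ Metric.ball z₀ σ, J z = 0 := fun z hz =>
    image_eq_zero_of_notMem_tsupport fun h => hz (hJs h)
  refine ⟨X, J, hXm, fun x => indicator_nonneg (fun _ _ => φ.nonneg) x,
    fun x => indicator_apply_le' (fun _ => φ.le_one) fun _ => zero_le_one, ?_, ?_,
    fun z => mul_nonneg (Real.sqrt_nonneg _) φ.nonneg, hJs, fun f hf => ?_⟩
  · have h1 : ∀ᶠ x in 𝓝 q, extChartAt I q x ∈ Metric.ball z₀ (σ / 4) :=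
      (continuousAt_extChartAt q).eventually (Metric.ball_mem_nhds _ (by positivity))
    filter_upwards [h1, extChartAt_source_mem_nhds (I := I) q] with x hx hxs
    rw [hX, indicator_of_mem hxs]
    exact φ.one_of_mem_closedBall (Metric.ball_subset_closedBall hx)
  · rw [contDiff_iff_contDiffAt]
    intro z
    by_cases hz : z ∈ Metric.ball z₀ σ
    · have h1 : ContDiffAt ℝ ∞ (fun z => √(metricMatrix I q z).det) z :=
        ((contDiffOn_sqrt_det_metricMatrix q).mono hball).contDiffAt
          (Metric.isOpen_ball.mem_nhds hz)
      exact (h1.mul φ.contDiff.contDiffAt).of_le ENat.LEInfty.out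
    · have h1 : J =ᶠ[𝓝 z] 0 := notMem_tsupport_iff_eventuallyEq.1 fun h => hz (hJs h)
      exact contDiffAt_const.congr_of_eventuallyEq h1
  · rw [integral_riemannianVolume_eq (I := I) q (F := fun x => X x * f x)
      (hXm.mul hf.measurable) fun x hx => by rw [hX, indicator_of_notMem hx, zero_mul]]
    rw [← setIntegral_eq_integral_of_forall_compl_eq_zero (s := (extChartAt I q).target)
      (f := fun z => J z * f ((extChartAt I q).symm z))
      fun z hz => by rw [hJ0 z fun h => hz (hball h), zero_mul]]
    refine setIntegral_congr_fun (measurableSet_extChartAt_target q) fun z hz => ?_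
    simp only [hX, hJ]
    rw [indicator_of_mem ((extChartAt I q).map_target hz), (extChartAt I q).right_inv hz]
    ring

/-- Near a point of the interior, there are pairs of arbitrarily small displacements for which the
mean distance increases at most to second order, whereas the mean square of the change of distance
is at least of second order. -/
theorem exists_integral_second_difference_le_of_mem_interior (hd : 0 < d) (q : M)
    (hq : extChartAt I q q ∈ interior (range I)) :
    ∃ δ > 0, ∃ C' > 0, ∃ κ > 0, ∃ h₁ > 0, ∀ ybar, dist ybar q < δ → ∀ h ∈ Ioc 0 h₁,
      ∃ y y', 0 < dist y ybar ∧ 0 < dist y' ybar ∧ dist y ybar ≤ C' * h ∧ dist y' ybar ≤ C' * h ∧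
        ∫ x, (dist x y - dist x ybar) ∂(riemannianVolume I M) +
          ∫ x, (dist x y' - dist x ybar) ∂(riemannianVolume I M) ≤ C' * h ^ 2 ∧
        κ * h ^ 2 ≤ ∫ x, (dist x y - dist x ybar) ^ 2 ∂(riemannianVolume I M) := by
  have := isFiniteMeasure_riemannianVolume (I := I) (M := M)
  have := isOpenPosMeasure_riemannianVolume (I := I) (M := M)
  obtain ⟨𝓒, -, hK, he, hz₀, hB, hdom, hint⟩ := exists_metricChart (I := I) q one_pos
  obtain ⟨hball, h2⟩ := hint hq
  have heq : 𝓒.e 𝓒.z₀ = q := by rw [he, hz₀, extChartAt_to_inv]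
  have hs := 𝓒.s_pos
  have ht : Metric.ball (extChartAt I q q) (𝓒.s / 4) ⊆ (extChartAt I q).target := by
    rw [← hz₀]
    exact fun z hz => hdom (𝓒.small_subset_dom (𝓒.ball_subset_small hball
      (Metric.ball_subset_ball (by linarith) hz)))
  obtain ⟨X, J, hX, hX0, hX1, hXq, hJ, hJ0, hJs, hXJ⟩ := exists_smooth_weight q
    (by positivity : 0 < 𝓒.s / 4) ht
  rw [← heq] at hXq
  rw [← hz₀] at hJs
  rw [← he] at hXJ
  have hv : (EuclideanSpace.single (⟨0, hd⟩ : Fin d) (1 : ℝ)) ≠ 0 := by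
    rw [← norm_ne_zero_iff]
    simp
  have := 𝓒.exists_integral_second_difference_le h2 hball (riemannianVolume I M) volume
    (isGeodesic I M) hX hX0 hX1 hXq hJ hJ0 hJs hXJ hv
  rwa [heq] at this

end

/-! ### Growth of the demand -/

/-- The function `s ↦ 1 / (1 + n eˢ)` is strictly convex at `0` when `n > 1`: it lies above its
tangent at `0`, by a quadratic amount. -/
lemma exists_le_one_div_one_add_mul_exp {n : ℝ} (hn : 1 < n) :
    ∃ c > 0, ∃ τ > 0, ∀ s, |s| ≤ τ →
      1 / (n + 1) - n / (n + 1) ^ 2 * s + c * s ^ 2 ≤ 1 / (1 + n * Real.exp s) := by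
  set k := n + 1 with hk
  have hk0 : 0 < k := by linarith
  -- `4 * a / k` is the second derivative at `0`
  set a := n * (n - 1) / (4 * k ^ 2) with ha
  have ha0 : 0 < a := by
    have : 0 < n - 1 := by linarith
    positivity
  set p := n / k with hp
  have hp0 : 0 < p := by positivity
  have hp1 : p < 1 := (div_lt_one hk0).2 (by linarith)
  have ha1 : a ≤ 1 := by
    rw [ha, div_le_one (by positivity), hk]
    nlinarith
  have hpa : p / 2 - p ^ 2 = -(2 * a) := by
    rw [hp, ha, hk]
    field_simp
    ring
  refine ⟨a / k, by positivity, min 1 (a / 5), by positivity, fun s hs => ?_⟩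
  have hs1 : |s| ≤ 1 := hs.trans (min_le_left _ _)
  have hs2 : |s| * 5 ≤ a := (le_div_iff₀ (by norm_num)).1 (hs.trans (min_le_right _ _))
  have hs0 := abs_nonneg s
  set u := s + s ^ 2 / 2 + |s| ^ 3 with hu
  have hexp : Real.exp s ≤ 1 + u := by
    have h := Real.exp_bound hs1 (n := 3) (by norm_num)
    simp only [Finset.sum_range_succ, Finset.sum_range_zero] at h
    norm_num [Nat.factorial] at h
    have h2 := (abs_le.1 h).2
    have h3 : 0 ≤ |s| ^ 3 := by positivity
    linarith
  have hden : 1 + n * Real.exp s ≤ k * (1 + p * u) := by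
    have h1 : k * (1 + p * u) = 1 + n * (1 + u) := by
      rw [hp, hk]; field_simp; ring
    rw [h1]
    gcongr
  have hden0 : 0 < 1 + n * Real.exp s := by positivity
  have hD0 : 0 < 1 + p * u := pos_of_mul_pos_right (hden0.trans_le hden) hk0.le
  have hsq : s ^ 2 = |s| ^ 2 := (sq_abs s).symm
  have hq : (1 - p * s + a * s ^ 2) * (1 + p * u) ≤ 1 := by
    have e1 : (1 - p * s + a * s ^ 2) * (1 + p * u) = 1 + (p / 2 - p ^ 2) * s ^ 2 + a * s ^ 2 +
        (p * |s| ^ 3 - p ^ 2 * (s ^ 3 / 2) - p ^ 2 * (s * |s| ^ 3) + a * p * (s ^ 2 * u)) := by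
      rw [hu]; ring
    have i1 : p * |s| ^ 3 ≤ 1 * |s| ^ 3 := by gcongr
    have hp2 : p ^ 2 ≤ 1 := pow_le_one₀ hp0.le hp1.le
    have i2 : -(p ^ 2 * (s ^ 3 / 2)) ≤ 1 * (|s| ^ 3 / 2) := by
      refine (neg_le_abs _).trans ?_
      rw [abs_mul, abs_div, abs_pow, abs_pow, abs_of_pos hp0, abs_of_pos (two_pos : (0 : ℝ) < 2)]
      gcongr
    have i3 : -(p ^ 2 * (s * |s| ^ 3)) ≤ 1 * (1 * |s| ^ 3) := by
      refine (neg_le_abs _).trans ?_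
      rw [abs_mul, abs_mul, abs_pow, abs_pow, abs_abs, abs_of_pos hp0]
      gcongr
    have hus : u ≤ |s| * (5 / 2) := by
      have h1 : |s| ^ 2 ≤ |s| := by nlinarith
      have h2 : |s| ^ 3 ≤ |s| := by nlinarith [mul_nonneg hs0 hs0]
      rw [hu, hsq]
      linarith [le_abs_self s]
    have i4 : a * p * (s ^ 2 * u) ≤ 1 * (|s| ^ 3 * (5 / 2)) := by
      calc a * p * (s ^ 2 * u) ≤ a * p * (|s| ^ 2 * (|s| * (5 / 2))) := by
            rw [hsq]; gcongr
        _ = a * p * (|s| ^ 3 * (5 / 2)) := by ring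
        _ ≤ 1 * (|s| ^ 3 * (5 / 2)) := by
            gcongr
            nlinarith
    have i5 : |s| ^ 3 * 5 ≤ a * s ^ 2 := by
      rw [hsq]
      calc |s| ^ 3 * 5 = (|s| * 5) * |s| ^ 2 := by ring
        _ ≤ _ := by gcongr
    rw [e1, hpa]
    linarith
  calc 1 / k - n / k ^ 2 * s + a / k * s ^ 2 = (1 - p * s + a * s ^ 2) / k := by
        rw [hp]; field_simp
    _ ≤ 1 / (k * (1 + p * u)) := by
        rw [div_le_div_iff₀ hk0 (by positivity)]
        nlinarith
    _ ≤ 1 / (1 + n * Real.exp s) := by gcongr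

section

variable {M : Type*} [MetricSpace M] [MeasurableSpace M] [BorelSpace M]

/-- When `n` firms are at `ybar` and another one, with the same price, moves away from `ybar`, the
demand of the latter can be made to grow at least quadratically by arbitrarily small moves. -/
def DemandGrows (μ : Measure M) (n β : ℝ) (ybar : M) : Prop :=
  ∃ η > 0, ∀ ε > 0, ∃ y, y ≠ ybar ∧ dist y ybar < ε ∧
    1 / (n + 1) + η * dist y ybar ^ 2 ≤
      ⨍ x, 1 / (1 + n * Real.exp (β * (dist x y - dist x ybar))) ∂μ

variable [CompactSpace M] {μ : Measure M} [IsFiniteMeasure μ] [NeZero μ]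

/-- Second order lower bound for the demand after a small move: the term linear in the change of
distance is multiplied by `β`, the quadratic one by `β ^ 2`. -/
lemma exists_le_average {n : ℝ} (hn : 1 < n) :
    ∃ c > 0, ∃ τ > 0, ∀ β > 0, ∀ y ybar : M, β * dist y ybar ≤ τ →
      1 / (n + 1) + (c * β ^ 2 * ∫ x, (dist x y - dist x ybar) ^ 2 ∂μ -
        n / (n + 1) ^ 2 * β * ∫ x, (dist x y - dist x ybar) ∂μ) / μ.real univ ≤
      ⨍ x, 1 / (1 + n * Real.exp (β * (dist x y - dist x ybar))) ∂μ := by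
  obtain ⟨c, hc, τ, hτ, h⟩ := exists_le_one_div_one_add_mul_exp hn
  refine ⟨c, hc, τ, hτ, fun β hβ y ybar hd => ?_⟩
  have hm : 0 < μ.real univ := by
    rw [Measure.real, ENNReal.toReal_pos_iff]
    exact ⟨Measure.measure_univ_pos.2 (NeZero.ne μ), measure_lt_top _ _⟩
  have ht : ∀ x, |β * (dist x y - dist x ybar)| ≤ τ := fun x => by
    rw [abs_mul, abs_of_pos hβ]
    refine le_trans ?_ hd
    gcongr
    rw [dist_comm x y, dist_comm x ybar]
    exact abs_dist_sub_le y ybar x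
  have hi1 : Integrable (fun x => dist x y - dist x ybar) μ :=
    integrable_of_continuous (by fun_prop)
  have hi2 : Integrable (fun x => (dist x y - dist x ybar) ^ 2) μ :=
    integrable_of_continuous (by fun_prop)
  have hi3 : Integrable (fun x => 1 / (1 + n * Real.exp (β * (dist x y - dist x ybar)))) μ := by
    refine integrable_of_continuous ?_
    refine continuous_const.div (by fun_prop) fun x => ?_
    positivity
  have hmono := integral_mono (((integrable_const (1 / (n + 1))).sub
    (hi1.const_mul (n / (n + 1) ^ 2 * β))).add (hi2.const_mul (c * β ^ 2))) hi3 fun x => by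
      refine le_trans (le_of_eq ?_) (h _ (ht x))
      simp only [Pi.add_apply, Pi.sub_apply]
      ring
  rw [integral_add' ((integrable_const (1 / (n + 1))).sub
    (hi1.const_mul (n / (n + 1) ^ 2 * β))) (hi2.const_mul (c * β ^ 2)),
    integral_sub' (integrable_const (1 / (n + 1))) (hi1.const_mul (n / (n + 1) ^ 2 * β)),
    integral_const_mul, integral_const_mul, integral_const, smul_eq_mul] at hmono
  rw [average_eq, smul_eq_mul, ← div_eq_inv_mul, le_div_iff₀ hm, add_mul, div_mul_cancel₀ _ hm.ne']
  linarith

/-- When the mean distance decreases at a definite rate, the linear term suffices for the demand to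
grow. -/
lemma demandGrows_of_integral_le {n : ℝ} (hn : 1 < n) {ybar : M} {η : ℝ} (hη : 0 < η)
    (h : ∀ ε > 0, ∃ y, y ≠ ybar ∧ dist y ybar < ε ∧
      ∫ x, (dist x y - dist x ybar) ∂μ ≤ -η * dist y ybar) {β : ℝ} (hβ : 0 < β) :
    DemandGrows μ n β ybar := by
  obtain ⟨c, hc, τ, hτ, hav⟩ := exists_le_average (μ := μ) hn
  have hm : 0 < μ.real univ := by
    rw [Measure.real, ENNReal.toReal_pos_iff]
    exact ⟨Measure.measure_univ_pos.2 (NeZero.ne μ), measure_lt_top _ _⟩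
  refine ⟨n / (n + 1) ^ 2 * β * η / μ.real univ, by positivity, fun ε hε => ?_⟩
  obtain ⟨y, hne, hlt, hle⟩ := h (min ε (min 1 (τ / β))) (by positivity)
  have h1 : dist y ybar ≤ 1 := hlt.le.trans ((min_le_right _ _).trans (min_le_left _ _))
  have h2 : dist y ybar * β ≤ τ :=
    (le_div_iff₀ hβ).1 (hlt.le.trans ((min_le_right _ _).trans (min_le_right _ _)))
  refine ⟨y, hne, hlt.trans_le (min_le_left _ _), le_trans ?_ (hav β hβ y ybar (by linarith))⟩
  rw [div_mul_eq_mul_div]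
  gcongr
  have h3 : 0 ≤ c * β ^ 2 * ∫ x, (dist x y - dist x ybar) ^ 2 ∂μ :=
    mul_nonneg (by positivity) (integral_nonneg fun x => sq_nonneg _)
  have h4 : dist y ybar ^ 2 ≤ dist y ybar := by nlinarith [dist_nonneg (x := y) (y := ybar)]
  have hA : 0 < n / (n + 1) ^ 2 * β := by positivity
  calc n / (n + 1) ^ 2 * β * η * dist y ybar ^ 2
      ≤ n / (n + 1) ^ 2 * β * η * dist y ybar := by gcongr
    _ = -(n / (n + 1) ^ 2 * β * (-η * dist y ybar)) := by ring
    _ ≤ -(n / (n + 1) ^ 2 * β * ∫ x, (dist x y - dist x ybar) ∂μ) := by gcongr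
    _ ≤ _ := by linarith

/-- When the rationality is large, the convexity of the demand as a function of the change of
distance wins over the second order increase of the mean distance. -/
lemma exists_demandGrows_of_integral_le {n : ℝ} (hn : 1 < n) {C' κ : ℝ} (hC : 0 < C')
    (hκ : 0 < κ) :
    ∃ β₀ > 0, ∀ (ybar : M) (h₁ : ℝ), 0 < h₁ → (∀ h ∈ Ioc 0 h₁, ∃ y y', 0 < dist y ybar ∧
      0 < dist y' ybar ∧ dist y ybar ≤ C' * h ∧ dist y' ybar ≤ C' * h ∧
      ∫ x, (dist x y - dist x ybar) ∂μ + ∫ x, (dist x y' - dist x ybar) ∂μ ≤ C' * h ^ 2 ∧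
      κ * h ^ 2 ≤ ∫ x, (dist x y - dist x ybar) ^ 2 ∂μ) → ∀ β > β₀, DemandGrows μ n β ybar := by
  obtain ⟨c, hc, τ, hτ, hav⟩ := exists_le_average (μ := μ) hn
  have hm : 0 < μ.real univ := by
    rw [Measure.real, ENNReal.toReal_pos_iff]
    exact ⟨Measure.measure_univ_pos.2 (NeZero.ne μ), measure_lt_top _ _⟩
  refine ⟨n / (n + 1) ^ 2 * C' / (c * κ), by positivity, fun ybar h₁ hh₁ H β hβ => ?_⟩
  have hβ0 : 0 < β := lt_trans (by positivity) hβ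
  rw [gt_iff_lt, div_lt_iff₀ (by positivity)] at hβ
  set ζ := c * β ^ 2 * κ - n / (n + 1) ^ 2 * β * C' with hζ
  have hζ0 : 0 < ζ := by
    have : ζ = β * (β * (c * κ) - n / (n + 1) ^ 2 * C') := by rw [hζ]; ring
    rw [this]
    exact mul_pos hβ0 (by linarith)
  refine ⟨ζ / (2 * C' ^ 2 * μ.real univ), by positivity, fun ε hε => ?_⟩
  set h := min h₁ (min (ε / (2 * C')) (τ / (β * C'))) with hh
  have hh0 : 0 < h := by positivity
  have hhε : h * (2 * C') ≤ ε := (le_div_iff₀ (by positivity)).1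
    ((min_le_right _ _).trans (min_le_left _ _))
  have hhτ : h * (β * C') ≤ τ := (le_div_iff₀ (by positivity)).1
    ((min_le_right _ _).trans (min_le_right _ _))
  obtain ⟨y, y', hy, hy', hyh, hyh', hle, hsq⟩ := H h ⟨hh0, min_le_left _ _⟩
  have hsmall : ∀ z, dist z ybar ≤ C' * h → β * dist z ybar ≤ τ := fun z hz => by
    calc β * dist z ybar ≤ β * (C' * h) := by gcongr
      _ ≤ τ := by linarith
  have hlt : ∀ z, dist z ybar ≤ C' * h → dist z ybar < ε := fun z hz => by
    have : 0 < C' * h := by positivity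
    linarith
  have hav1 := hav β hβ0 y ybar (hsmall y hyh)
  have hav2 := hav β hβ0 y' ybar (hsmall y' hyh')
  set a := ⨍ x, 1 / (1 + n * Real.exp (β * (dist x y - dist x ybar))) ∂μ
  set a' := ⨍ x, 1 / (1 + n * Real.exp (β * (dist x y' - dist x ybar))) ∂μ
  have hsum : 2 * (1 / (n + 1)) + ζ * h ^ 2 / μ.real univ ≤ a + a' := by
    refine le_trans ?_ (add_le_add hav1 hav2)
    have h3 : 0 ≤ c * β ^ 2 * ∫ x, (dist x y' - dist x ybar) ^ 2 ∂μ :=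
      mul_nonneg (by positivity) (integral_nonneg fun x => sq_nonneg _)
    have h4 : c * β ^ 2 * (κ * h ^ 2) ≤ c * β ^ 2 * ∫ x, (dist x y - dist x ybar) ^ 2 ∂μ := by
      gcongr
    have h5 : n / (n + 1) ^ 2 * β * (∫ x, (dist x y - dist x ybar) ∂μ +
        ∫ x, (dist x y' - dist x ybar) ∂μ) ≤ n / (n + 1) ^ 2 * β * (C' * h ^ 2) := by
      gcongr
    rw [add_add_add_comm, ← add_div (_ - _), two_mul]
    refine add_le_add_right ?_ _
    gcongr
    rw [hζ]
    linarith
  have key : ∀ z, dist z ybar ≤ C' * h →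
      ζ / (2 * C' ^ 2 * μ.real univ) * dist z ybar ^ 2 ≤ ζ * h ^ 2 / μ.real univ / 2 := by
    intro z hz
    calc ζ / (2 * C' ^ 2 * μ.real univ) * dist z ybar ^ 2
        ≤ ζ / (2 * C' ^ 2 * μ.real univ) * (C' * h) ^ 2 := by gcongr
      _ = _ := by field_simp
  have k1 := key y hyh
  have k2 := key y' hyh'
  -- the better of the two moves
  rcases le_total a' a with hcase | hcase
  · exact ⟨y, dist_pos.1 hy, hlt y hyh, by linarith⟩
  · exact ⟨y', dist_pos.1 hy', hlt y' hyh', by linarith⟩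

end

section

variable {d : ℕ} {H : Type*} [TopologicalSpace H]
  (I : ModelWithCorners ℝ (EuclideanSpace ℝ (Fin d)) H)
  (M : Type*) [MetricSpace M] [CompactSpace M] [ChartedSpace H M] [IsManifold I ∞ M]
  [RiemannianBundle (fun x : M => TangentSpace I x)]
  [IsContMDiffRiemannianBundle I ∞ (EuclideanSpace ℝ (Fin d)) (fun x : M => TangentSpace I x)]
  [IsRiemannianManifold I M] [MeasurableSpace M] [BorelSpace M]

/-- By compactness, the growth of the demand near each point holds uniformly in the rationality. -/
theorem exists_forall_demandGrows [Nonempty M] (hd : 0 < d) {n : ℝ} (hn : 1 < n) :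
    ∃ β₀ > 0, ∀ β > β₀, ∀ ybar : M, DemandGrows (riemannianVolume I M) n β ybar := by
  have := isFiniteMeasure_riemannianVolume (I := I) (M := M)
  have := isOpenPosMeasure_riemannianVolume (I := I) (M := M)
  have : NeZero (riemannianVolume I M) :=
    ⟨fun h => isOpen_univ.measure_ne_zero (riemannianVolume I M) univ_nonempty (by simp [h])⟩
  have hloc : ∀ q : M, ∃ δ > 0, ∃ β₀ > 0, ∀ ybar, dist ybar q < δ → ∀ β > β₀,
      DemandGrows (riemannianVolume I M) n β ybar := by
    intro q
    by_cases hq : extChartAt I q q ∈ interior (range I)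
    · obtain ⟨δ, hδ, C', hC, κ, hκ, h₁, hh₁, h⟩ :=
        exists_integral_second_difference_le_of_mem_interior hd q hq
      obtain ⟨β₀, hβ₀, h'⟩ := exists_demandGrows_of_integral_le (μ := riemannianVolume I M) hn hC hκ
      exact ⟨δ, hδ, β₀, hβ₀, fun ybar hy β hβ => h' ybar h₁ hh₁ (h ybar hy) β hβ⟩
    · obtain ⟨δ, hδ, h⟩ := exists_integral_dist_decrease_of_notMem_interior hd q hq
      refine ⟨δ, hδ, 1, one_pos, fun ybar hy β hβ => ?_⟩
      obtain ⟨η, hη, h⟩ := h ybar hy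
      exact demandGrows_of_integral_le hn hη h (one_pos.trans hβ)
  choose δ hδ β₀ hβ₀ h using hloc
  obtain ⟨t, ht⟩ := isCompact_univ.elim_nhds_subcover (fun q => Metric.ball q (δ q))
    fun q _ => Metric.ball_mem_nhds q (hδ q)
  refine ⟨∑ q ∈ t, β₀ q + 1, add_pos_of_nonneg_of_pos
    (Finset.sum_nonneg fun q _ => (hβ₀ q).le) one_pos, fun β hβ ybar => ?_⟩
  obtain ⟨q, hqt, hq⟩ := mem_iUnion₂.1 (ht.2 (mem_univ ybar))
  refine h q ybar hq β ?_
  have := Finset.single_le_sum (f := β₀) (fun q _ => (hβ₀ q).le) hqt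
  change β₀ q < β
  linarith

end

/-! ### Concentrated equilibria with softmin consumers -/

section Choice

variable {N : ℕ} {M : Type*}

lemma IsConcentrated.exists_eq_const {y : Fin N → M} (hy : IsConcentrated y) (i : Fin N) :
    y = fun _ => y i :=
  funext fun j => hy j i

lemma sum_eq_add_sum_erase (f : Fin N → ℝ) (i : Fin N) :
    ∑ k, f k = f i + ∑ k ∈ Finset.univ.erase i, f k :=
  (Finset.add_sum_erase Finset.univ f (Finset.mem_univ i)).symm

/-- When all firms are at the same point, the distances cancel, and so the choice depends only on
the prices. -/
lemma softminChoice_update_price [Dist M] (β : ℝ) (p : Fin N → ℝ) (ybar : M) (i : Fin N) (q : ℝ)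
    (x : M) :
    softminChoice β (Function.update p i q) (fun _ => ybar) i x =
      Real.exp (-β * q) /
        (Real.exp (-β * q) + ∑ k ∈ Finset.univ.erase i, Real.exp (-β * p k)) := by
  have h : ∀ r : ℝ, Real.exp (-β * (dist x ybar + r)) =
      Real.exp (-β * dist x ybar) * Real.exp (-β * r) := fun r => by
    rw [mul_add, Real.exp_add]
  simp only [softminChoice, h]
  rw [← Finset.mul_sum, mul_div_mul_left _ _ (Real.exp_pos _).ne', sum_eq_add_sum_erase _ i,
    Function.update_self, Finset.sum_congr rfl fun k hk => by
      rw [Function.update_of_ne (Finset.ne_of_mem_erase hk)]]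

lemma softminChoice_update_location [Dist M] (β pbar : ℝ) (ybar z : M) (i : Fin N) (x : M) :
    softminChoice β (fun _ => pbar) (Function.update (fun _ => ybar) i z) i x =
      1 / (1 + ((N : ℝ) - 1) * Real.exp (β * (dist x z - dist x ybar))) := by
  have hN : 1 ≤ N := i.pos
  have h : ((Finset.univ.erase i).card : ℝ) = (N : ℝ) - 1 := by
    rw [Finset.card_erase_of_mem (Finset.mem_univ i), Finset.card_univ, Fintype.card_fin,
      Nat.cast_sub hN, Nat.cast_one]
  simp only [softminChoice]
  rw [sum_eq_add_sum_erase _ i, Function.update_self, Finset.sum_congr rfl fun k hk => by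
    rw [Function.update_of_ne (Finset.ne_of_mem_erase hk)], Finset.sum_const, nsmul_eq_mul, h]
  have h2 : Real.exp (-β * (dist x ybar + pbar)) = Real.exp (-β * (dist x z + pbar)) *
      Real.exp (β * (dist x z - dist x ybar)) := by
    rw [← Real.exp_add]; ring_nf
  rw [h2, mul_left_comm, ← mul_one_add, ← div_div, div_self (Real.exp_pos _).ne']

end Choice

section Game

variable {d : ℕ} {H : Type*} [TopologicalSpace H]
  {I : ModelWithCorners ℝ (EuclideanSpace ℝ (Fin d)) H}
  {M : Type*} [MetricSpace M] [ChartedSpace H M]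
  [RiemannianBundle (fun x : M => TangentSpace I x)] [MeasurableSpace M] {N : ℕ}

lemma IsNashEquilibrium.isLocalNashEquilibrium {f : ChoiceRule N M} {c : ℝ}
    {p : Fin N → ℝ} {y : Fin N → M} (h : IsNashEquilibrium I f c p y) :
    IsLocalNashEquilibrium I f c p y :=
  ⟨h.1, fun i => eventually_mem_nhdsWithin.mono fun q hq => h.2 i q hq⟩

/-- Joint deviations of price and location that are closer than some `ε` are not profitable. -/
lemma IsLocalNashEquilibrium.exists_forall_le {f : ChoiceRule N M} {c : ℝ}
    {p : Fin N → ℝ} {y : Fin N → M} (h : IsLocalNashEquilibrium I f c p y) (i : Fin N) :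
    ∃ ε > 0, ∀ q z, c ≤ q → |q - p i| < ε → dist z (y i) < ε →
      deviationProfit I f c p y i (q, z) ≤ profit I f c p y i := by
  obtain ⟨ε, hε, hball⟩ := Metric.mem_nhdsWithin_iff.1 (h.2 i)
  refine ⟨ε, hε, fun q z hq hqp hz => hball ⟨?_, hq, mem_univ z⟩⟩
  rw [Metric.mem_ball, Prod.dist_eq, max_lt_iff, Real.dist_eq]
  exact ⟨hqp, hz⟩

section Softmin

variable [IsFiniteMeasure (riemannianVolume I M)] [NeZero (riemannianVolume I M)]

lemma demand_softminChoice_update_price (β : ℝ) (p : Fin N → ℝ) (ybar : M) (i : Fin N) (q : ℝ) :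
    demand I (softminChoice β) (Function.update p i q) (fun _ => ybar) i =
      Real.exp (-β * q) /
        (Real.exp (-β * q) + ∑ k ∈ Finset.univ.erase i, Real.exp (-β * p k)) := by
  simp only [demand, softminChoice_update_price, average_const]

/-- The first-order condition for the prices of a concentrated local equilibrium. -/
lemma IsLocalNashEquilibrium.price_condition (hN : 1 < N) {β : ℝ} {c : ℝ} {p : Fin N → ℝ}
    {ybar : M} (h : IsLocalNashEquilibrium I (softminChoice β) c p fun _ => ybar) (i : Fin N) :
    c < p i ∧ ∑ k, Real.exp (-β * p k) =
      β * (p i - c) * (∑ k, Real.exp (-β * p k) - Real.exp (-β * p i)) := by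
  obtain ⟨ε, hε, hle⟩ := h.exists_forall_le i
  set S := ∑ k ∈ Finset.univ.erase i, Real.exp (-β * p k) with hS
  have hS0 : 0 < S := by
    refine Finset.sum_pos (fun k _ => Real.exp_pos _) ?_
    rw [← Finset.card_pos, Finset.card_erase_of_mem (Finset.mem_univ i), Finset.card_univ,
      Fintype.card_fin]
    omega
  set φ : ℝ → ℝ := fun q => (q - c) * (Real.exp (-β * q) / (Real.exp (-β * q) + S)) with hφ
  have hdev : ∀ q, deviationProfit I (softminChoice β) c p (fun _ => ybar) i (q, ybar) = φ q := by
    intro q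
    have hy : Function.update (fun _ : Fin N => ybar) i ybar = fun _ => ybar :=
      Function.update_eq_self i fun _ => ybar
    rw [deviationProfit, profit, hy, demand_softminChoice_update_price, Function.update_self]
  have hprof : profit I (softminChoice β) c p (fun _ => ybar) i = φ (p i) := by
    rw [← hdev, deviationProfit, Function.update_eq_self]
    congr 1
    exact (Function.update_eq_self i fun _ => ybar).symm
  have hφle : ∀ q, c ≤ q → |q - p i| < ε → φ q ≤ φ (p i) := by
    intro q hq hqp
    rw [← hdev, ← hprof]
    exact hle q ybar hq hqp (by simpa using hε)
  have hci : c < p i := by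
    -- a firm that sells at the unit cost earns nothing, and would gain by raising its price
    refine lt_of_le_of_ne (h.1 i) fun heq => ?_
    have h1 := hφle (p i + ε / 2) (by linarith [h.1 i])
      (by rw [add_sub_cancel_left, abs_of_pos] <;> linarith)
    have h2 : 0 < φ (p i + ε / 2) := mul_pos (by linarith) (by positivity)
    have h3 : φ (p i) = 0 := by simp [hφ, ← heq]
    linarith
  refine ⟨hci, ?_⟩
  have hmax : IsLocalMax φ (p i) := by
    have h1 : ∀ᶠ q in 𝓝 (p i), c ≤ q := eventually_ge_nhds hci
    have h2 : ∀ᶠ q in 𝓝 (p i), |q - p i| < ε := by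
      exact Metric.ball_mem_nhds (p i) hε
    filter_upwards [h1, h2] with q hq1 hq2 using hφle q hq1 hq2
  set E := Real.exp (-β * p i) with hE
  have hE0 : 0 < E := Real.exp_pos _
  have hexp : HasDerivAt (fun q => Real.exp (-β * q)) (E * (-β)) (p i) := by
    simpa [hE] using ((hasDerivAt_id (p i)).const_mul (-β)).exp
  have hder : HasDerivAt φ (1 * (E / (E + S)) +
      (p i - c) * ((E * (-β) * (E + S) - E * (E * (-β))) / (E + S) ^ 2)) (p i) :=
    ((hasDerivAt_id (p i)).sub_const c).mul (hexp.div (hexp.add_const S) (by positivity))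
  have h0 := hmax.hasDerivAt_eq_zero hder
  rw [sum_eq_add_sum_erase _ i, ← hS, ← hE, add_sub_cancel_left]
  have h1 : 1 * (E / (E + S)) + (p i - c) * ((E * (-β) * (E + S) - E * (E * (-β))) / (E + S) ^ 2) =
      E / (E + S) ^ 2 * (E + S - β * (p i - c) * S) := by
    field_simp
    ring
  rw [h1, mul_eq_zero] at h0
  rcases h0 with h0 | h0
  · exact absurd h0 (by positivity)
  · linarith

/-- In a concentrated local equilibrium all the prices are equal: in the first-order condition,
a higher price gives a larger right-hand side. -/
lemma IsLocalNashEquilibrium.price_eq (hN : 1 < N) {β : ℝ} (hβ : 0 < β) {c : ℝ} {p : Fin N → ℝ}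
    {ybar : M} (h : IsLocalNashEquilibrium I (softminChoice β) c p fun _ => ybar) (i j : Fin N) :
    p i = p j := by
  have key : ∀ i j, ¬ p i < p j := by
    intro i j hij
    obtain ⟨hi, ei⟩ := h.price_condition hN i
    obtain ⟨hj, ej⟩ := h.price_condition hN j
    set T := ∑ k, Real.exp (-β * p k) with hT
    have hT0 : 0 < T := Finset.sum_pos (fun k _ => Real.exp_pos _) ⟨i, Finset.mem_univ i⟩
    have h1 : 0 < β * (p i - c) := mul_pos hβ (by linarith)
    have h2 : 0 < T - Real.exp (-β * p i) := pos_of_mul_pos_right (ei ▸ hT0) h1.le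
    have h3 : Real.exp (-β * p j) < Real.exp (-β * p i) := Real.exp_lt_exp.2 (by nlinarith)
    have h4 : β * (p i - c) < β * (p j - c) := by gcongr
    have h5 : β * (p i - c) * (T - Real.exp (-β * p i)) <
        β * (p j - c) * (T - Real.exp (-β * p j)) := by
      apply mul_lt_mul h4 (by linarith) h2 (by linarith)
    linarith
  exact le_antisymm (not_lt.1 (key j i)) (not_lt.1 (key i j))

omit [IsFiniteMeasure (riemannianVolume I M)] [NeZero (riemannianVolume I M)] in
/-- The profit of a firm which leaves the common location with the common price. -/
lemma deviationProfit_location (β c pbar : ℝ) (ybar z : M) (i : Fin N) :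
    deviationProfit I (softminChoice β) c (fun _ => pbar) (fun _ => ybar) i (pbar, z) =
      (pbar - c) * ⨍ x, 1 / (1 + ((N : ℝ) - 1) * Real.exp (β * (dist x z - dist x ybar)))
        ∂(riemannianVolume I M) := by
  have hp : Function.update (fun _ : Fin N => pbar) i pbar = fun _ => pbar :=
    Function.update_eq_self i fun _ => pbar
  rw [deviationProfit, profit, hp, demand]
  simp only [softminChoice_update_location]

lemma profit_concentrated (β c pbar : ℝ) (ybar : M) (i : Fin N) :
    profit I (softminChoice β) c (fun _ => pbar) (fun _ => ybar) i = (pbar - c) * (1 / N) := by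
  have h : profit I (softminChoice β) c (fun _ => pbar) (fun _ => ybar) i =
      deviationProfit I (softminChoice β) c (fun _ => pbar) (fun _ => ybar) i (pbar, ybar) := by
    rw [deviationProfit]
    congr 1
    · exact (Function.update_eq_self i fun _ => pbar).symm
    · exact (Function.update_eq_self i fun _ => ybar).symm
  rw [h, deviationProfit_location]
  simp only [sub_self, mul_zero, Real.exp_zero, mul_one, add_sub_cancel, average_const]

/-- Where the demand grows, firms at the same point with the same price are not in a local
equilibrium. -/
theorem DemandGrows.not_isLocalNashEquilibrium (hN : 1 < N) {β : ℝ} (hβ : 0 < β)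
    {ybar : M} (hgrow : DemandGrows (riemannianVolume I M) ((N : ℝ) - 1) β ybar) (c : ℝ)
    (p : Fin N → ℝ) : ¬ IsLocalNashEquilibrium I (softminChoice β) c p fun _ => ybar := by
  intro h
  let i : Fin N := ⟨0, by omega⟩
  have hc := (h.price_condition hN i).1
  have hp : p = fun _ => p i := funext fun j => h.price_eq hN hβ j i
  set pbar := p i with hpbar
  clear_value pbar
  subst hp
  obtain ⟨ε, hε, hle⟩ := h.exists_forall_le i
  obtain ⟨η, hη, hg⟩ := hgrow
  obtain ⟨z, hne, hz, hav⟩ := hg ε hε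
  have h1 := hle pbar z hc.le (by simpa using hε) hz
  rw [deviationProfit_location, profit_concentrated] at h1
  rw [sub_add_cancel] at hav
  have h2 := le_of_mul_le_mul_left h1 (by linarith)
  have h3 : 0 < η * dist z ybar ^ 2 := mul_pos hη (pow_pos (dist_pos.2 hne) 2)
  linarith

end Softmin

end Game

/-! ### Concentrated equilibria with rational consumers -/

section RationalChoice

variable {N : ℕ} {M : Type*}

lemma rationalChoice_nonneg [Dist M] (p : Fin N → ℝ) (y : Fin N → M) (i : Fin N) (x : M) :
    0 ≤ rationalChoice p y i x := by
  rw [rationalChoice]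
  split_ifs <;> positivity

lemma rationalChoice_le_one [Dist M] (p : Fin N → ℝ) (y : Fin N → M) (i : Fin N) (x : M) :
    rationalChoice p y i x ≤ 1 := by
  rw [rationalChoice]
  split_ifs with h
  · have : 1 ≤ (cheapestFirms p y x).card := Finset.card_pos.2 ⟨i, h⟩
    exact inv_le_one_of_one_le₀ (by exact_mod_cast this)
  · exact zero_le_one

lemma mem_cheapestFirms [Dist M] {p : Fin N → ℝ} {y : Fin N → M} {x : M} {i : Fin N} :
    i ∈ cheapestFirms p y x ↔ ∀ k, dist x (y i) + p i ≤ dist x (y k) + p k := by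
  simp [cheapestFirms]

lemma rationalChoice_eq_one [Dist M] {p : Fin N → ℝ} {y : Fin N → M} {i : Fin N} {x : M}
    (h : ∀ k ≠ i, dist x (y i) + p i < dist x (y k) + p k) : rationalChoice p y i x = 1 := by
  have hs : cheapestFirms p y x = {i} := by
    ext j
    rw [mem_cheapestFirms, Finset.mem_singleton]
    refine ⟨fun hj => ?_, ?_⟩
    · by_contra hne
      exact (h j hne).not_ge (hj i)
    · rintro rfl k
      by_cases hk : k = j
      · rw [hk]
      · exact (h k hk).le
  simp [rationalChoice, hs]

lemma rationalChoice_le_half [Dist M] {p : Fin N → ℝ} {y : Fin N → M} {i j : Fin N} {x : M}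
    (hij : j ≠ i) (h : dist x (y j) + p j ≤ dist x (y i) + p i) :
    rationalChoice p y i x ≤ 1 / 2 := by
  rw [rationalChoice]
  split_ifs with hi
  · have hj : j ∈ cheapestFirms p y x :=
      mem_cheapestFirms.2 fun k => h.trans (mem_cheapestFirms.1 hi k)
    have hc : 1 < (cheapestFirms p y x).card := Finset.one_lt_card.2 ⟨j, hj, i, hi, hij⟩
    have hc' : (2 : ℝ) ≤ (cheapestFirms p y x).card := by exact_mod_cast hc
    rw [one_div]
    gcongr
  · norm_num

/-- The choice of rational consumers is measurable, as the limit of the softmin choices. -/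
lemma measurable_rationalChoice [MetricSpace M] [MeasurableSpace M] [BorelSpace M]
    (p : Fin N → ℝ) (y : Fin N → M) (i : Fin N) : Measurable (rationalChoice p y i) := by
  refine measurable_of_tendsto_metrizable (f := fun n : ℕ => softminChoice (n : ℝ) p y i) ?_
    (tendsto_pi_nhds.2 fun x => (tendsto_softminChoice p y i x).comp tendsto_natCast_atTop_atTop)
  intro n
  refine Continuous.measurable ?_
  unfold softminChoice
  refine Continuous.div (by fun_prop) (by fun_prop) fun x => ?_
  exact (Finset.sum_pos (fun k _ => Real.exp_pos _) ⟨i, Finset.mem_univ i⟩).ne'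

end RationalChoice

section RationalGame

variable {d : ℕ} {H : Type*} [TopologicalSpace H]
  {I : ModelWithCorners ℝ (EuclideanSpace ℝ (Fin d)) H}
  {M : Type*} [MetricSpace M] [ChartedSpace H M]
  [RiemannianBundle (fun x : M => TangentSpace I x)] [MeasurableSpace M] [BorelSpace M] {N : ℕ}
  [IsFiniteMeasure (riemannianVolume I M)]

lemma integrable_rationalChoice (p : Fin N → ℝ) (y : Fin N → M) (i : Fin N) :
    Integrable (rationalChoice p y i) (riemannianVolume I M) :=
  Integrable.of_bound (measurable_rationalChoice p y i).aestronglyMeasurable 1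
    (Eventually.of_forall fun x => by
      rw [Real.norm_of_nonneg (rationalChoice_nonneg p y i x)]
      exact rationalChoice_le_one p y i x)

variable [NeZero (riemannianVolume I M)]

omit [BorelSpace M] in
/-- A firm which is strictly cheapest for all consumers has the whole demand. -/
lemma demand_eq_one {p : Fin N → ℝ} {y : Fin N → M} {i : Fin N}
    (h : ∀ k ≠ i, ∀ x, dist x (y i) + p i < dist x (y k) + p k) :
    demand I rationalChoice p y i = 1 := by
  have : rationalChoice p y i = fun _ : M => (1 : ℝ) :=
    funext fun x => rationalChoice_eq_one fun k hk => h k hk x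
  rw [demand]
  simp only [this, average_const]

/-- A firm that is never cheaper than some other one has at most half of the demand. -/
lemma demand_le_half {p : Fin N → ℝ} {y : Fin N → M} {i j : Fin N} (hij : j ≠ i)
    (h : ∀ x, dist x (y j) + p j ≤ dist x (y i) + p i) :
    demand I rationalChoice p y i ≤ 1 / 2 := by
  have h1 : (⨍ _ : M, (1 / 2 : ℝ) ∂(riemannianVolume I M)) = 1 / 2 := average_const _ _
  rw [demand, ← h1, average_eq, average_eq]
  exact smul_le_smul_of_nonneg_left (integral_mono (integrable_rationalChoice p y i)
    (integrable_const _) fun x => rationalChoice_le_half hij (h x)) (by positivity)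

/-- A firm which is strictly cheapest for the consumers of a nonempty open set has a positive
demand. -/
lemma demand_pos {p : Fin N → ℝ} {y : Fin N → M} {i : Fin N} {U : Set M}
    [(riemannianVolume I M).IsOpenPosMeasure] (hU : IsOpen U) (hne : U.Nonempty)
    (h : ∀ k ≠ i, ∀ x ∈ U, dist x (y i) + p i < dist x (y k) + p k) :
    0 < demand I rationalChoice p y i := by
  have hm : 0 < (riemannianVolume I M).real univ := by
    rw [Measure.real, ENNReal.toReal_pos_iff]
    exact ⟨Measure.measure_univ_pos.2 (NeZero.ne _), measure_lt_top _ _⟩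
  have hU0 : 0 < (riemannianVolume I M).real U :=
    ENNReal.toReal_pos (hU.measure_pos _ hne).ne' (measure_ne_top _ _)
  rw [demand, average_eq]
  refine mul_pos (inv_pos.2 hm) (lt_of_lt_of_le hU0 ?_)
  have h1 : ∫ x, U.indicator (fun _ => (1 : ℝ)) x ∂(riemannianVolume I M) =
      (riemannianVolume I M).real U := by
    rw [integral_indicator_const _ hU.measurableSet, smul_eq_mul, mul_one]
  rw [← h1]
  refine integral_mono ((integrable_const _).indicator hU.measurableSet)
    (integrable_rationalChoice p y i) fun x => ?_
  by_cases hx : x ∈ U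
  · rw [indicator_of_mem hx, rationalChoice_eq_one fun k hk => h k hk x hx]
  · rw [indicator_of_notMem hx]
    exact rationalChoice_nonneg p y i x

/-- With perfectly rational consumers, a cheapest firm of a concentrated profile always has a
profitable deviation: if it is alone to be cheapest it raises its price, if it shares its demand
with others it undercuts them, and if they all sell at the unit cost it moves away and raises its
price, keeping the consumers near its new location. -/
theorem not_isLocalNashEquilibrium_rationalChoice [(riemannianVolume I M).IsOpenPosMeasure]
    (hN : 0 < N) {ybar : M} (hacc : ∀ ε > 0, ∃ z, z ≠ ybar ∧ dist z ybar < ε) (c : ℝ)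
    (p : Fin N → ℝ) : ¬ IsLocalNashEquilibrium I rationalChoice c p fun _ => ybar := by
  intro h
  obtain ⟨i, -, hi⟩ := Finset.exists_min_image Finset.univ p
    ⟨(⟨0, hN⟩ : Fin N), Finset.mem_univ _⟩
  have hi' : ∀ k, p i ≤ p k := fun k => hi k (Finset.mem_univ k)
  have hci := h.1 i
  obtain ⟨ε, hε, hle⟩ := h.exists_forall_le i
  have hy : Function.update (fun _ : Fin N => ybar) i ybar = fun _ => ybar :=
    Function.update_eq_self i fun _ => ybar
  have hself : dist ybar ybar < ε := by simpa using hε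
  by_cases htie : ∃ j, j ≠ i ∧ p j = p i
  · obtain ⟨j, hj, hpj⟩ := htie
    have hhalf : demand I rationalChoice p (fun _ => ybar) i ≤ 1 / 2 :=
      demand_le_half hj fun x => by rw [hpj]
    rcases hci.lt_or_eq with hlt | heq
    · -- undercutting
      set q := p i - min (ε / 2) ((p i - c) / 3) with hq
      have hmin : 0 < min (ε / 2) ((p i - c) / 3) := lt_min (by linarith) (by linarith)
      have hm1 : min (ε / 2) ((p i - c) / 3) ≤ ε / 2 := min_le_left _ _
      have hm2 : min (ε / 2) ((p i - c) / 3) ≤ (p i - c) / 3 := min_le_right _ _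
      have h1 := hle q ybar (by linarith) (by rw [hq, abs_lt]; constructor <;> linarith) hself
      have h2 : demand I rationalChoice (Function.update p i q) (fun _ => ybar) i = 1 := by
        refine demand_eq_one fun k hk x => ?_
        rw [Function.update_self, Function.update_of_ne hk]
        linarith [hi' k]
      rw [deviationProfit, profit, profit, hy, h2, Function.update_self, mul_one] at h1
      have h3 : (p i - c) * demand I rationalChoice p (fun _ => ybar) i ≤ (p i - c) * (1 / 2) := by
        gcongr
      linarith
    · -- moving away from the other firms
      obtain ⟨z, hne, hz⟩ := hacc ε hε
      have hD : 0 < dist z ybar := dist_pos.2 hne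
      set D := dist z ybar with hDdef
      have h1 := hle (c + D / 4) z (by linarith)
        (by rw [← heq, add_sub_cancel_left, abs_of_pos] <;> linarith) hz
      have h2 : 0 < demand I rationalChoice (Function.update p i (c + D / 4))
          (Function.update (fun _ => ybar) i z) i := by
        refine demand_pos (Metric.isOpen_ball (x := z) (ε := D / 4))
          ⟨z, Metric.mem_ball_self (by linarith)⟩ fun k hk x hx => ?_
        rw [Function.update_self, Function.update_self, Function.update_of_ne hk,
          Function.update_of_ne hk]
        have h3 : dist x z < D / 4 := hx
        have h4 := dist_triangle_left z ybar x
        linarith [hi' k]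
      rw [deviationProfit, profit, profit, Function.update_self, ← heq, sub_self, zero_mul,
        add_sub_cancel_left] at h1
      exact h1.not_gt (mul_pos (by linarith) h2)
  · -- raising the price
    push Not at htie
    have hgt : ∀ k ≠ i, p i < p k := fun k hk => lt_of_le_of_ne (hi' k) (htie k hk).symm
    obtain ⟨q, hq1, hq2, hq3⟩ : ∃ q, p i < q ∧ q < p i + ε ∧ ∀ k ≠ i, q < p k := by
      have h1 : ∀ᶠ q in 𝓝[>] p i, ∀ k ≠ i, q < p k := by
        refine eventually_all.2 fun k => ?_
        by_cases hk : k = i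
        · exact Eventually.of_forall fun _ h => absurd hk h
        · exact (eventually_nhdsWithin_of_eventually_nhds
            (eventually_lt_nhds (hgt k hk))).mono fun _ h _ => h
      have h2 : ∀ᶠ q in 𝓝[>] p i, q < p i + ε :=
        eventually_nhdsWithin_of_eventually_nhds (eventually_lt_nhds (by linarith))
      obtain ⟨q, ⟨hq1, hq2⟩, hq3⟩ := ((h1.and h2).and eventually_mem_nhdsWithin).exists
      exact ⟨q, hq3, hq2, hq1⟩
    have h1 := hle q ybar (by linarith) (by rw [abs_lt]; constructor <;> linarith) hself
    have h2 : demand I rationalChoice (Function.update p i q) (fun _ => ybar) i = 1 := by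
      refine demand_eq_one fun k hk x => ?_
      rw [Function.update_self, Function.update_of_ne hk]
      linarith [hq3 k hk]
    have h3 : demand I rationalChoice p (fun _ => ybar) i = 1 :=
      demand_eq_one fun k hk x => by linarith [hgt k hk]
    rw [deviationProfit, profit, profit, hy, h2, h3, Function.update_self] at h1
    linarith

end RationalGame

/-! ### The Hessian of the profit -/

/-- If a function with vanishing gradient at `a` grows quadratically along some points that tend to
`a`, then its Hessian at `a` is positive in some direction. -/
lemma exists_fderiv_fderiv_pos {E : Type*} [NormedAddCommGroup E] [NormedSpace ℝ E] {f : E → ℝ}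
    {a : E} (hf : ∀ᶠ z in 𝓝 a, DifferentiableAt ℝ f z)
    (hf2 : DifferentiableAt ℝ (fderiv ℝ f) a) (h0 : fderiv ℝ f a = 0) {η : ℝ} (hη : 0 < η)
    (hgrow : ∃ᶠ z in 𝓝 a, z ≠ a ∧ f a + η * ‖z - a‖ ^ 2 ≤ f z) :
    ∃ v, 0 < fderiv ℝ (fderiv ℝ f) a v v := by
  by_contra! hneg
  have hlit := hf2.hasFDerivAt.isLittleO.def (half_pos hη)
  obtain ⟨r, hr, hball⟩ := Metric.eventually_nhds_iff_ball.1 (hf.and hlit)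
  obtain ⟨z, ⟨hne, hz⟩, hzr⟩ := (hgrow.and_eventually (Metric.ball_mem_nhds a hr)).exists
  set w := z - a with hw
  have hw0 : 0 < ‖w‖ := norm_pos_iff.2 (sub_ne_zero.2 hne)
  have hwr : ‖w‖ < r := mem_ball_iff_norm.1 hzr
  have hmem : ∀ t ∈ Icc (0 : ℝ) 1, a + t • w ∈ Metric.ball a r := by
    intro t ht
    rw [mem_ball_iff_norm, add_sub_cancel_left, norm_smul, Real.norm_of_nonneg ht.1]
    nlinarith [ht.2]
  have hder : ∀ t ∈ Icc (0 : ℝ) 1,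
      HasDerivAt (fun t : ℝ => f (a + t • w)) (fderiv ℝ f (a + t • w) w) t := by
    intro t ht
    have h1 : HasDerivAt (fun t : ℝ => a + t • w) w t := by
      simpa using ((hasDerivAt_id t).smul_const w).const_add a
    exact ((hball _ (hmem t ht)).1.hasFDerivAt).comp_hasDerivAt t h1
  -- mean value theorem on the segment; the derivative there is given by the Hessian up to `η / 2`
  obtain ⟨t, ht, heq⟩ := exists_hasDerivAt_eq_slope (fun t : ℝ => f (a + t • w))
    (fun t => fderiv ℝ f (a + t • w) w) one_pos
    (fun t ht => (hder t ht).continuousAt.continuousWithinAt)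
    fun t ht => hder t (Ioo_subset_Icc_self ht)
  have ht' := Ioo_subset_Icc_self ht
  have h2 := (hball _ (hmem t ht')).2
  rw [h0, sub_zero, add_sub_cancel_left, map_smul, norm_smul, Real.norm_of_nonneg ht'.1] at h2
  have h3 := (fderiv ℝ f (a + t • w) - t • fderiv ℝ (fderiv ℝ f) a w).le_opNorm w
  rw [sub_apply, smul_apply, smul_eq_mul, Real.norm_eq_abs] at h3
  have h4 : t * fderiv ℝ (fderiv ℝ f) a w w ≤ 0 :=
    mul_nonpos_of_nonneg_of_nonpos ht'.1 (hneg w)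
  have h5 : fderiv ℝ f (a + t • w) w ≤ η / 2 * ‖w‖ ^ 2 := by
    have h6 := (le_abs_self _).trans h3
    have h7 : ‖fderiv ℝ f (a + t • w) - t • fderiv ℝ (fderiv ℝ f) a w‖ * ‖w‖ ≤
        η / 2 * (1 * ‖w‖) * ‖w‖ := by
      refine mul_le_mul_of_nonneg_right (h2.trans ?_) hw0.le
      gcongr
      exact ht'.2
    linarith
  simp only [zero_smul, one_smul, add_zero, sub_zero, div_one] at heq
  rw [hw, add_sub_cancel, ← hw] at heq
  have : 0 < η * ‖w‖ ^ 2 := by positivity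
  linarith

section

variable {d : ℕ} {H : Type*} [TopologicalSpace H]
  {I : ModelWithCorners ℝ (EuclideanSpace ℝ (Fin d)) H}
  {M : Type*} [MetricSpace M] [ChartedSpace H M] [IsManifold I ∞ M]
  [RiemannianBundle (fun x : M => TangentSpace I x)]
  [IsContMDiffRiemannianBundle I ∞ (EuclideanSpace ℝ (Fin d)) (fun x : M => TangentSpace I x)]
  [IsRiemannianManifold I M]

/-- The distance to the centre of a chart is comparable to the distance between coordinates. -/
lemma exists_norm_extChartAt_sub_le (q : M) :
    ∃ C > 0, ∀ᶠ y in 𝓝 q, ‖extChartAt I q y - extChartAt I q q‖ ≤ C * dist y q := by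
  obtain ⟨𝓒, -, hK, he, hz₀, -, hdom, -⟩ := exists_metricChart (I := I) q one_pos
  have heq : 𝓒.e 𝓒.z₀ = q := by rw [he, hz₀, extChartAt_to_inv]
  obtain ⟨δ, hδ, himg⟩ := 𝓒.exists_dist_lt_imp 𝓒.s_pos
  refine ⟨𝓒.C, 𝓒.C_pos, ?_⟩
  filter_upwards [Metric.ball_mem_nhds q hδ] with y hy
  obtain ⟨a, ha, rfl⟩ := himg y (by rw [heq]; exact hy)
  have h1 := 𝓒.norm_sub_le_mul_dist
    ⟨𝓒.z₀_mem, Metric.mem_ball_self 𝓒.s_pos⟩ ha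
  have h2 : extChartAt I q (𝓒.e a) = a := by
    rw [he]
    exact (extChartAt I q).right_inv (hdom (𝓒.small_subset_dom ha))
  rw [h2, ← hz₀, dist_comm]
  rwa [heq] at h1

variable [MeasurableSpace M] [IsFiniteMeasure (riemannianVolume I M)]
  [NeZero (riemannianVolume I M)] {N : ℕ}

/-- Growth of the demand, measured by the distance of `M`, is quadratic growth of the profit in the
chart at `ybar`. -/
theorem DemandGrows.exists_locationHessian_pos {β : ℝ} {ybar : M}
    (hgrow : DemandGrows (riemannianVolume I M) ((N : ℝ) - 1) β ybar) {c pbar : ℝ} (hc : c < pbar)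
    (i : Fin N)
    (h2 : LocationTwiceDifferentiable I (softminChoice β) c (fun _ => pbar) (fun _ => ybar) i)
    (h1 : LocationFirstOrder I (softminChoice β) c (fun _ => pbar) (fun _ => ybar) i) :
    ∃ v, 0 < locationHessian I (softminChoice β) c (fun _ => pbar) (fun _ => ybar) i v v := by
  obtain ⟨η, hη, hg⟩ := hgrow
  obtain ⟨C, hC, hcomp⟩ := exists_norm_extChartAt_sub_le (I := I) ybar
  have hpc : 0 < pbar - c := sub_pos.2 hc
  refine exists_fderiv_fderiv_pos h2.1 h2.2 h1 (η := (pbar - c) * η / C ^ 2) (by positivity) ?_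
  have hfreq : ∃ᶠ y in 𝓝 ybar, y ≠ ybar ∧ 1 / ((N : ℝ) - 1 + 1) + η * dist y ybar ^ 2 ≤
      ⨍ x, 1 / (1 + ((N : ℝ) - 1) * Real.exp (β * (dist x y - dist x ybar)))
        ∂(riemannianVolume I M) := by
    rw [Metric.nhds_basis_ball.frequently_iff]
    intro ε hε
    obtain ⟨y, hne, hlt, hle⟩ := hg ε hε
    exact ⟨y, hlt, hne, hle⟩
  refine (continuousAt_extChartAt (I := I) ybar).frequently
    ((hfreq.and_eventually (hcomp.and (extChartAt_source_mem_nhds (I := I) ybar))).mono ?_)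
  rintro y ⟨⟨hne, hle⟩, hy, hys⟩
  refine ⟨fun h => hne ((extChartAt I ybar).injOn hys (mem_extChartAt_source ybar) h), ?_⟩
  have e1 : ∀ z ∈ (extChartAt I ybar).source,
      locationProfit I (softminChoice β) c (fun _ => pbar) (fun _ => ybar) i
        (extChartAt I ybar z) = (pbar - c) *
        ⨍ x, 1 / (1 + ((N : ℝ) - 1) * Real.exp (β * (dist x z - dist x ybar)))
          ∂(riemannianVolume I M) := by
    intro z hz
    rw [locationProfit, (extChartAt I ybar).left_inv hz, deviationProfit_location]
  rw [e1 y hys, e1 ybar (mem_extChartAt_source ybar)]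
  simp only [sub_self, mul_zero, Real.exp_zero, mul_one, add_sub_cancel, average_const]
  rw [sub_add_cancel] at hle
  have e2 : η / C ^ 2 * ‖extChartAt I ybar y - extChartAt I ybar ybar‖ ^ 2 ≤
      η * dist y ybar ^ 2 := by
    calc _ ≤ η / C ^ 2 * (C * dist y ybar) ^ 2 := by gcongr
      _ = _ := by field_simp
  calc _ = (pbar - c) * (1 / N +
        η / C ^ 2 * ‖extChartAt I ybar y - extChartAt I ybar ybar‖ ^ 2) := by ring
    _ ≤ _ := by gcongr; linarith

end

theorem mainTheorem2
    {d : ℕ} (hd : 0 < d) {H : Type*} [TopologicalSpace H]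
    (I : ModelWithCorners ℝ (EuclideanSpace ℝ (Fin d)) H)
    (M : Type*) [MetricSpace M] [CompactSpace M] [PathConnectedSpace M]
    [MeasurableSpace M] [BorelSpace M]
    [ChartedSpace H M] [IsManifold I ∞ M]
    [RiemannianBundle (fun x : M => TangentSpace I x)]
    [IsContMDiffRiemannianBundle I ∞ (EuclideanSpace ℝ (Fin d)) (fun x : M => TangentSpace I x)]
    [IsRiemannianManifold I M]
    (N : ℕ) (hN : 2 < N) :
    (∃ βbar : ℝ, 0 < βbar ∧ ∀ β : ℝ, βbar < β → ∀ c : ℝ, 0 ≤ c →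
      (∀ (p : Fin N → ℝ) (y : Fin N → M), IsConcentrated y →
        ¬ IsNashEquilibrium I (softminChoice β) c p y ∧
        ¬ IsLocalNashEquilibrium I (softminChoice β) c p y) ∧
      (∀ (pbar : ℝ) (ybar : M) (i : Fin N), c < pbar → I.IsInteriorPoint ybar →
        LocationTwiceDifferentiable I (softminChoice β) c (fun _ => pbar) (fun _ => ybar) i →
        LocationFirstOrder I (softminChoice β) c (fun _ => pbar) (fun _ => ybar) i →
        ∃ v : EuclideanSpace ℝ (Fin d),
          0 < locationHessian I (softminChoice β) c (fun _ => pbar) (fun _ => ybar) i v v)) ∧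
    (∀ c : ℝ, 0 ≤ c → ∀ (p : Fin N → ℝ) (y : Fin N → M), IsConcentrated y →
      ¬ IsNashEquilibrium I rationalChoice c p y ∧
      ¬ IsLocalNashEquilibrium I rationalChoice c p y) := by
  have : Nonempty M := PathConnectedSpace.nonempty
  have := isFiniteMeasure_riemannianVolume (I := I) (M := M)
  have := isOpenPosMeasure_riemannianVolume (I := I) (M := M)
  have : NeZero (riemannianVolume I M) :=
    ⟨fun h => isOpen_univ.measure_ne_zero (riemannianVolume I M) univ_nonempty (by simp [h])⟩
  have hN' : (1 : ℝ) < (N : ℝ) - 1 := by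
    have : (2 : ℝ) < N := by exact_mod_cast hN
    linarith
  let i₀ : Fin N := ⟨0, by omega⟩
  obtain ⟨β₀, hβ₀, hgrow⟩ := exists_forall_demandGrows I M hd hN'
  refine ⟨⟨β₀, hβ₀, fun β hβ c _ => ⟨fun p y hy => ?_, fun pbar ybar i hc _ h2 h1 =>
    (hgrow β hβ ybar).exists_locationHessian_pos hc i h2 h1⟩⟩, fun c _ p y hy => ?_⟩
  · have h := (hgrow β hβ (y i₀)).not_isLocalNashEquilibrium (by omega) (hβ₀.trans hβ) c p
    rw [← hy.exists_eq_const i₀] at h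
    exact ⟨fun hn => h hn.isLocalNashEquilibrium, h⟩
  · have hacc : ∀ ε > 0, ∃ z, z ≠ y i₀ ∧ dist z (y i₀) < ε := fun ε hε => by
      obtain ⟨η, -, hg⟩ := hgrow (β₀ + 1) (lt_add_one β₀) (y i₀)
      obtain ⟨z, hne, hlt, -⟩ := hg ε hε
      exact ⟨z, hne, hlt⟩
    have h := not_isLocalNashEquilibrium_rationalChoice (I := I) (by omega) hacc c p
    rw [← hy.exists_eq_const i₀] at h
    exact ⟨fun hn => h hn.isLocalNashEquilibrium, h⟩
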